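/- Let $K$ be a field and let $B$ be a co-Frobenius Hopf algebra over $K$, that is, a Hopf algebra with a linear functional $\varphi\neq 0$ on $B$ such that $(\iota\otimes\varphi)\Delta(b)=\varphi(b)1$ for all $b\in B$ (a left integral). Then the antipode $S$ of $B$ is bijective. Let $A=\{\varphi(\,\cdot\, b): b\in B\}\subset B^*$, with pairing $\langle a,b\rangle=a(b)$, and with the product and coproduct given by $\langle aa',b\rangle=\langle a,b_{(1)}\rangle\langle a',b_{(2)}\rangle$ and $\langle a_{(1)},b\rangle\langle a_{(2)},b'\rangle=\langle a,bb'\rangle$; this is a regular multiplier Hopf algebra, the dual of $B$. Write $$b\blacktriangleright a=\langle a_{(2)},b\rangle a_{(1)},\quad a\blacktriangleleft b=\langle a_{(1)},b\rangle a_{(2)},\quad b\blacktriangleleft a=\langle a,b_{(1)}\rangle b_{(2)},\quad \langle S^{-1}(a),b\rangle=\langle a,S^{-1}(b)\rangle .$$ Let $\mathscr D=A\bowtie B$ be the Drinfel'd double: the space $A\otimes B$ with $$(a\bowtie b)(a'\bowtie b')=a\big(b_{(1)}\blacktriangleright a'\blacktriangleleft S^{-1}(b_{(3)})\big)\bowtie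 b_{(2)}b',\qquad \Delta(a\bowtie b)=(a_{(2)}\bowtie b_{(1)})\otimes(a_{(1)}\bowtie b_{(2)}),$$ which is a regular multiplier Hopf algebra. Let $\mathscr H=A\# B$ be the Heisenberg double: the space $A\otimes B$ with the associative non-degenerate product $$(a\# b)(a'\# b')=a(b_{(1)}\blacktriangleright a')\# b_{(2)}b'.$$ Then the formula $$(a\bowtie b)\cdot(a'\# b')=a_{(3)}(b_{(1)}\blacktriangleright a')S^{-1}(a_{(2)})\#\big(b_{(2)}b'S(b_{(3)})\big)\blacktriangleleft S^{-1}(a_{(1)})$$ defines an action of $\mathscr D$ on $\mathscr H$, and the formula $$((a'\bowtie b')\otimes1)\Gamma(a\# b)=(a'\bowtie b')(a_{(2)}\bowtie b_{(1)})\otimes(a_{(1)}\# b_{(2)})$$ defines a coaction $\Gamma:\mathscr H\to M_0(\mathscr D\otimes\mathscr H)$, where $M_0(\mathscr D\otimes\mathscr H)$ is the space of pairs of linear maps $\mathscr D\to\mathscr D\otimes\mathscr H$, written $d\mapsto z(d\otimes1)$ and $d\mapsto(d\otimes1)z$, with $(d\otimes1)(z(e\otimes1))=((d\otimes1)z)(e\otimes1)$.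 With these, $\mathscr H$ is a left-left Yetter–Drinfel'd module algebra over $\mathscr D$, that is: 1. $\mathscr H$ is a unital module algebra: $(de)\cdot x=d\cdot(e\cdot x)$, $\mathscr D\cdot\mathscr H=\mathscr H$, and $d\cdot(xy)=(d_{(1)}\cdot x)(d_{(2)}\cdot y)$; 2. $\mathscr H$ is a comodule algebra: $\Gamma$ is injective, $(\Delta\otimes\iota)\Gamma=(\iota\otimes\Gamma)\Gamma$, and $\Gamma(xy)=\Gamma(x)\Gamma(y)$; 3. $(d_{(1)}\cdot x)_{(-1)}d_{(2)}d'\otimes(d_{(1)}\cdot x)_{(0)}=d_{(1)}x_{(-1)}d'\otimes d_{(2)}\cdot x_{(0)}$ for all $d,d'\in\mathscr D$, $x\in\mathscr H$. Moreover $\mathscr H$ is braided $\mathscr D$-commutative: $yx=(y_{(-1)}\cdot x)\,y_{(0)}$ for all $x,y\in\mathscr H$. -/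

import Mathlib

open scoped TensorProduct

noncomputable section

/-! ### Non-degenerate algebras, multiplier Hopf algebras -/

/-- An associative `K`-algebra structure on the vector space `V`, not necessarily with a unit,
whose multiplication is non-degenerate as a bilinear map. -/
structure NondegenerateAlgebra (K V : Type*) [Field K] [AddCommGroup V] [Module K V] where
  mul : V →ₗ[K] V →ₗ[K] V
  mul_assoc : ∀ a b c, mul (mul a b) c = mul a (mul b c)
  eq_zero_of_mul_right : ∀ a, (∀ b, mul a b = 0) → a = 0
  eq_zero_of_mul_left : ∀ a, (∀ b, mul b a = 0) → a = 0

/-- The multiplication of the algebra `V ⊗ V`, `(a ⊗ b)(a' ⊗ b') = aa' ⊗ bb'`. -/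
def NondegenerateAlgebra.mulTensor {K V : Type*} [Field K] [AddCommGroup V] [Module K V]
    (𝒱 : NondegenerateAlgebra K V) : V ⊗[K] V →ₗ[K] V ⊗[K] V →ₗ[K] V ⊗[K] V :=
  TensorProduct.map₂ 𝒱.mul 𝒱.mul

/-- A regular multiplier Hopf algebra structure on the vector space `D`.

The comultiplication is a homomorphism `Δ : D → M(D ⊗ D)` into the multiplier algebra.
A multiplier `m` of an algebra `R` is a pair of maps `x ↦ m x`, `x ↦ x m` of `R` into itself
such that `x (m y) = (x m) y`; the two maps that belong to `Δ(a)` are `comulLeft a` and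
`comulRight a`.  The maps `T₁, T₂, T₃, T₄` express that the multipliers
`Δ(a)(1 ⊗ b)`, `(a ⊗ 1)Δ(b)`, `Δ(a)(b ⊗ 1)`, `(1 ⊗ a)Δ(b)` lie in `D ⊗ D`.  Bijectivity of
`T₁, T₂` is the condition that `(D, Δ)` is a multiplier Hopf algebra, bijectivity of `T₃, T₄`
the same condition for the co-opposite comultiplication. -/
structure RegularMultiplierHopfAlgebra (K D : Type*) [Field K] [AddCommGroup D] [Module K D]
    extends NondegenerateAlgebra K D where
  /-- `comulLeft a u = Δ(a) u` -/
  comulLeft : D →ₗ[K] D ⊗[K] D →ₗ[K] D ⊗[K] D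
  /-- `comulRight a u = u Δ(a)` -/
  comulRight : D →ₗ[K] D ⊗[K] D →ₗ[K] D ⊗[K] D
  comul_multiplier : ∀ a u w,
    toNondegenerateAlgebra.mulTensor u (comulLeft a w) =
      toNondegenerateAlgebra.mulTensor (comulRight a u) w
  comulLeft_mul : ∀ a b u, comulLeft (mul a b) u = comulLeft a (comulLeft b u)
  comulRight_mul : ∀ a b u, comulRight (mul a b) u = comulRight b (comulRight a u)
  /-- `T₁ (a ⊗ b) = Δ(a)(1 ⊗ b)` -/
  T₁ : D ⊗[K] D →ₗ[K] D ⊗[K] D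
  /-- `T₂ (a ⊗ b) = (a ⊗ 1)Δ(b)` -/
  T₂ : D ⊗[K] D →ₗ[K] D ⊗[K] D
  /-- `T₃ (a ⊗ b) = Δ(a)(b ⊗ 1)` -/
  T₃ : D ⊗[K] D →ₗ[K] D ⊗[K] D
  /-- `T₄ (a ⊗ b) = (1 ⊗ a)Δ(b)` -/
  T₄ : D ⊗[K] D →ₗ[K] D ⊗[K] D
  T₁_spec : ∀ a b u,
    toNondegenerateAlgebra.mulTensor (T₁ (a ⊗ₜ[K] b)) u = comulLeft a ((mul b).lTensor D u)
  T₂_spec : ∀ a b u,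
    toNondegenerateAlgebra.mulTensor u (T₂ (a ⊗ₜ[K] b)) = comulRight b ((mul.flip a).rTensor D u)
  T₃_spec : ∀ a b u,
    toNondegenerateAlgebra.mulTensor (T₃ (a ⊗ₜ[K] b)) u = comulLeft a ((mul b).rTensor D u)
  T₄_spec : ∀ a b u,
    toNondegenerateAlgebra.mulTensor u (T₄ (a ⊗ₜ[K] b)) = comulRight b ((mul.flip a).lTensor D u)
  /-- `(a ⊗ 1 ⊗ 1)(Δ ⊗ ι)(Δ(b)(1 ⊗ c)) = (ι ⊗ Δ)((a ⊗ 1)Δ(b))(1 ⊗ 1 ⊗ c)` -/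
  coassoc : ∀ a b c : D,
    TensorProduct.assoc K D D D
        ((T₂ ∘ₗ TensorProduct.mk K D D a).rTensor D (T₁ (b ⊗ₜ[K] c))) =
      (T₁ ∘ₗ (TensorProduct.mk K D D).flip c).lTensor D (T₂ (a ⊗ₜ[K] b))
  T₁_bijective : Function.Bijective T₁
  T₂_bijective : Function.Bijective T₂
  T₃_bijective : Function.Bijective T₃
  T₄_bijective : Function.Bijective T₄

/-! ### Yetter–Drinfel'd module algebras -/

section YetterDrinfeld

variable {K D : Type*} [Field K] [AddCommGroup D] [Module K D]

/-- A left unital module `V` over `D`: an associative action with `D · V = V`. -/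
structure LeftUnitalModule (𝒟 : RegularMultiplierHopfAlgebra K D)
    (V : Type*) [AddCommGroup V] [Module K V] where
  act : D →ₗ[K] V →ₗ[K] V
  mul_act : ∀ d e v, act (𝒟.mul d e) v = act d (act e v)
  unital : Function.Surjective (TensorProduct.lift act)

/-- A left comodule `V` over `D`: an injective, coassociative map `Γ : V → M₀(D ⊗ V)`.

An element `z` of the completed module `M₀(D ⊗ V)` is a pair of maps `D → D ⊗ V`, written
`d ↦ z (d ⊗ 1)` and `d ↦ (d ⊗ 1) z`, such that `(d ⊗ 1)(z (e ⊗ 1)) = ((d ⊗ 1) z)(e ⊗ 1)`. -/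
structure LeftComodule (𝒟 : RegularMultiplierHopfAlgebra K D)
    (V : Type*) [AddCommGroup V] [Module K V] where
  /-- `coactLeft v d = Γ(v)(d ⊗ 1)` -/
  coactLeft : V →ₗ[K] D →ₗ[K] D ⊗[K] V
  /-- `coactRight v d = (d ⊗ 1)Γ(v)` -/
  coactRight : V →ₗ[K] D →ₗ[K] D ⊗[K] V
  coact_compat : ∀ v d e,
    (𝒟.mul d).rTensor V (coactLeft v e) = (𝒟.mul.flip e).rTensor V (coactRight v d)
  coact_injective : Function.Injective fun v => (coactLeft v, coactRight v)
  /-- `(Δ ⊗ ι)Γ = (ι ⊗ Γ)Γ`, multiplied from the left by `(d ⊗ 1)Δ(e) ⊗ 1`; on the left hand side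
  `((d ⊗ 1)Δ(e) ⊗ 1)(Δ ⊗ ι)Γ(v) = (d ⊗ 1 ⊗ 1)(Δ ⊗ ι)((e ⊗ 1)Γ(v))`.  The elements
  `(d ⊗ 1)Δ(e)` span `D ⊗ D`. -/
  coact_coassoc : ∀ d e v,
    TensorProduct.assoc K D D V
        ((𝒟.T₂ ∘ₗ TensorProduct.mk K D D d).rTensor V (coactRight v e)) =
      (TensorProduct.lift coactRight).lTensor D
        (TensorProduct.assoc K D V D ((coactRight v).rTensor D (𝒟.T₂ (d ⊗ₜ[K] e))))

/-- A left-left Yetter–Drinfel'd module over `D`. -/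
structure YetterDrinfeldModule (𝒟 : RegularMultiplierHopfAlgebra K D)
    (V : Type*) [AddCommGroup V] [Module K V]
    extends LeftUnitalModule 𝒟 V, LeftComodule 𝒟 V where
  /-- `(a₍₁₎ · v)₍₋₁₎ a₍₂₎ a' ⊗ (a₍₁₎ · v)₍₀₎ = a₍₁₎ v₍₋₁₎ a' ⊗ a₍₂₎ · v₍₀₎`.  On the left
  `a₍₁₎ ⊗ a₍₂₎ a' = T₁ (a ⊗ a')`; on the right, for `v₍₋₁₎ a' ⊗ v₍₀₎ = Γ(v)(a' ⊗ 1) = ∑ c ⊗ w`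
  one has `∑ a₍₁₎ c ⊗ a₍₂₎ · w` with `a₍₁₎ c ⊗ a₍₂₎ = T₃ (a ⊗ c)`. -/
  yetter_drinfeld : ∀ a a' v,
    TensorProduct.lift (coactLeft ∘ₗ act.flip v) (𝒟.T₁ (a ⊗ₜ[K] a')) =
      (TensorProduct.lift act).lTensor D
        (TensorProduct.assoc K D D V
          ((𝒟.T₃ ∘ₗ TensorProduct.mk K D D a).rTensor V (coactLeft v a')))

/-- A left-left Yetter–Drinfel'd module algebra over `D`: a Yetter–Drinfel'd module on an algebra
which with its action is a module algebra and with its coaction a comodule algebra. -/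
structure YetterDrinfeldModuleAlgebra (𝒟 : RegularMultiplierHopfAlgebra K D)
    {V : Type*} [AddCommGroup V] [Module K V] (𝒱 : NondegenerateAlgebra K V)
    extends YetterDrinfeldModule 𝒟 V where
  /-- `d · (x y) = (d₍₁₎ · x)(d₍₂₎ · y)` for all `x` of the form `e · x'` (these span `V`), so that
  `d₍₁₎ · x ⊗ d₍₂₎ · y = d₍₁₎ e · x' ⊗ d₍₂₎ · y` with `d₍₁₎ e ⊗ d₍₂₎ = T₃ (d ⊗ e)`. -/
  act_mul : ∀ d e x y,
    act d (𝒱.mul (act e x) y) =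
      TensorProduct.lift (𝒱.mul.compl₁₂ (act.flip x) (act.flip y)) (𝒟.T₃ (d ⊗ₜ[K] e))
  /-- `Γ(x y) = Γ(x)Γ(y)`, multiplied from the left by `d ⊗ 1`: if `(d ⊗ 1)Γ(x) = ∑ e ⊗ z` then
  `(d ⊗ 1)Γ(x)Γ(y) = ∑ (1 ⊗ z)((e ⊗ 1)Γ(y))`. -/
  coact_mul : ∀ d x y,
    coactRight (𝒱.mul x y) d =
      (TensorProduct.lift 𝒱.mul.flip).lTensor D
        (TensorProduct.assoc K D V V ((coactRight y).rTensor V (coactRight x d)))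

/-- Braided commutativity `y x = (y₍₋₁₎ · x) y₍₀₎`, for all `x` of the form `d · x'`
(these span `V`), so that the right hand side is `(c · x') w` with `∑ c ⊗ w = Γ(y)(d ⊗ 1)`. -/
def YetterDrinfeldModuleAlgebra.BraidedCommutative {𝒟 : RegularMultiplierHopfAlgebra K D}
    {V : Type*} [AddCommGroup V] [Module K V] {𝒱 : NondegenerateAlgebra K V}
    (Y : YetterDrinfeldModuleAlgebra 𝒟 𝒱) : Prop :=
  ∀ d x y, 𝒱.mul y (Y.act d x) =
    TensorProduct.lift (𝒱.mul ∘ₗ Y.act.flip x) (Y.coactLeft y d)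

end YetterDrinfeld

/-! ### Sweedler sums in a Hopf algebra -/

section Sweedler

variable (K : Type*) {B M : Type*} [Field K] [Ring B] [HopfAlgebra K B] [AddCommGroup M]

/-- `∑ f b₍₁₎ b₍₂₎`, to be used for `f` that is linear in each variable. -/
def sweedler₂ (f : B → B → M) (b : B) : M :=
  ∑ i ∈ (Coalgebra.Repr.arbitrary K b).index,
    f ((Coalgebra.Repr.arbitrary K b).left i) ((Coalgebra.Repr.arbitrary K b).right i)

/-- `∑ f b₍₁₎ b₍₂₎ b₍₃₎`, to be used for `f` that is linear in each variable. -/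
def sweedler₃ (f : B → B → B → M) (b : B) : M :=
  sweedler₂ K (fun b₁ b' => sweedler₂ K (fun b₂ b₃ => f b₁ b₂ b₃) b') b

/-- `∑ f b₍₁₎ b₍₂₎ b₍₃₎ b₍₄₎`, to be used for `f` that is linear in each variable. -/
def sweedler₄ (f : B → B → B → B → M) (b : B) : M :=
  sweedler₂ K (fun b₁ b' => sweedler₃ K (fun b₂ b₃ b₄ => f b₁ b₂ b₃ b₄) b') b

/-- For bilinear `f` the sum does not depend on how `Δ(b)` is written as a sum of tensors. -/
theorem sweedler₂_eq [Module K M] (f : B →ₗ[K] B →ₗ[K] M) (b : B) :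
    sweedler₂ K (fun x y => f x y) b = TensorProduct.lift f (Coalgebra.comul b) := by
  conv_rhs => rw [← (Coalgebra.Repr.arbitrary K b).eq]
  simp [sweedler₂]

end Sweedler

/-! ### Integrals, the dual, the Drinfel'd double and the Heisenberg double -/

section Dual

variable {K B : Type*} [Field K] [Ring B] [HopfAlgebra K B]

/-- A left integral on `B`: `(ι ⊗ φ)Δ(b) = φ(b) 1`. -/
def IsLeftIntegral (φ : Module.Dual K B) : Prop :=
  ∀ b : B, sweedler₂ K (fun b₁ b₂ => φ b₂ • b₁) b = φ b • (1 : B)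

/-- The subspace `{φ(· b) | b ∈ B}` of the dual space of `B`. -/
def dualSpace (φ : Module.Dual K B) : Submodule K (Module.Dual K B) :=
  LinearMap.range ((LinearMap.mul K B).flip.compr₂ φ)

/-- The underlying vector space `{φ(· b) | b ∈ B}` of the dual `A` of `B`, for a left integral
`φ ≠ 0`. -/
def DualAlg (φ : Module.Dual K B) : Type _ := dualSpace φ

instance (φ : Module.Dual K B) : AddCommGroup (DualAlg φ) :=
  inferInstanceAs (AddCommGroup (dualSpace φ))

instance (φ : Module.Dual K B) : Module K (DualAlg φ) :=
  inferInstanceAs (Module K (dualSpace φ))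

/-- The inclusion of `A` into the dual space of `B`, that is, the pairing `⟨a, x⟩` of `A`
and `B`. -/
def pairing (φ : Module.Dual K B) : DualAlg φ →ₗ[K] Module.Dual K B :=
  (dualSpace φ).subtype

instance (φ : Module.Dual K B) : CoeFun (DualAlg φ) fun _ => B → K :=
  ⟨fun a => pairing φ a⟩

/-- An element of `A ⊗ A` as a functional on `B ⊗ B`: `a ⊗ a'` takes the value `⟨a, x⟩⟨a', y⟩`
at `x ⊗ y`.  This map is injective. -/
def evalAA (φ : Module.Dual K B) :
    DualAlg φ ⊗[K] DualAlg φ →ₗ[K] Module.Dual K (B ⊗[K] B) :=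
  TensorProduct.dualDistrib K B B ∘ₗ
    TensorProduct.map (pairing φ) (pairing φ)

/-- An element of `A ⊗ B` as a linear map `B → B`: `a ⊗ b` maps `x` to `⟨a, x⟩ b`.
This map is injective. -/
def evalAB (φ : Module.Dual K B) : DualAlg φ ⊗[K] B →ₗ[K] B →ₗ[K] B :=
  dualTensorHom K B B ∘ₗ (pairing φ).rTensor B

/-- An element of `(A ⊗ B) ⊗ (A ⊗ B)` as a linear map `B ⊗ B → B ⊗ B`:
`(a ⊗ b) ⊗ (a' ⊗ b')` maps `x ⊗ y` to `⟨a, x⟩⟨a', y⟩ b ⊗ b'`.  This map is injective. -/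
def evalABAB (φ : Module.Dual K B) :
    (DualAlg φ ⊗[K] B) ⊗[K] (DualAlg φ ⊗[K] B) →ₗ[K] B ⊗[K] B →ₗ[K] B ⊗[K] B :=
  TensorProduct.homTensorHomMap (RingHom.id K) B B B B ∘ₗ
    TensorProduct.map (evalAB φ) (evalAB φ)

/-- `𝒜` is the dual multiplier Hopf algebra of `B`: the product is dual to the coproduct of `B`,
`⟨a a', x⟩ = ⟨a, x₍₁₎⟩⟨a', x₍₂₎⟩`, and the coproduct is dual to the product of `B`,
`⟨a₍₁₎, x⟩⟨a₍₂₎, y⟩ = ⟨a, x y⟩`, so that `a₍₁₎ ⊗ a₍₂₎ a'` takes the value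
`⟨a, x y₍₁₎⟩⟨a', y₍₂₎⟩` at `x ⊗ y`. -/
def IsDualOf (φ : Module.Dual K B) (𝒜 : RegularMultiplierHopfAlgebra K (DualAlg φ)) : Prop :=
  (∀ (a a' : DualAlg φ) (x : B),
    (𝒜.mul a a') x = sweedler₂ K (fun x₁ x₂ => a x₁ * a' x₂) x) ∧
  (∀ (a a' : DualAlg φ) (x y : B),
    evalAA φ (𝒜.T₁ (a ⊗ₜ[K] a')) (x ⊗ₜ[K] y) =
      sweedler₂ K (fun y₁ y₂ => a (x * y₁) * a' y₂) y)

/-- `𝒟` is the Drinfel'd double `A ⋈ B`; here `S` is the antipode of `B`.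

The product is `(a ⋈ b)(a' ⋈ b') = a (b₍₁₎ ▸ a' ◂ S⁻¹(b₍₃₎)) ⋈ b₍₂₎ b'`, where
`⟨b ▸ a ◂ c, x⟩ = ⟨a, c x b⟩`.  The coproduct is `Δ(a ⋈ b) = (a₍₂₎ ⋈ b₍₁₎) ⊗ (a₍₁₎ ⋈ b₍₂₎)`, so
`Δ(a ⋈ b)(1 ⊗ (a' ⋈ b')) = (a₍₂₎ ⋈ b₍₁₎) ⊗ (a₍₁₎ (b₍₂₎ ▸ a' ◂ S⁻¹(b₍₄₎)) ⋈ b₍₃₎ b')`. -/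
def IsDrinfeldDouble (S : B ≃ₗ[K] B) (φ : Module.Dual K B)
    (𝒟 : RegularMultiplierHopfAlgebra K (DualAlg φ ⊗[K] B)) : Prop :=
  (∀ (a a' : DualAlg φ) (b b' x : B),
    evalAB φ (𝒟.mul (a ⊗ₜ[K] b) (a' ⊗ₜ[K] b')) x =
      sweedler₂ K (fun x₁ x₂ => sweedler₃ K (fun b₁ b₂ b₃ =>
        (a x₁ * a' (S.symm b₃ * x₂ * b₁)) • (b₂ * b')) b) x) ∧
  (∀ (a a' : DualAlg φ) (b b' x y : B),
    evalABAB φ (𝒟.T₁ ((a ⊗ₜ[K] b) ⊗ₜ[K] (a' ⊗ₜ[K] b'))) (x ⊗ₜ[K] y) =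
      sweedler₂ K (fun y₁ y₂ => sweedler₄ K (fun b₁ b₂ b₃ b₄ =>
        (a (y₁ * x) * a' (S.symm b₄ * y₂ * b₂)) • (b₁ ⊗ₜ[K] (b₃ * b'))) b) y)

/-- `ℋ` is the Heisenberg double `A # B`, with product
`(a # b)(a' # b') = a (b₍₁₎ ▸ a') # b₍₂₎ b'`, where `⟨b ▸ a, x⟩ = ⟨a, x b⟩`. -/
def IsHeisenbergDouble (φ : Module.Dual K B)
    (ℋ : NondegenerateAlgebra K (DualAlg φ ⊗[K] B)) : Prop :=
  ∀ (a a' : DualAlg φ) (b b' x : B),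
    evalAB φ (ℋ.mul (a ⊗ₜ[K] b) (a' ⊗ₜ[K] b')) x =
      sweedler₂ K (fun x₁ x₂ => sweedler₂ K (fun b₁ b₂ =>
        (a x₁ * a' (x₂ * b₁)) • (b₂ * b')) b) x

/-- The action of `A ⋈ B` on `A # B`,
`(a ⋈ b) · (a' # b') =
  a₍₃₎ (b₍₁₎ ▸ a') S⁻¹(a₍₂₎) # (b₍₂₎ b' S(b₍₃₎)) ◂ S⁻¹(a₍₁₎)`,
where `c ◂ a = ⟨a, c₍₁₎⟩ c₍₂₎` for `c ∈ B`, and `⟨S⁻¹(a), x⟩ = ⟨a, S⁻¹(x)⟩`.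
With `c = b₍₂₎ b' S(b₍₃₎)` the value of the right hand side at `x` is
`⟨a, S⁻¹(c₍₁₎) S⁻¹(x₍₃₎) x₍₁₎⟩ ⟨a', x₍₂₎ b₍₁₎⟩ c₍₂₎`. -/
def IsHeisenbergAction (S : B ≃ₗ[K] B) (φ : Module.Dual K B)
    (act : DualAlg φ ⊗[K] B →ₗ[K] DualAlg φ ⊗[K] B →ₗ[K] DualAlg φ ⊗[K] B) : Prop :=
  ∀ (a a' : DualAlg φ) (b b' x : B),
    evalAB φ (act (a ⊗ₜ[K] b) (a' ⊗ₜ[K] b')) x =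
      sweedler₃ K (fun x₁ x₂ x₃ => sweedler₃ K (fun b₁ b₂ b₃ => sweedler₂ K (fun c₁ c₂ =>
        (a (S.symm c₁ * S.symm x₃ * x₁) * a' (x₂ * b₁)) • c₂) (b₂ * b' * S b₃)) b) x

/-- The coaction of `A ⋈ B` on `A # B`,
`((a' ⋈ b') ⊗ 1)Γ(a # b) = (a' ⋈ b')(a₍₂₎ ⋈ b₍₁₎) ⊗ (a₍₁₎ # b₍₂₎)
  = (a' (b'₍₁₎ ▸ a₍₂₎ ◂ S⁻¹(b'₍₃₎)) ⋈ b'₍₂₎ b₍₁₎) ⊗ (a₍₁₎ # b₍₂₎)`;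
`coactRight h d` stands for `(d ⊗ 1)Γ(h)`. -/
def IsHeisenbergCoaction (S : B ≃ₗ[K] B) (φ : Module.Dual K B)
    (coactRight : DualAlg φ ⊗[K] B →ₗ[K] DualAlg φ ⊗[K] B →ₗ[K]
      (DualAlg φ ⊗[K] B) ⊗[K] (DualAlg φ ⊗[K] B)) : Prop :=
  ∀ (a a' : DualAlg φ) (b b' x y : B),
    evalABAB φ (coactRight (a ⊗ₜ[K] b) (a' ⊗ₜ[K] b')) (x ⊗ₜ[K] y) =
      sweedler₂ K (fun x₁ x₂ => sweedler₃ K (fun c₁ c₂ c₃ => sweedler₂ K (fun b₁ b₂ =>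
        (a' x₁ * a (y * (S.symm c₃ * x₂ * c₁))) • ((c₂ * b₁) ⊗ₜ[K] b₂)) b) b') x

end Dual

end

/-!
The statement combines three existence claims with a list of identities. Everything is made explicit
by viewing the elements of `A ⊗ B` as linear maps `B → B`.

*The integral.* The identities `∑ φ(a₍₂₎ b) S(a₍₁₎) = ∑ φ(a b₍₂₎) b₍₁₎` and
`∑ φ(x₍₂₎ S(h)) x₍₁₎ = ∑ φ(x S(h₍₁₎)) h₍₂₎` show that the radicals of the forms `φ(x b)` and
`φ(x S(b))` are one-sided coideals, hence zero (`eq_zero_of_coideal`), so `φ` is faithful and `S` is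
injective; surjectivity follows by testing with a functional that vanishes on the range of `S`.
With the right integral `φ ∘ S` one finds `{φ(· b)} = {φ(S(b ·))}`
(`IsLeftIntegral.mem_dualSpace_iff`), so that `A` is a sub-bimodule and a two-sided rational ideal
of `B*` that separates the points of `B`. These properties (`IsRationalDual`) are all that is used
of `A` from then on.

*The multiplier Hopf algebras.* An entwining `ψ` of an algebra `R` with a coalgebra `C` makes
`Hom(C, R)` a unital associative algebra, `(f g)(c) = f(c₍₁₎)_ψ g(c₍₂₎^ψ)`. The dual `A`, the
Drinfel'd double and the Heisenberg double are subalgebras of such algebras, for `C = B` and `R = K`,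
`R = B`, `R = B`, with three different entwinings. Morphisms of entwinings induce algebra
homomorphisms; the comultiplication of `A` is `f ↦ f ∘ μ`, and the comultiplication of the
Drinfel'd double and the coaction `Γ` are both given by `T ↦ Δ ∘ T ∘ μᵒᵖ`. That these maps are
multiplicative and coassociative is therefore a statement about `μ` and `Δ` of `B`, and the axioms
for multipliers follow in unital algebras, once it is known that the maps `T₁, …, T₄` preserve the
subspace and are bijective there (`HopfRealization`). For `A` these maps are the transposes of the
Galois maps of `B`, which preserve `A ⊗ A` by rationality; for the Drinfel'd double they are composed
of those of `A` and of the Galois maps `b ⊗ v ↦ b₍₁₎ ⊗ b₍₂₎ v` of `B`-modules.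

*The action.* It is `(a ⋈ b) · X = a · (b · X)`, where `B` acts by the adjoint action (`adjAct`) and
all functionals act by `(f · X)(x) = ∑ ⟨f, S⁻¹(c₍₁₎) S⁻¹(x₍₃₎) x₍₁₎⟩ c₍₂₎`, `c = X(x₍₂₎)`
(`dualAct`). In terms of the operators `x ↦ ∑ x₍₂₎ X(x₍₁₎)` on `B` (`heisenbergOp`) the product of the
Heisenberg double is composition in reverse order, both actions become short formulas, and the
commutation relation, the two module algebra conditions and braided commutativity reduce to
contractions such as `∑ S⁻¹(b₍₂₎) b₍₁₎ = ε(b)`. Unitality holds because `ε` acts as the identity and,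
the action being rational (`exists_dualAct`), what holds for the action of `A` holds for all
functionals.

*The Yetter–Drinfel'd condition* for `a ⋈ b` follows from the conditions for `b ∈ B`, which is an
identity in the algebra of functions `B ⊗ B → B ⊗ B` (`drinfeldT₃_adjAct`), and for `a ∈ A`, which is
an identity between Sweedler sums (`drinfeldT₃_dualAct`).
-/

open scoped TensorProduct

noncomputable section

/-! ### Sums over tensors and Sweedler calculus -/

attribute [fun_prop] IsLinearMap

section Linear

variable {K U V W M N : Type*} [Field K] [AddCommMonoid U] [Module K U] [AddCommMonoid V]
  [Module K V] [AddCommMonoid W] [Module K W] [AddCommMonoid M] [Module K M] [AddCommMonoid N] [Module K N]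

@[fun_prop]
theorem IsLinearMap.fun_id : IsLinearMap K (fun x : V => x) := ⟨fun _ _ => rfl, fun _ _ => rfl⟩

@[fun_prop]
theorem IsLinearMap.fun_comp {f : V → W} {g : U → V} (hf : IsLinearMap K f) (hg : IsLinearMap K g) :
    IsLinearMap K (fun x => f (g x)) :=
  ⟨fun x y => by rw [hg.map_add, hf.map_add], fun c x => by rw [hg.map_smul, hf.map_smul]⟩

@[fun_prop]
theorem LinearMap.isLinearMap_coe (f : V →ₗ[K] W) : IsLinearMap K (fun x => f x) :=
  ⟨f.map_add, f.map_smul⟩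

@[fun_prop]
theorem LinearEquiv.isLinearMap_coe (f : V ≃ₗ[K] W) : IsLinearMap K (fun x => f x) :=
  ⟨f.map_add, f.map_smul⟩

@[fun_prop]
theorem IsLinearMap.fun_apply {f : U → V →ₗ[K] W} (hf : IsLinearMap K f) (v : V) :
    IsLinearMap K (fun x => f x v) :=
  ⟨fun x y => by rw [hf.map_add, LinearMap.add_apply],
    fun c x => by rw [hf.map_smul, LinearMap.smul_apply]⟩

@[fun_prop]
theorem IsLinearMap.mul_const {A : Type*} [Ring A] [Algebra K A] {f : U → A}
    (hf : IsLinearMap K f) (a : A) : IsLinearMap K (fun x => f x * a) :=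
  ⟨fun x y => by rw [hf.map_add, add_mul], fun c x => by rw [hf.map_smul, smul_mul_assoc]⟩

@[fun_prop]
theorem IsLinearMap.const_mul {A : Type*} [Ring A] [Algebra K A] {f : U → A}
    (hf : IsLinearMap K f) (a : A) : IsLinearMap K (fun x => a * f x) :=
  ⟨fun x y => by rw [hf.map_add, mul_add], fun c x => by rw [hf.map_smul, mul_smul_comm]⟩

@[fun_prop]
theorem IsLinearMap.tmul_const {f : U → V} (hf : IsLinearMap K f) (w : W) :
    IsLinearMap K (fun x => f x ⊗ₜ[K] w) :=
  ⟨fun x y => by rw [hf.map_add, TensorProduct.add_tmul],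
    fun c x => by rw [hf.map_smul, TensorProduct.smul_tmul']⟩

@[fun_prop]
theorem IsLinearMap.const_tmul {f : U → W} (hf : IsLinearMap K f) (v : V) :
    IsLinearMap K (fun x => v ⊗ₜ[K] f x) :=
  ⟨fun x y => by rw [hf.map_add, TensorProduct.tmul_add],
    fun c x => by rw [hf.map_smul, TensorProduct.tmul_smul]⟩

@[fun_prop]
theorem IsLinearMap.fun_smul_const {f : U → K} (hf : IsLinearMap K f) (v : V) :
    IsLinearMap K (fun x => f x • v) :=
  ⟨fun x y => by rw [hf.map_add, add_smul],
    fun c x => by rw [hf.map_smul, smul_assoc]⟩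

@[fun_prop]
theorem IsLinearMap.fun_const_smul {f : U → V} (hf : IsLinearMap K f) (c : K) :
    IsLinearMap K (fun x => c • f x) :=
  ⟨fun x y => by rw [hf.map_add, smul_add],
    fun d x => by rw [hf.map_smul, smul_comm]⟩

@[fun_prop]
theorem IsLinearMap.finsetSum {ι : Type*} (s : Finset ι) {f : ι → U → V}
    (hf : ∀ i, IsLinearMap K (f i)) : IsLinearMap K (fun x => ∑ i ∈ s, f i x) :=
  ⟨fun x y => by simp_rw [fun i => (hf i).map_add, Finset.sum_add_distrib],
    fun c x => by simp_rw [fun i => (hf i).map_smul, Finset.smul_sum]⟩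

/-- `∑ f uᵢ vᵢ` for `z = ∑ uᵢ ⊗ vᵢ`; for `f` that is linear in each variable it does not depend on
how `z` is written as a sum of tensors. -/
def tensorSum (f : U → V → M) (z : U ⊗[K] V) : M :=
  ∑ p ∈ (TensorProduct.exists_finset z).choose, f p.1 p.2

theorem tensorSum_congr {M' : Type*} [AddCommMonoid M'] {f g : U → V → M'}
    (h : ∀ u v, f u v = g u v) {z : U ⊗[K] V} :
    tensorSum f z = tensorSum g z := by
  rw [funext₂ h]

@[simp]
theorem tensorSum_zero {M' : Type*} [AddCommMonoid M'] (z : U ⊗[K] V) :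
    tensorSum (fun _ _ => (0 : M')) z = 0 := by
  simp [tensorSum]

theorem tensorSum_tmul_self (z : U ⊗[K] V) : tensorSum (fun u v => u ⊗ₜ[K] v) z = z :=
  (TensorProduct.exists_finset z).choose_spec.symm

theorem tensorSum_eq_lift (F : U →ₗ[K] V →ₗ[K] M) (z : U ⊗[K] V) :
    tensorSum (fun u v => F u v) z = TensorProduct.lift F z := by
  conv_rhs => rw [(TensorProduct.exists_finset z).choose_spec]
  simp [tensorSum]

/-- A function that is linear in each of its two variables, as a bilinear map. -/
def bilin (f : U → V → M) (h₁ : ∀ y, IsLinearMap K (fun x => f x y))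
    (h₂ : ∀ x, IsLinearMap K (fun y => f x y)) : U →ₗ[K] V →ₗ[K] M :=
  LinearMap.mk₂ K f (fun x x' y => (h₁ y).map_add x x') (fun c x y => (h₁ y).map_smul c x)
    (fun x => (h₂ x).map_add) (fun c x => (h₂ x).map_smul c)

@[simp]
theorem bilin_apply (f : U → V → M) (h₁ : ∀ y, IsLinearMap K (fun x => f x y))
    (h₂ : ∀ x, IsLinearMap K (fun y => f x y)) (x : U) (y : V) : bilin f h₁ h₂ x y = f x y := rfl

theorem tensorSum_eq_lift_bilin {f : U → V → M} (h₁ : ∀ y, IsLinearMap K (fun x => f x y))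
    (h₂ : ∀ x, IsLinearMap K (fun y => f x y)) (z : U ⊗[K] V) :
    tensorSum f z = TensorProduct.lift (bilin f h₁ h₂) z :=
  tensorSum_eq_lift (bilin f h₁ h₂) z

@[fun_prop]
theorem IsLinearMap.tensorSum_const {f : N → U → V → M}
    (hf : ∀ x y, IsLinearMap K (fun u => f u x y)) (z : U ⊗[K] V) :
    IsLinearMap K (fun u => tensorSum (f u) z) := by
  unfold tensorSum
  fun_prop

@[fun_prop]
theorem IsLinearMap.tensorSum_apply {f : U → V → M} (h₁ : ∀ y, IsLinearMap K (fun x => f x y))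
    (h₂ : ∀ x, IsLinearMap K (fun y => f x y)) :
    IsLinearMap K (fun z : U ⊗[K] V => tensorSum f z) := by
  simp_rw [tensorSum_eq_lift_bilin h₁ h₂]
  fun_prop

theorem tensorSum_tmul {f : U → V → M} (h₁ : ∀ y, IsLinearMap K (fun x => f x y))
    (h₂ : ∀ x, IsLinearMap K (fun y => f x y)) (u : U) (v : V) :
    tensorSum f (u ⊗ₜ[K] v) = f u v := by
  simp [tensorSum_eq_lift_bilin h₁ h₂]

theorem tensorSum_smul_arg {f : U → V → M} (h₁ : ∀ y, IsLinearMap K (fun x => f x y))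
    (h₂ : ∀ x, IsLinearMap K (fun y => f x y)) (k : K) (z : U ⊗[K] V) :
    tensorSum f (k • z) = k • tensorSum f z :=
  (IsLinearMap.tensorSum_apply h₁ h₂).map_smul k z

theorem tensorSum_zero_arg {f : U → V → M} (h₁ : ∀ y, IsLinearMap K (fun x => f x y))
    (h₂ : ∀ x, IsLinearMap K (fun y => f x y)) :
    tensorSum f (0 : U ⊗[K] V) = 0 :=
  (IsLinearMap.tensorSum_apply h₁ h₂).map_zero

theorem IsLinearMap.map_tensorSum {L : M → N} (hL : IsLinearMap K L) (f : U → V → M)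
    (z : U ⊗[K] V) : L (tensorSum f z) = tensorSum (fun u v => L (f u v)) z :=
  map_sum (hL.mk') _ _

theorem LinearMap.map_tensorSum (L : M →ₗ[K] N) (f : U → V → M)
    (z : U ⊗[K] V) : L (tensorSum f z) = tensorSum (fun u v => L (f u v)) z :=
  map_sum L _ _

theorem LinearEquiv.map_tensorSum (L : M ≃ₗ[K] N) (f : U → V → M)
    (z : U ⊗[K] V) : L (tensorSum f z) = tensorSum (fun u v => L (f u v)) z :=
  map_sum L _ _

theorem AlgHom.map_tensorSum {A A' : Type*} [Ring A] [Algebra K A] [Ring A'] [Algebra K A']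
    (F : A →ₐ[K] A') (f : U → V → A) (z : U ⊗[K] V) :
    F (tensorSum f z) = tensorSum (fun u v => F (f u v)) z :=
  map_sum F _ _

theorem tensorSum_apply (f : U → V → M →ₗ[K] N) (z : U ⊗[K] V) (m : M) :
    tensorSum f z m = tensorSum (fun u v => f u v m) z := by
  simp [tensorSum]

theorem tensorSum_mul {A : Type*} [Ring A] [Algebra K A] (f : U → V → A) (z : U ⊗[K] V) (a : A) :
    tensorSum f z * a = tensorSum (fun u v => f u v * a) z := by
  simp [tensorSum, Finset.sum_mul]

theorem mul_tensorSum {A : Type*} [Ring A] [Algebra K A] (f : U → V → A) (z : U ⊗[K] V) (a : A) :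
    a * tensorSum f z = tensorSum (fun u v => a * f u v) z := by
  simp [tensorSum, Finset.mul_sum]

theorem tensorSum_smul (f : U → V → K) (z : U ⊗[K] V) (m : M) :
    tensorSum f z • m = tensorSum (fun u v => f u v • m) z := by
  simp [tensorSum, Finset.sum_smul]

theorem smul_tensorSum (f : U → V → M) (z : U ⊗[K] V) (c : K) :
    c • tensorSum f z = tensorSum (fun u v => c • f u v) z := by
  simp [tensorSum, Finset.smul_sum]

theorem tensorSum_tmul_const (f : U → V → M) (z : U ⊗[K] V) (n : N) :
    tensorSum f z ⊗ₜ[K] n = tensorSum (fun u v => f u v ⊗ₜ[K] n) z := by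
  simp [tensorSum, TensorProduct.sum_tmul]

theorem const_tmul_tensorSum (f : U → V → M) (z : U ⊗[K] V) (n : N) :
    n ⊗ₜ[K] tensorSum f z = tensorSum (fun u v => n ⊗ₜ[K] f u v) z := by
  simp [tensorSum, TensorProduct.tmul_sum]

theorem tensorSum_tensorSum {f : U → V → M} (h₁ : ∀ y, IsLinearMap K (fun x => f x y))
    (h₂ : ∀ x, IsLinearMap K (fun y => f x y)) {U' V' : Type*} [AddCommMonoid U'] [Module K U']
    [AddCommMonoid V'] [Module K V'] (g : U' → V' → U ⊗[K] V) (z : U' ⊗[K] V') :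
    tensorSum f (tensorSum g z) = tensorSum (fun u v => tensorSum f (g u v)) z :=
  (IsLinearMap.tensorSum_apply h₁ h₂).map_tensorSum g z

theorem tensorSum_comm {U' V' : Type*} [AddCommMonoid U'] [Module K U']
    [AddCommMonoid V'] [Module K V'] {M' : Type*} [AddCommMonoid M'] (f : U → V → U' → V' → M')
    (z : U ⊗[K] V) (w : U' ⊗[K] V') :
    tensorSum (fun u v => tensorSum (fun u' v' => f u v u' v') w) z =
      tensorSum (fun u' v' => tensorSum (fun u v => f u v u' v') z) w :=
  Finset.sum_comm

/-- Linear maps out of a tensor product agree if they agree on pure tensors. -/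
theorem eq_of_tmul {f g : U ⊗[K] V → M} (hf : IsLinearMap K f) (hg : IsLinearMap K g)
    (h : ∀ u v, f (u ⊗ₜ[K] v) = g (u ⊗ₜ[K] v)) (z : U ⊗[K] V) : f z = g z := by
  have : hf.mk' = hg.mk' := TensorProduct.ext' h
  exact LinearMap.congr_fun this z

end Linear

section Sweedler

variable {K C M N : Type*} [Field K] [AddCommGroup C] [Module K C] [Coalgebra K C]
  [AddCommGroup M] [Module K M] [AddCommGroup N] [Module K N]

local notation "Δ" => Coalgebra.comul (R := K)
local notation "ε" => Coalgebra.counit (R := K)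

/-- Coassociativity; this brings nested Sweedler sums into the normal form in which each sum is over
the last factor of the preceding one. The next two lemmas do this across one and two unrelated sums
in between. -/
theorem tensorSum_coassoc {f : C → C → C → M} (h₁ : ∀ y z, IsLinearMap K (fun x => f x y z))
    (h₂ : ∀ x z, IsLinearMap K (fun y => f x y z)) (h₃ : ∀ x y, IsLinearMap K (fun z => f x y z))
    (b : C) :
    tensorSum (fun x z => tensorSum (fun x₁ x₂ => f x₁ x₂ z) (Δ x)) (Δ b) =
      tensorSum (fun x y => tensorSum (fun y₁ y₂ => f x y₁ y₂) (Δ y)) (Δ b) := by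
  let F : C ⊗[K] (C ⊗[K] C) →ₗ[K] M := TensorProduct.lift (bilin
    (fun x t => tensorSum (fun y z => f x y z) t) (by fun_prop) (by fun_prop))
  have h := congr_arg F (Coalgebra.coassoc_apply (R := K) b)
  conv_lhs at h => rw [← tensorSum_tmul_self (Δ b)]
  conv_rhs at h => rw [← tensorSum_tmul_self (Δ b)]
  simp only [LinearMap.map_tensorSum, LinearMap.rTensor_tmul, LinearMap.lTensor_tmul,
    LinearEquiv.map_tensorSum] at h
  have h' : ∀ u v : C, F (TensorProduct.assoc K C C C (Δ u ⊗ₜ[K] v)) =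
      tensorSum (fun x₁ x₂ => f x₁ x₂ v) (Δ u) := by
    intro u v
    conv_lhs => rw [← tensorSum_tmul_self (Δ u)]
    simp only [tensorSum_tmul_const, LinearMap.map_tensorSum, LinearEquiv.map_tensorSum,
      TensorProduct.assoc_tmul]
    congr! 3 with x y
    simp (disch := fun_prop) [F, tensorSum_tmul]
  simp only [h'] at h
  rw [h]
  congr! 3

theorem tensorSum_coassoc_one {U V : Type*} [AddCommGroup U] [Module K U]
    [AddCommGroup V] [Module K V] {f : C → C → U → V → C → M} {w : C → U ⊗[K] V}
    (h₁ : ∀ y p q z, IsLinearMap K (fun x => f x y p q z))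
    (h₂ : ∀ x p q z, IsLinearMap K (fun y => f x y p q z))
    (h₃ : ∀ x y, IsLinearMap K (fun z => tensorSum (fun p q => f x y p q z) (w z)))
    (b : C) :
    tensorSum (fun x z => tensorSum (fun p q =>
        tensorSum (fun x₁ x₂ => f x₁ x₂ p q z) (Δ x)) (w z)) (Δ b) =
      tensorSum (fun x y => tensorSum (fun y₁ y₂ =>
        tensorSum (fun p q => f x y₁ p q y₂) (w y₂)) (Δ y)) (Δ b) := by
  rw [← tensorSum_coassoc (K := K) (f := fun x y z => tensorSum (fun p q => f x y p q z) (w z))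
    (by fun_prop) (by fun_prop) h₃]
  refine tensorSum_congr fun x z => ?_
  exact tensorSum_comm (K := K) ..

theorem tensorSum_coassoc_two {U V U' V' : Type*} [AddCommGroup U] [Module K U]
    [AddCommGroup V] [Module K V] [AddCommGroup U'] [Module K U']
    [AddCommGroup V'] [Module K V'] {f : C → C → U → V → U' → V' → C → M} {w : C → U ⊗[K] V}
    {w' : U → V → C → U' ⊗[K] V'}
    (h₁ : ∀ y p q p' q' z, IsLinearMap K (fun x => f x y p q p' q' z))
    (h₂ : ∀ x p q p' q' z, IsLinearMap K (fun y => f x y p q p' q' z))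
    (h₃ : ∀ x y, IsLinearMap K (fun z => tensorSum (fun p q =>
      tensorSum (fun p' q' => f x y p q p' q' z) (w' p q z)) (w z)))
    (b : C) :
    tensorSum (fun x z => tensorSum (fun p q => tensorSum (fun p' q' =>
        tensorSum (fun x₁ x₂ => f x₁ x₂ p q p' q' z) (Δ x)) (w' p q z)) (w z)) (Δ b) =
      tensorSum (fun x y => tensorSum (fun y₁ y₂ => tensorSum (fun p q =>
        tensorSum (fun p' q' => f x y₁ p q p' q' y₂) (w' p q y₂)) (w y₂)) (Δ y)) (Δ b) := by
  rw [← tensorSum_coassoc_one (K := K) (w := w) (f := fun x y p q z =>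
    tensorSum (fun p' q' => f x y p q p' q' z) (w' p q z)) (by fun_prop) (by fun_prop) h₃]
  refine tensorSum_congr fun x z => tensorSum_congr fun p q => ?_
  exact tensorSum_comm (fun p' q' x₁ x₂ => f x₁ x₂ p q p' q' z) _ _

theorem tensorSum_counit_left {f : C → M} (hf : IsLinearMap K f) (b : C) :
    tensorSum (fun x y => ε x • f y) (Δ b) = f b := by
  let F : K ⊗[K] C →ₗ[K] M := TensorProduct.lift ((LinearMap.lsmul K M).flip ∘ₗ hf.mk').flip
  have h := congr_arg F (Coalgebra.rTensor_counit_comul (R := K) b)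
  conv_lhs at h => rw [← tensorSum_tmul_self (Δ b)]
  simpa [LinearMap.map_tensorSum, F] using h

theorem tensorSum_counit_right {f : C → M} (hf : IsLinearMap K f) (b : C) :
    tensorSum (fun x y => ε y • f x) (Δ b) = f b := by
  let F : C ⊗[K] K →ₗ[K] M := TensorProduct.lift ((LinearMap.lsmul K M).flip ∘ₗ hf.mk')
  have h := congr_arg F (Coalgebra.lTensor_counit_comul (R := K) b)
  conv_lhs at h => rw [← tensorSum_tmul_self (Δ b)]
  simpa [LinearMap.map_tensorSum, F] using h

theorem comul_tmul_eq {D : Type*} [AddCommGroup D] [Module K D] [Coalgebra K D] (x : C) (y : D) :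
    Δ (x ⊗ₜ[K] y) = tensorSum (fun x₁ x₂ => tensorSum (fun y₁ y₂ =>
      ((x₁ ⊗ₜ[K] y₁ : C ⊗[K] D) ⊗ₜ[K] (x₂ ⊗ₜ[K] y₂ : C ⊗[K] D))) (Δ y)) (Δ x) := by
  rw [TensorProduct.comul_tmul]
  conv_lhs => rw [← tensorSum_tmul_self (Δ x), ← tensorSum_tmul_self (Δ y)]
  simp [tensorSum_tmul_const, const_tmul_tensorSum, LinearEquiv.map_tensorSum]
  exact tensorSum_comm (K := K) ..

end Sweedler

section Bialgebra

variable {K B M N : Type*} [Field K] [Ring B] [HopfAlgebra K B] [AddCommGroup M] [Module K M]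

local notation "Δ" => Coalgebra.comul (R := K)
local notation "ε" => Coalgebra.counit (R := K)

theorem comul_mul_eq (a b : B) :
    Δ (a * b) = tensorSum (fun a₁ a₂ => tensorSum (fun b₁ b₂ => (a₁ * b₁) ⊗ₜ[K] (a₂ * b₂))
      (Δ b)) (Δ a) := by
  rw [Bialgebra.comul_mul]
  conv_lhs => rw [← tensorSum_tmul_self (Δ a), ← tensorSum_tmul_self (Δ b)]
  simp only [tensorSum_mul, mul_tensorSum, Algebra.TensorProduct.tmul_mul_tmul]
  exact tensorSum_comm (K := K) ..

theorem sweedler₂_eq_tensorSum {f : B → B → M} (h₁ : ∀ y, IsLinearMap K (fun x => f x y))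
    (h₂ : ∀ x, IsLinearMap K (fun y => f x y)) (b : B) :
    sweedler₂ K f b = tensorSum f (Δ b) := by
  rw [tensorSum_eq_lift_bilin h₁ h₂]
  exact sweedler₂_eq K (bilin f h₁ h₂) b

theorem sweedler₃_eq_tensorSum {f : B → B → B → M} (h₁ : ∀ y z, IsLinearMap K (fun x => f x y z))
    (h₂ : ∀ x z, IsLinearMap K (fun y => f x y z)) (h₃ : ∀ x y, IsLinearMap K (fun z => f x y z))
    (b : B) : sweedler₃ K f b =
      tensorSum (fun x r => tensorSum (fun y z => f x y z) (Δ r)) (Δ b) := by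
  have h' := fun x : B => fun b : B => sweedler₂_eq_tensorSum (h₂ x) (h₃ x) b
  rw [sweedler₃, ← sweedler₂_eq_tensorSum (by fun_prop) (by fun_prop)]
  simp only [h']

theorem sweedler₄_eq_tensorSum {f : B → B → B → B → M}
    (h₁ : ∀ y z w, IsLinearMap K (fun x => f x y z w))
    (h₂ : ∀ x z w, IsLinearMap K (fun y => f x y z w))
    (h₃ : ∀ x y w, IsLinearMap K (fun z => f x y z w))
    (h₄ : ∀ x y z, IsLinearMap K (fun w => f x y z w))
    (b : B) : sweedler₄ K f b =
      tensorSum (fun x r => tensorSum (fun y r => tensorSum (fun z w => f x y z w) (Δ r)) (Δ r))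
        (Δ b) := by
  have h' := fun x : B => fun b : B => sweedler₃_eq_tensorSum (h₂ x) (h₃ x) (h₄ x) b
  rw [sweedler₄, ← sweedler₂_eq_tensorSum (by fun_prop) (by fun_prop)]
  simp only [h']

end Bialgebra

/-! ### The antipode -/

section Antipode

variable {K B M : Type*} [Field K] [Ring B] [HopfAlgebra K B] [AddCommGroup M] [Module K M]

local notation "Δ" => Coalgebra.comul (R := K)
local notation "ε" => Coalgebra.counit (R := K)

/-- A bilinear operation on `B` with `∑ p b₍₁₎ b₍₂₎ = ε(b) 1`, such as `(x, y) ↦ S(x) y`. -/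
def IsCounital (K : Type*) {B : Type*} [Field K] [Ring B] [HopfAlgebra K B] (p : B → B → B) :
    Prop :=
  (∀ y, IsLinearMap K fun x => p x y) ∧ (∀ x, IsLinearMap K fun y => p x y) ∧
    ∀ b, tensorSum p (Coalgebra.comul (R := K) b) = Coalgebra.counit (R := K) b • (1 : B)

variable {p : B → B → B}

/-- The contraction `∑ F(p(b₍₁₎, b₍₂₎)) = ε(b) F(1)`. -/
theorem IsCounital.sum (hp : IsCounital K p) {f : B → B → M} (F : B → M)
    (hF : IsLinearMap K F) (h : ∀ x y, f x y = F (p x y)) (b : B) :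
    tensorSum f (Δ b) = ε b • F 1 := by
  rw [← hF.map_smul, ← hp.2.2 b, hF.map_tensorSum]
  exact tensorSum_congr h

/-- The contraction `∑ F(p(b₍₁₎, b₍₂₎), b₍₃₎) = F(1, b)`. -/
theorem IsCounital.sum_left (hp : IsCounital K p) {f : B → B → B → M} (F : B → B → M)
    (hF₁ : ∀ y, IsLinearMap K fun x => F x y) (hF₂ : ∀ x, IsLinearMap K fun y => F x y)
    (h : ∀ x y z, f x y z = F (p x y) z) (b : B) :
    tensorSum (fun x r => tensorSum (fun y z => f x y z) (Δ r)) (Δ b) = F 1 b := by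
  have h₁ := hp.1
  have h₂ := hp.2.1
  simp only [h]
  rw [← tensorSum_coassoc (by fun_prop) (by fun_prop) (by fun_prop)]
  simp only [fun x z => hp.sum (fun u => F u z) (hF₁ z) (fun _ _ => rfl) x]
  exact tensorSum_counit_left (hF₂ 1) b

/-- The contraction `∑ F(b₍₁₎, p(b₍₂₎, b₍₃₎)) = F(b, 1)`. -/
theorem IsCounital.sum_right (hp : IsCounital K p) {f : B → B → B → M} (F : B → B → M)
    (hF₁ : ∀ y, IsLinearMap K fun x => F x y) (hF₂ : ∀ x, IsLinearMap K fun y => F x y)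
    (h : ∀ x y z, f x y z = F x (p y z)) (b : B) :
    tensorSum (fun x r => tensorSum (fun y z => f x y z) (Δ r)) (Δ b) = F b 1 := by
  simp only [h]
  simp only [fun x z => hp.sum (fun u => F x u) (hF₂ x) (fun _ _ => rfl) z]
  exact tensorSum_counit_right (hF₁ 1) b

theorem isCounital_antipode_mul : IsCounital K fun x y : B => HopfAlgebra.antipode K x * y := by
  refine ⟨by fun_prop, by fun_prop, fun b => ?_⟩
  have h := HopfAlgebra.mul_antipode_rTensor_comul_apply (R := K) b
  rw [← tensorSum_tmul_self (Δ b)] at h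
  simpa [LinearMap.map_tensorSum, Algebra.algebraMap_eq_smul_one] using h

theorem isCounital_mul_antipode : IsCounital K fun x y : B => x * HopfAlgebra.antipode K y := by
  refine ⟨by fun_prop, by fun_prop, fun b => ?_⟩
  have h := HopfAlgebra.mul_antipode_lTensor_comul_apply (R := K) b
  rw [← tensorSum_tmul_self (Δ b)] at h
  simpa [LinearMap.map_tensorSum, Algebra.algebraMap_eq_smul_one] using h

/-- The antipode reverses the coproduct. Both sides are convolution inverses of `Δ`. -/
theorem comul_antipode_eq (b : B) : Δ (HopfAlgebra.antipode K b) =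
    tensorSum (fun x y => HopfAlgebra.antipode K y ⊗ₜ[K] HopfAlgebra.antipode K x) (Δ b) := by
  set S : B →ₗ[K] B := HopfAlgebra.antipode K
  have e₁ : ∀ b : B, tensorSum (fun x y => Δ x * Δ (S y)) (Δ b) = ε b • 1 := by
    intro b
    have h := (isCounital_mul_antipode (K := K)).sum (fun x : B => Δ x) (by fun_prop)
      (fun _ _ => rfl) b
    simpa only [Bialgebra.comul_mul, Bialgebra.comul_one] using h
  have e₂ : ∀ b : B, tensorSum (fun x y => tensorSum (fun x₁ x₂ => S x₂ ⊗ₜ[K] S x₁) (Δ x) * Δ y)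
      (Δ b) = ε b • 1 := by
    intro b
    have h : ∀ y : B, ∀ z, z * Δ y =
        tensorSum (fun y₁ y₂ => z * (y₁ ⊗ₜ[K] y₂)) (Δ y) := by
      intro y z
      conv_lhs => rw [← tensorSum_tmul_self (Δ y), mul_tensorSum]
    simp (disch := fun_prop) only [h, tensorSum_mul, tensorSum_coassoc_one,
      Algebra.TensorProduct.tmul_mul_tmul]
    have h' : ∀ r : B, ∀ x,
        tensorSum (fun x₂ r => tensorSum (fun y₁ y₂ => (S x₂ * y₁) ⊗ₜ[K] (S x * y₂)) (Δ r)) (Δ r) =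
          1 ⊗ₜ[K] (S x * r) := fun r x =>
      (isCounital_antipode_mul (K := K)).sum_left (fun u v => u ⊗ₜ[K] (S x * v)) (by fun_prop)
        (by fun_prop) (fun _ _ _ => rfl) r
    simp only [h']
    exact (isCounital_antipode_mul (K := K)).sum (fun u => 1 ⊗ₜ[K] u) (by fun_prop)
      (fun _ _ => rfl) b
  -- both sides equal `∑ G(b₍₁₎) Δ(b₍₂₎) Δ(S(b₍₃₎))`, where `G` is the right hand side
  have e₃ : tensorSum (fun x r => tensorSum (fun y z =>
      tensorSum (fun x₁ x₂ => S x₂ ⊗ₜ[K] S x₁) (Δ x) * Δ y * Δ (S z)) (Δ r)) (Δ b) =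
      Δ (S b) := by
    rw [← tensorSum_coassoc (by fun_prop) (by fun_prop) (by fun_prop)]
    simp only [← tensorSum_mul, e₂, smul_mul_assoc, one_mul]
    exact tensorSum_counit_left (by fun_prop) b
  rw [← e₃]
  simp only [mul_assoc, ← mul_tensorSum, e₁, mul_smul_comm, mul_one]
  exact tensorSum_counit_right (by fun_prop) b

variable {S : B ≃ₗ[K] B} (hS : (S : B →ₗ[K] B) = HopfAlgebra.antipode K)
include hS

theorem antipode_apply (b : B) : HopfAlgebra.antipode K b = S b := by rw [← hS]; rfl

theorem antipodeEquiv_mul (a b : B) : S (a * b) = S b * S a := by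
  simp only [← antipode_apply hS, HopfAlgebra.antipode_mul_antidistrib]

theorem antipodeEquiv_one : S 1 = 1 := by
  simp only [← antipode_apply hS, HopfAlgebra.antipode_one]

theorem antipodeEquiv_symm_mul (a b : B) : S.symm (a * b) = S.symm b * S.symm a := by
  apply S.injective
  simp [antipodeEquiv_mul hS]

theorem antipodeEquiv_symm_one : S.symm 1 = 1 := by
  apply S.injective
  simp [antipodeEquiv_one hS]

theorem counit_antipodeEquiv (b : B) : ε (S b) = ε b := by
  simp only [← antipode_apply hS, HopfAlgebra.counit_antipode]

theorem counit_antipodeEquiv_symm (b : B) : ε (S.symm b) = ε b := by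
  rw [← counit_antipodeEquiv hS, S.apply_symm_apply]

theorem comul_antipodeEquiv (b : B) :
    Δ (S b) = tensorSum (fun x y => S y ⊗ₜ[K] S x) (Δ b) := by
  simpa only [antipode_apply hS] using comul_antipode_eq (K := K) b

theorem comul_antipodeEquiv_symm (b : B) :
    Δ (S.symm b) = tensorSum (fun x y => S.symm y ⊗ₜ[K] S.symm x) (Δ b) := by
  have h := comul_antipodeEquiv hS (S.symm b)
  rw [S.apply_symm_apply] at h
  rw [h]
  simp (disch := fun_prop) [tensorSum_tensorSum, tensorSum_tmul, tensorSum_tmul_self]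

theorem isCounital_antipodeEquiv_mul : IsCounital K fun x y : B => S x * y := by
  simpa only [antipode_apply hS] using isCounital_antipode_mul (K := K) (B := B)

theorem isCounital_mul_antipodeEquiv : IsCounital K fun x y : B => x * S y := by
  simpa only [antipode_apply hS] using isCounital_mul_antipode (K := K) (B := B)

theorem isCounital_antipodeEquiv_symm_mul : IsCounital K fun x y : B => S.symm y * x := by
  refine ⟨by fun_prop, by fun_prop, fun b => S.injective ?_⟩
  rw [LinearEquiv.map_tensorSum, S.map_smul, antipodeEquiv_one hS,
    ← (isCounital_antipodeEquiv_mul hS).2.2]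
  simp [antipodeEquiv_mul hS]

theorem isCounital_mul_antipodeEquiv_symm : IsCounital K fun x y : B => y * S.symm x := by
  refine ⟨by fun_prop, by fun_prop, fun b => S.injective ?_⟩
  rw [LinearEquiv.map_tensorSum, S.map_smul, antipodeEquiv_one hS,
    ← (isCounital_mul_antipodeEquiv hS).2.2]
  simp [antipodeEquiv_mul hS]

end Antipode

/-! ### Left integrals and bijectivity of the antipode -/

section LinearAlgebra

variable {K U V W X Y M : Type*} [Field K] [AddCommGroup U] [Module K U] [AddCommGroup V]
  [Module K V] [AddCommGroup W] [Module K W] [AddCommGroup X] [Module K X] [AddCommGroup Y]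
  [Module K Y] [AddCommGroup M] [Module K M]

/-- A subspace that is annihilated only by the zero functional is the whole space. -/
theorem Submodule.eq_top_of_forall_dual (p : Submodule K V)
    (h : ∀ f : Module.Dual K V, (∀ x ∈ p, f x = 0) → f = 0) : p = ⊤ := by
  by_contra hp
  obtain ⟨f, hf, hpf⟩ := p.exists_le_ker_of_lt_top (lt_top_iff_ne_top.2 hp)
  exact hf (h f fun x hx => hpf hx)

/-- A family of linear maps that is jointly injective on `V` is jointly injective on `U ⊗ V`. -/
theorem eq_zero_of_forall_lTensor {ι : Type*} {N : ι → Type*} [∀ i, AddCommGroup (N i)]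
    [∀ i, Module K (N i)] (g : ∀ i, V →ₗ[K] N i) (hg : ∀ v, (∀ i, g i v = 0) → v = 0)
    (z : U ⊗[K] V) (hz : ∀ i, (g i).lTensor U z = 0) : z = 0 := by
  classical
  let 𝓑 := Module.Basis.ofVectorSpace K U
  have hnat : ∀ i (z : U ⊗[K] V) k, TensorProduct.equivFinsuppOfBasisLeft 𝓑 ((g i).lTensor U z) k =
      g i (TensorProduct.equivFinsuppOfBasisLeft 𝓑 z k) := by
    intro i z k
    refine eq_of_tmul (K := K) (f := fun z => TensorProduct.equivFinsuppOfBasisLeft 𝓑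
      ((g i).lTensor U z) k) ⟨by simp, by simp⟩
      (g := fun z => g i (TensorProduct.equivFinsuppOfBasisLeft 𝓑 z k)) ⟨by simp, by simp⟩
      (fun u v => ?_) z
    simp
  apply (TensorProduct.equivFinsuppOfBasisLeft 𝓑).injective
  ext k
  rw [map_zero, Finsupp.zero_apply]
  refine hg _ fun i => ?_
  rw [← hnat, hz, map_zero, Finsupp.zero_apply]

/-- Families of maps that are jointly injective on `U` and on `V` give a jointly injective family
on `U ⊗ V`. -/
theorem eq_zero_of_forall_map {ι κ : Type*} (f : ι → U →ₗ[K] X) (g : κ → V →ₗ[K] Y)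
    (hf : ∀ u, (∀ i, f i u = 0) → u = 0) (hg : ∀ v, (∀ k, g k v = 0) → v = 0)
    (z : U ⊗[K] V) (hz : ∀ i k, TensorProduct.map (f i) (g k) z = 0) : z = 0 := by
  apply (TensorProduct.comm K U V).injective
  rw [map_zero]
  refine eq_zero_of_forall_lTensor f hf _ fun i => ?_
  apply (TensorProduct.comm K V X).injective
  rw [map_zero]
  refine eq_zero_of_forall_lTensor g hg _ fun k => ?_
  rw [← hz i k]
  refine eq_of_tmul (K := K) (f := fun z => (g k).lTensor X (TensorProduct.comm K V X
    ((f i).lTensor V (TensorProduct.comm K U V z)))) (by fun_prop) (by fun_prop)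
    (fun u v => ?_) z
  simp

/-- A linear map into `M` with values in the range of the injective map `j : V → M`, as a map
into `V`. -/
def liftRange (j : V →ₗ[K] M) (hj : Function.Injective j) (f : X →ₗ[K] M)
    (hf : ∀ x, f x ∈ LinearMap.range j) : X →ₗ[K] V :=
  (LinearEquiv.ofInjective j hj).symm ∘ₗ f.codRestrict (LinearMap.range j) hf

@[simp]
theorem apply_liftRange (j : V →ₗ[K] M) (hj : Function.Injective j) (f : X →ₗ[K] M)
    (hf : ∀ x, f x ∈ LinearMap.range j) (x : X) : j (liftRange j hj f hf x) = f x := by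
  have := (LinearEquiv.ofInjective j hj).apply_symm_apply (f.codRestrict (LinearMap.range j) hf x)
  exact congr_arg Subtype.val this

/-- A bilinear map into `M` with values in the range of the injective map `j : V → M`, as a
bilinear map into `V`. -/
def liftRange₂ (j : V →ₗ[K] M) (hj : Function.Injective j) (f : X →ₗ[K] Y →ₗ[K] M)
    (hf : ∀ x y, f x y ∈ LinearMap.range j) : X →ₗ[K] Y →ₗ[K] V :=
  LinearMap.mk₂ K (fun x y => liftRange j hj (f x) (hf x) y)
    (fun _ _ _ => hj (by simp)) (fun _ _ _ => hj (by simp)) (fun _ _ _ => hj (by simp))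
    (fun _ _ _ => hj (by simp))

@[simp]
theorem apply_liftRange₂ (j : V →ₗ[K] M) (hj : Function.Injective j) (f : X →ₗ[K] Y →ₗ[K] M)
    (hf : ∀ x y, f x y ∈ LinearMap.range j) (x : X) (y : Y) :
    j (liftRange₂ j hj f hf x y) = f x y :=
  apply_liftRange j hj (f x) (hf x) y

end LinearAlgebra

section Integral

variable {K B : Type*} [Field K] [Ring B] [HopfAlgebra K B]

local notation "Δ" => Coalgebra.comul (R := K)
local notation "ε" => Coalgebra.counit (R := K)
local notation "𝐒" => HopfAlgebra.antipode K (A := B)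

/-- If the kernel of `Φ : B → B*` is a one-sided coideal and the values of `Φ` along `Δ(b)` can be
contracted to a non-zero multiple of `ε(b)`, then `Φ` is injective. Here `z b` is `Δ(b)` or its
flip. -/
theorem eq_zero_of_coideal (Φ : B →ₗ[K] Module.Dual K B) (z : B → B ⊗[K] B)
    (hz : ∀ (f : Module.Dual K B) b, tensorSum (fun u v => ε v * f u) (z b) = f b)
    (h₀ : ∀ b, Φ b = 0 → ∀ c, tensorSum (fun u v => Φ v c • u) (z b) = 0)
    (θ : B ⊗[K] Module.Dual K B →ₗ[K] K) {k : K} (hk : k ≠ 0)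
    (hθ : ∀ b, tensorSum (fun u v => θ (u ⊗ₜ[K] Φ v)) (z b) = ε b * k) {b : B} (hb : Φ b = 0) :
    b = 0 := by
  have key : ∀ b, Φ b = 0 → ε b = 0 := by
    intro b hb
    have ht : tensorSum (fun u v => u ⊗ₜ[K] Φ v) (z b) = 0 := by
      refine eq_zero_of_forall_lTensor (fun c => Module.Dual.eval K B c)
        (fun f hf => LinearMap.ext hf) _ fun c => ?_
      apply (TensorProduct.rid K B).injective
      rw [map_zero, ← h₀ b hb c, LinearMap.map_tensorSum, LinearEquiv.map_tensorSum]
      simp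
    have h := hθ b
    rw [← LinearMap.map_tensorSum, ht, map_zero] at h
    exact (mul_eq_zero.1 h.symm).resolve_right hk
  refine (Module.forall_dual_apply_eq_zero_iff K b).1 fun f => ?_
  have h : Φ (tensorSum (fun u v => f u • v) (z b)) = 0 := by
    ext c
    have := congr_arg f (h₀ b hb c)
    simpa [LinearMap.map_tensorSum, tensorSum_apply, mul_comm] using this
  have h' := key _ h
  rw [LinearMap.map_tensorSum] at h'
  rw [← hz f b, ← h']
  exact tensorSum_congr fun u v => by simp [mul_comm]

variable {φ : Module.Dual K B} (hφ : IsLeftIntegral φ)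
include hφ

/-- The defining property of the integral, `∑ φ(b₍₂₎) F(b₍₁₎) = φ(b) F(1)`. -/
theorem IsLeftIntegral.sum {M : Type*} [AddCommGroup M] [Module K M] {F : B → M}
    (hF : IsLinearMap K F) (b : B) : tensorSum (fun x y => φ y • F x) (Δ b) = φ b • F 1 := by
  have h := hφ b
  rw [sweedler₂_eq_tensorSum (by fun_prop) (by fun_prop)] at h
  rw [← hF.map_smul, ← h, hF.map_tensorSum]
  exact tensorSum_congr fun x y => (hF.map_smul _ _).symm

/-- `∑ φ(a₍₂₎ b) S(a₍₁₎) = ∑ φ(a b₍₂₎) b₍₁₎`. -/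
theorem IsLeftIntegral.antipode_sum_mul (a b : B) :
    tensorSum (fun a₁ a₂ => φ (a₂ * b) • 𝐒 a₁) (Δ a) =
      tensorSum (fun b₁ b₂ => φ (a * b₂) • b₁) (Δ b) := by
  have h : ∀ a₁ a₂ : B, φ (a₂ * b) • 𝐒 a₁ = tensorSum (fun x y => φ y • (𝐒 a₁ * x)) (Δ (a₂ * b)) :=
    fun a₁ a₂ => by rw [hφ.sum (F := fun x => 𝐒 a₁ * x) (by fun_prop), mul_one]
  simp (disch := fun_prop) only [h, comul_mul_eq, tensorSum_tensorSum, tensorSum_tmul]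
  rw [tensorSum_congr fun x y => tensorSum_comm (K := K) _ _ _, tensorSum_comm]
  refine tensorSum_congr fun b₁ b₂ => ?_
  have := (isCounital_antipode_mul (K := K)).sum_left (M := B)
    (f := fun x y z => φ (z * b₂) • (𝐒 x * (y * b₁)))
    (fun u v => φ (v * b₂) • (u * b₁)) (by fun_prop) (by fun_prop)
    (fun x y z => by rw [mul_assoc]) a
  rw [one_mul] at this
  exact this

/-- `∑ φ(x₍₂₎ S(h)) x₍₁₎ = ∑ φ(x S(h₍₁₎)) h₍₂₎`. -/
theorem IsLeftIntegral.sum_mul_antipode (x h : B) :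
    tensorSum (fun x₁ x₂ => φ (x₂ * 𝐒 h) • x₁) (Δ x) =
      tensorSum (fun h₁ h₂ => φ (x * 𝐒 h₁) • h₂) (Δ h) := by
  have e : ∀ h₁ h₂ : B, φ (x * 𝐒 h₁) • h₂ =
      tensorSum (fun u v => φ v • (u * h₂)) (Δ (x * 𝐒 h₁)) :=
    fun a₁ a₂ => by rw [hφ.sum (F := fun x => x * a₂) (by fun_prop), one_mul]
  simp (disch := fun_prop) only [e, comul_mul_eq, comul_antipode_eq, tensorSum_tensorSum,
    tensorSum_tmul]
  rw [tensorSum_comm]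
  refine tensorSum_congr fun x₁ x₂ => ?_
  simp (disch := fun_prop) only [tensorSum_coassoc]
  symm
  exact (isCounital_antipode_mul (K := K)).sum_right
    (fun u v => φ (x₂ * 𝐒 u) • (x₁ * v)) (by fun_prop) (by fun_prop)
    (fun x y z => by rw [mul_assoc]) h |>.trans (by rw [mul_one])

variable (hφ₀ : φ ≠ 0)
include hφ₀

/-- The form `(x, b) ↦ φ(x b)` is non-degenerate in `b`: its radical is a one-sided coideal
by `IsLeftIntegral.antipode_sum_mul`, and `∑ φ(a S(b₍₁₎) b₍₂₎) = ε(b) φ(a)`. -/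
theorem IsLeftIntegral.eq_zero_of_mul_right {b : B} (hb : ∀ x, φ (x * b) = 0) : b = 0 := by
  obtain ⟨a, ha⟩ : ∃ a, φ a ≠ 0 := by
    by_contra! h
    exact hφ₀ (LinearMap.ext h)
  refine eq_zero_of_coideal ((LinearMap.mul K B).flip.compr₂ φ) (fun b => Δ b) (fun f b => ?_)
    (fun b hb c => ?_) (TensorProduct.lift (bilin (K := K) (fun c f => f (a * 𝐒 c))
      (fun f => by fun_prop) (fun c => by fun_prop))) ha (fun b => ?_) (LinearMap.ext hb)
  · exact tensorSum_counit_right (M := K) (by fun_prop) b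
  · have hb' : ∀ x, φ (x * b) = 0 := fun x => LinearMap.congr_fun hb x
    have := hφ.antipode_sum_mul c b
    simp only [hb', zero_smul] at this
    simp only [LinearMap.compr₂_apply, LinearMap.flip_apply, LinearMap.mul_apply', ← this]
    simp [tensorSum]
  · simp only [TensorProduct.lift.tmul, bilin_apply, LinearMap.compr₂_apply, LinearMap.flip_apply,
      LinearMap.mul_apply']
    refine ((isCounital_antipode_mul (K := K)).sum (fun u => φ (a * u)) (by fun_prop)
      (fun x y => by rw [mul_assoc]) b).trans (by simp)

/-- The subspace of all `b` with `φ(x S(b)) = 0` for all `x` contains the kernel of `S`. It is a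
one-sided coideal by `IsLeftIntegral.sum_mul_antipode`, and
`∑ φ(a S(S(b₍₂₎)) S(b₍₁₎)) = ε(b) φ(a)`, so it is zero. -/
theorem IsLeftIntegral.antipode_injective : Function.Injective 𝐒 := by
  obtain ⟨a, ha⟩ : ∃ a, φ a ≠ 0 := by
    by_contra! h
    exact hφ₀ (LinearMap.ext h)
  refine (injective_iff_map_eq_zero _).2 fun h hh => ?_
  refine eq_zero_of_coideal ((LinearMap.mul K B).flip.compr₂ φ ∘ₗ 𝐒)
    (fun b => TensorProduct.comm K B B (Δ b)) (fun f b => ?_)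
    (fun b hb c => ?_) (TensorProduct.lift (bilin (K := K) (fun c f => f (a * 𝐒 (𝐒 c)))
      (fun f => by fun_prop) (fun c => by fun_prop))) ha (fun b => ?_) (LinearMap.ext fun x => by
        simp [hh])
  · conv_lhs => rw [← tensorSum_tmul_self (Δ b)]
    simp (disch := fun_prop) only [LinearEquiv.map_tensorSum, TensorProduct.comm_tmul,
      tensorSum_tensorSum, tensorSum_tmul]
    exact tensorSum_counit_left (M := K) (by fun_prop) b
  · have hb' : ∀ x, φ (x * 𝐒 b) = 0 := fun x => LinearMap.congr_fun hb x
    have := hφ.sum_mul_antipode c b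
    conv_lhs => rw [← tensorSum_tmul_self (Δ b)]
    simp (disch := fun_prop) only [LinearEquiv.map_tensorSum, TensorProduct.comm_tmul,
      tensorSum_tensorSum, tensorSum_tmul]
    simp only [hb', zero_smul] at this
    simp only [LinearMap.comp_apply, LinearMap.compr₂_apply, LinearMap.flip_apply,
      LinearMap.mul_apply', ← this]
    simp [tensorSum]
  · conv_lhs => rw [← tensorSum_tmul_self (Δ b)]
    simp (disch := fun_prop) only [LinearEquiv.map_tensorSum, TensorProduct.comm_tmul,
      tensorSum_tensorSum, tensorSum_tmul]
    simp only [TensorProduct.lift.tmul, bilin_apply, LinearMap.compr₂_apply, LinearMap.flip_apply,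
      LinearMap.mul_apply', LinearMap.comp_apply]
    refine ((isCounital_mul_antipode (K := K)).sum (fun u => φ (a * 𝐒 u)) (by fun_prop)
      (fun x y => by rw [HopfAlgebra.antipode_mul_antidistrib, mul_assoc]) b).trans
      (by simp [HopfAlgebra.antipode_one])

/-- If a functional `f` vanishes on the range of `S`, then by `IsLeftIntegral.antipode_sum_mul`
the element `∑ f(b₍₁₎) b₍₂₎` lies in the radical of `φ(x y)`, so it is zero; now apply `ε`. -/
theorem IsLeftIntegral.antipode_surjective : Function.Surjective 𝐒 := by
  rw [← LinearMap.range_eq_top]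
  refine Submodule.eq_top_of_forall_dual _ fun f hf => LinearMap.ext fun b => ?_
  have hf' : ∀ b, f (𝐒 b) = 0 := fun b => hf _ ⟨b, rfl⟩
  have h : tensorSum (fun b₁ b₂ => f b₁ • b₂) (Δ b) = 0 := by
    refine hφ.eq_zero_of_mul_right hφ₀ fun x => ?_
    have := congr_arg f (hφ.antipode_sum_mul x b)
    rw [LinearMap.map_tensorSum, LinearMap.map_tensorSum] at this
    rw [mul_tensorSum, LinearMap.map_tensorSum]
    simp only [map_smul, hf', smul_zero] at this
    simp only [mul_smul_comm, map_smul, smul_eq_mul, mul_comm (f _)] at this ⊢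
    rw [← this]
    simp [tensorSum]
  have h' := congr_arg ε h
  rw [LinearMap.map_tensorSum] at h'
  rw [← tensorSum_counit_right (K := K) (f := fun x => f x) (by fun_prop) b]
  simpa [mul_comm] using h'

end Integral

/-! ### The dual space of a co-Frobenius Hopf algebra -/

section DualAlgebra

variable {K B : Type*} [Field K] [Ring B] [HopfAlgebra K B]

local notation "Δ" => Coalgebra.comul (R := K)
local notation "ε" => Coalgebra.counit (R := K)

theorem mem_dualSpace {φ : Module.Dual K B} {f : Module.Dual K B} :
    f ∈ dualSpace φ ↔ ∃ b, ∀ x, f x = φ (x * b) := by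
  constructor
  · rintro ⟨b, rfl⟩
    exact ⟨b, fun x => rfl⟩
  · rintro ⟨b, hb⟩
    exact ⟨b, LinearMap.ext fun x => (hb x).symm⟩

variable {φ : Module.Dual K B} (hφ : IsLeftIntegral φ) {S : B ≃ₗ[K] B}
  (hS : (S : B →ₗ[K] B) = HopfAlgebra.antipode K)

include hφ hS

/-- `φ ∘ S` is a right integral. -/
theorem IsLeftIntegral.sum_antipode {M : Type*} [AddCommGroup M] [Module K M] {F : B → M}
    (hF : IsLinearMap K F) (b : B) :
    tensorSum (fun x y => φ (S x) • F y) (Δ b) = φ (S b) • F 1 := by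
  have := hφ.sum (F := fun x => F (S.symm x)) (by fun_prop) (S b)
  simpa (disch := fun_prop) [comul_antipodeEquiv hS, tensorSum_tensorSum, tensorSum_tmul,
    antipodeEquiv_symm_one hS] using this

/-- `∑ φ(x₍₂₎ c) x₍₁₎ = ∑ φ(x c₍₂₎) S⁻¹(c₍₁₎)`. -/
theorem IsLeftIntegral.sum_mul (x c : B) :
    tensorSum (fun x₁ x₂ => φ (x₂ * c) • x₁) (Δ x) =
      tensorSum (fun c₁ c₂ => φ (x * c₂) • S.symm c₁) (Δ c) := by
  have := congr_arg S.symm (hφ.antipode_sum_mul x c)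
  simpa [LinearEquiv.map_tensorSum, antipode_apply hS] using this

/-- `∑ φ(S(c x₍₁₎)) x₍₂₎ = ∑ φ(S(c₍₁₎ x)) S⁻¹(c₍₂₎)`. -/
theorem IsLeftIntegral.sum_antipode_mul (x c : B) :
    tensorSum (fun x₁ x₂ => φ (S (c * x₁)) • x₂) (Δ x) =
      tensorSum (fun c₁ c₂ => φ (S (c₁ * x)) • S.symm c₂) (Δ c) := by
  have h : ∀ c₁ c₂ : B, φ (S (c₁ * x)) • S.symm c₂ =
      tensorSum (fun u v => φ (S u) • (S.symm c₂ * v)) (Δ (c₁ * x)) :=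
    fun c₁ c₂ => by rw [hφ.sum_antipode hS (F := fun x => S.symm c₂ * x) (by fun_prop), mul_one]
  simp (disch := fun_prop) only [h, comul_mul_eq, tensorSum_tensorSum, tensorSum_tmul,
    tensorSum_coassoc]
  symm
  refine ((isCounital_antipodeEquiv_symm_mul hS).sum_right (fun u v =>
    tensorSum (fun x₁ x₂ => φ (S (u * x₁)) • (v * x₂)) (Δ x)) (by fun_prop) (by fun_prop)
    (fun u v w => ?_) c).trans (by simp only [one_mul])
  simp only [mul_assoc]

/-- With the right integral `ψ = φ ∘ S`, one has `φ(b w) = ψ(w' b)` for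
`w = ∑ ψ(x S⁻¹(y₍₁₎)) y₍₂₎` and `w' = ∑ φ(S⁻¹(x₍₂₎) y) x₍₁₎`. -/
theorem IsLeftIntegral.apply_mul_eq (b x y : B) :
    φ (b * tensorSum (fun y₁ y₂ => φ (S (x * S.symm y₁)) • y₂) (Δ y)) =
      φ (S (tensorSum (fun x₁ x₂ => φ (S.symm x₂ * y) • x₁) (Δ x) * b)) := by
  have h₁ := congr_arg (fun u => φ (S (x * u))) (hφ.sum_mul hS b y)
  have h₂ := congr_arg (fun u => φ (u * y)) (hφ.sum_antipode_mul hS b x)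
  simp only [LinearMap.map_tensorSum, LinearEquiv.map_tensorSum, mul_tensorSum, tensorSum_mul,
    mul_smul_comm, smul_mul_assoc, map_smul, smul_eq_mul, mul_comm (φ (S _))] at h₁ h₂ ⊢
  rw [← h₁, ← h₂]

variable (hφ₀ : φ ≠ 0)
include hφ₀

/-- The form `(b, x) ↦ φ(b x)` is non-degenerate in `b`; the argument is that of
`IsLeftIntegral.eq_zero_of_mul_right`, with `S⁻¹` in place of `S`. -/
theorem IsLeftIntegral.eq_zero_of_mul_left {b : B} (hb : ∀ x, φ (b * x) = 0) : b = 0 := by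
  obtain ⟨a, ha⟩ : ∃ a, φ a ≠ 0 := by
    by_contra! h
    exact hφ₀ (LinearMap.ext h)
  refine eq_zero_of_coideal ((LinearMap.mul K B).compr₂ φ) (fun b => Δ b) (fun f b => ?_)
    (fun b hb c => ?_) (TensorProduct.lift (bilin (K := K) (fun c f => f (S.symm c * a))
      (fun f => by fun_prop) (fun c => by fun_prop))) ha (fun b => ?_) (LinearMap.ext hb)
  · exact tensorSum_counit_right (M := K) (by fun_prop) b
  · have hb' : ∀ x, φ (b * x) = 0 := fun x => LinearMap.congr_fun hb x
    have := hφ.sum_mul hS b c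
    simp only [hb', zero_smul] at this
    simp only [LinearMap.compr₂_apply, LinearMap.mul_apply', this]
    simp [tensorSum]
  · simp only [TensorProduct.lift.tmul, bilin_apply, LinearMap.compr₂_apply,
      LinearMap.mul_apply']
    refine ((isCounital_mul_antipodeEquiv_symm hS).sum (fun u => φ (u * a)) (by fun_prop)
      (fun x y => by rw [mul_assoc]) b).trans (by simp)

/-- `{φ(· b)} = {ψ(b ·)}` for the right integral `ψ = φ ∘ S`: the elements `w` and `w'` of
`IsLeftIntegral.apply_mul_eq` span `B`. -/
theorem IsLeftIntegral.mem_dualSpace_iff {f : Module.Dual K B} :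
    f ∈ dualSpace φ ↔ ∃ b, ∀ x, f x = φ (S (b * x)) := by
  let R : Submodule K (Module.Dual K B) :=
    LinearMap.range ((LinearMap.mul K B).compr₂ (φ ∘ₗ (S : B →ₗ[K] B)))
  have hR : ∀ f, f ∈ R ↔ ∃ b, ∀ x, f x = φ (S (b * x)) := by
    intro f
    constructor
    · rintro ⟨b, rfl⟩
      exact ⟨b, fun x => rfl⟩
    · rintro ⟨b, hb⟩
      exact ⟨b, LinearMap.ext fun x => (hb x).symm⟩
  rw [← hR]
  constructor
  · rintro ⟨c, rfl⟩
    have htop : R.comap ((LinearMap.mul K B).flip.compr₂ φ) = ⊤ := by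
      refine Submodule.eq_top_of_forall_dual _ fun f hf => LinearMap.ext fun y => ?_
      have h : tensorSum (fun y₁ y₂ => f y₂ • S.symm y₁) (Δ y) = 0 := by
        apply S.injective
        rw [map_zero]
        refine hφ.eq_zero_of_mul_left hS hφ₀ fun x => ?_
        obtain ⟨x, rfl⟩ := S.surjective x
        have := hf (tensorSum (fun y₁ y₂ => φ (S (x * S.symm y₁)) • y₂) (Δ y)) ((hR _).2
          ⟨_, fun b => hφ.apply_mul_eq hS b x y⟩)
        rw [← antipodeEquiv_mul hS, mul_tensorSum]
        simpa only [LinearMap.map_tensorSum, LinearEquiv.map_tensorSum, map_smul, smul_eq_mul,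
          mul_smul_comm, mul_comm (f _)] using this
      have h' := congr_arg ε h
      rw [LinearMap.map_tensorSum] at h'
      rw [← tensorSum_counit_left (K := K) (f := fun x => f x) (by fun_prop) y]
      simpa [mul_comm, counit_antipodeEquiv_symm hS] using h'
    have : c ∈ R.comap ((LinearMap.mul K B).flip.compr₂ φ) := htop ▸ Submodule.mem_top
    exact this
  · rintro ⟨c, rfl⟩
    have htop : (dualSpace φ).comap ((LinearMap.mul K B).compr₂ (φ ∘ₗ (S : B →ₗ[K] B))) = ⊤ := by
      refine Submodule.eq_top_of_forall_dual _ fun f hf => LinearMap.ext fun x => ?_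
      have h : tensorSum (fun x₁ x₂ => f x₁ • S.symm x₂) (Δ x) = 0 := by
        refine hφ.eq_zero_of_mul_left hS hφ₀ fun y => ?_
        have := hf (tensorSum (fun x₁ x₂ => φ (S.symm x₂ * y) • x₁) (Δ x))
          ((mem_dualSpace).2
          ⟨_, fun b => (hφ.apply_mul_eq hS b x y).symm⟩)
        rw [tensorSum_mul]
        simpa only [LinearMap.map_tensorSum, LinearEquiv.map_tensorSum, map_smul, smul_eq_mul,
          smul_mul_assoc, mul_comm (f _)] using this
      have h' := congr_arg ε h
      rw [LinearMap.map_tensorSum] at h'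
      rw [← tensorSum_counit_right (K := K) (f := fun x => f x) (by fun_prop) x]
      simpa [mul_comm, counit_antipodeEquiv_symm hS] using h'
    have : c ∈ (dualSpace φ).comap ((LinearMap.mul K B).compr₂ (φ ∘ₗ (S : B →ₗ[K] B))) :=
      htop ▸ Submodule.mem_top
    exact this

/-- The properties of `A = {φ(· b)}` on which the construction of the doubles rests: `A` separates
the points of `B`, is a `B`-bimodule and is a two-sided rational ideal of the algebra `B*`, that is,
`∑ ⟨a, x₍₂₎⟩ x₍₁₎` and `∑ ⟨a, x₍₁₎⟩ x₍₂₎` are given by elements of `A ⊗ B`. -/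
structure IsRationalDual (φ : Module.Dual K B) : Prop where
  eq_zero : ∀ b : B, (∀ a : DualAlg φ, a b = 0) → b = 0
  exists_bimodule : ∀ (c b : B) (a : DualAlg φ), ∃ a' : DualAlg φ, ∀ x, a' x = a (c * x * b)
  exists_right : ∀ a : DualAlg φ, ∃ t : DualAlg φ ⊗[K] B, ∀ x,
    tensorSum (fun x₁ x₂ => a x₂ • x₁) (Coalgebra.comul (R := K) x) =
      tensorSum (fun (a : DualAlg φ) c => a x • c) t
  exists_left : ∀ a : DualAlg φ, ∃ t : DualAlg φ ⊗[K] B, ∀ x,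
    tensorSum (fun x₁ x₂ => a x₁ • x₂) (Coalgebra.comul (R := K) x) =
      tensorSum (fun (a : DualAlg φ) c => a x • c) t

/-- `{φ(· b)}` is a left `B`-submodule of `B*` by definition and, being `{φ(S(b ·))}` as well, also
a right one; the two descriptions give the two halves of rationality. -/
theorem IsLeftIntegral.isRationalDual : IsRationalDual φ where
  eq_zero b hb :=
    hφ.eq_zero_of_mul_left hS hφ₀ fun x => hb ⟨(LinearMap.mul K B).flip.compr₂ φ x, x, rfl⟩
  exists_bimodule := by
    rintro c b ⟨a, ha⟩
    obtain ⟨d, rfl⟩ := ha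
    obtain ⟨d', hd'⟩ := (hφ.mem_dualSpace_iff hS hφ₀).1
      (⟨b * d, rfl⟩ : (LinearMap.mul K B).flip.compr₂ φ (b * d) ∈ dualSpace φ)
    refine ⟨⟨(LinearMap.mul K B).compr₂ (φ ∘ₗ (S : B →ₗ[K] B)) (d' * c),
      (hφ.mem_dualSpace_iff hS hφ₀).2 ⟨d' * c, fun _ => rfl⟩⟩, fun x => ?_⟩
    have := hd' (c * x)
    change φ (c * x * (b * d)) = _ at this
    change φ (S (d' * c * x)) = φ (c * x * b * d)
    rw [mul_assoc, ← this, mul_assoc (c * x)]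
  exists_right := by
    rintro ⟨a, ha⟩
    obtain ⟨c, rfl⟩ := ha
    let e : B →ₗ[K] DualAlg φ := ((LinearMap.mul K B).flip.compr₂ φ).rangeRestrict
    refine ⟨tensorSum (fun c₁ c₂ => e c₂ ⊗ₜ[K] S.symm c₁) (Δ c), fun x => ?_⟩
    simp (disch := fun_prop) only [tensorSum_tensorSum, tensorSum_tmul]
    exact hφ.sum_mul hS x c
  exists_left := by
    rintro ⟨a, ha⟩
    obtain ⟨c, hc⟩ := (hφ.mem_dualSpace_iff hS hφ₀).1 ha
    let f : B →ₗ[K] Module.Dual K B := (LinearMap.mul K B).compr₂ (φ ∘ₗ (S : B →ₗ[K] B))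
    let e : B →ₗ[K] DualAlg φ := f.codRestrict (dualSpace φ) fun d =>
      (hφ.mem_dualSpace_iff hS hφ₀).2 ⟨d, fun _ => rfl⟩
    refine ⟨tensorSum (fun c₁ c₂ => e c₁ ⊗ₜ[K] S.symm c₂) (Δ c), fun x => ?_⟩
    simp (disch := fun_prop) only [tensorSum_tensorSum, tensorSum_tmul]
    refine .trans (tensorSum_congr fun x₁ x₂ => ?_) (hφ.sum_antipode_mul hS x c)
    rw [← hc]
    rfl

end DualAlgebra

section RationalDual

variable {K B : Type*} [Field K] [Ring B] [HopfAlgebra K B] {φ : Module.Dual K B}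

theorem pairing_injective (φ : Module.Dual K B) : Function.Injective (pairing φ) :=
  Subtype.val_injective

theorem DualAlg.ext {a a' : DualAlg φ} (h : ∀ x, a x = a' x) : a = a' :=
  pairing_injective φ (LinearMap.ext h)

/-- The `B`-bimodule structure of `A`: `bimodule h c b a` is `x ↦ ⟨a, c x b⟩`. -/
def IsRationalDual.bimodule (h : IsRationalDual φ) :
    B →ₗ[K] B →ₗ[K] DualAlg φ →ₗ[K] DualAlg φ :=
  LinearMap.mk₂ K (fun c b => liftRange (pairing φ) (pairing_injective φ)
      ((((LinearMap.mul K B).flip b ∘ₗ LinearMap.mul K B c).lcomp K K) ∘ₗ pairing φ) (fun a => by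
        obtain ⟨a', ha'⟩ := h.exists_bimodule c b a
        exact ⟨a', LinearMap.ext ha'⟩))
    (fun c c' b => LinearMap.ext fun a => DualAlg.ext fun x => by simp)
    (fun k c b => LinearMap.ext fun a => DualAlg.ext fun x => by simp)
    (fun c b b' => LinearMap.ext fun a => DualAlg.ext fun x => by simp)
    (fun k c b => LinearMap.ext fun a => DualAlg.ext fun x => by simp)

@[simp]
theorem IsRationalDual.bimodule_apply (h : IsRationalDual φ) (c b : B) (a : DualAlg φ) (x : B) :
    (h.bimodule c b a) x = a (c * x * b) := by
  simp [bimodule]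

theorem evalAB_tmul (a : DualAlg φ) (b x : B) : evalAB φ (a ⊗ₜ[K] b) x = a x • b := rfl

end RationalDual

/-! ### Entwinings and twisted convolution algebras -/

section Entwining

/-- An entwining of the algebra `R` with the coalgebra `C`: a map `ψ : R ⊗ C → R ⊗ C`, written
`ψ(r ⊗ c) = r_ψ ⊗ c^ψ`, that is compatible with the products, units, coproducts and counits. The
axioms are those that make `(f g)(c) = f(c₍₁₎)_ψ g(c₍₂₎^ψ)` an associative unital product on
`Hom(C, R)`. -/
structure Entwining (K C R : Type*) [Field K] [AddCommGroup C] [Module K C] [Coalgebra K C]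
    [Ring R] [Algebra K R] where
  ψ : R →ₗ[K] C →ₗ[K] R ⊗[K] C
  mul' : ∀ r r' c, ψ (r * r') c =
    tensorSum (fun s d => tensorSum (fun s' d' => (s * s') ⊗ₜ[K] d') (ψ r' d)) (ψ r c)
  one' : ∀ c, ψ 1 c = 1 ⊗ₜ[K] c
  counit' : ∀ r c, tensorSum (fun s d => Coalgebra.counit (R := K) d • s) (ψ r c) =
    Coalgebra.counit (R := K) c • r
  comul' : ∀ r c, tensorSum (fun s d => s ⊗ₜ[K] Coalgebra.comul (R := K) d) (ψ r c) =
    tensorSum (fun c₁ c₂ => tensorSum (fun s d => tensorSum (fun u e => u ⊗ₜ[K] (d ⊗ₜ[K] e))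
      (ψ s c₂)) (ψ r c₁)) (Coalgebra.comul (R := K) c)

variable {K C R C' R' M : Type*} [Field K] [AddCommGroup C] [Module K C] [Coalgebra K C]
  [Ring R] [Algebra K R] [AddCommGroup C'] [Module K C'] [Coalgebra K C']
  [Ring R'] [Algebra K R'] [AddCommGroup M] [Module K M]

local notation "Δ" => Coalgebra.comul (R := K)
local notation "ε" => Coalgebra.counit (R := K)

namespace Entwining

theorem sum_mul (E : Entwining K C R) {g : R → C → M} (h₁ : ∀ y, IsLinearMap K fun x => g x y)
    (h₂ : ∀ x, IsLinearMap K fun y => g x y) (r r' : R) (c : C) :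
    tensorSum g (E.ψ (r * r') c) =
      tensorSum (fun s d => tensorSum (fun s' d' => g (s * s') d') (E.ψ r' d)) (E.ψ r c) := by
  simp (disch := fun_prop) only [E.mul', tensorSum_tensorSum, tensorSum_tmul]

theorem sum_one (E : Entwining K C R) {g : R → C → M} (h₁ : ∀ y, IsLinearMap K fun x => g x y)
    (h₂ : ∀ x, IsLinearMap K fun y => g x y) (c : C) :
    tensorSum g (E.ψ 1 c) = g 1 c := by
  simp (disch := fun_prop) only [E.one', tensorSum_tmul]

theorem sum_counit (E : Entwining K C R) {g : R → M} (h : IsLinearMap K g) (r : R) (c : C) :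
    tensorSum (fun s d => ε d • g s) (E.ψ r c) = ε c • g r := by
  rw [← h.map_smul, ← E.counit', h.map_tensorSum]
  exact tensorSum_congr fun s d => (h.map_smul _ _).symm

theorem sum_comul (E : Entwining K C R) {g : R → C → C → M}
    (h₁ : ∀ y z, IsLinearMap K fun x => g x y z)
    (h₂ : ∀ x z, IsLinearMap K fun y => g x y z) (h₃ : ∀ x y, IsLinearMap K fun z => g x y z)
    (r : R) (c : C) :
    tensorSum (fun s d => tensorSum (fun d₁ d₂ => g s d₁ d₂) (Δ d)) (E.ψ r c) =
      tensorSum (fun c₁ c₂ => tensorSum (fun s d => tensorSum (fun u e => g u d e)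
        (E.ψ s c₂)) (E.ψ r c₁)) (Δ c) := by
  have h := congr_arg (fun z => tensorSum (fun s t => tensorSum (fun d₁ d₂ => g s d₁ d₂) t) z)
    (E.comul' r c)
  simp (disch := fun_prop) only [tensorSum_tensorSum, tensorSum_tmul] at h
  exact h

/-- The space `Hom(C, R)` with the product `(f g)(c) = f(c₍₁₎)_ψ g(c₍₂₎^ψ)`. -/
def Conv (_E : Entwining K C R) : Type _ := C →ₗ[K] R

variable {E : Entwining K C R}

namespace Conv

instance : AddCommGroup E.Conv := inferInstanceAs (AddCommGroup (C →ₗ[K] R))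
instance : Module K E.Conv := inferInstanceAs (Module K (C →ₗ[K] R))
instance : FunLike E.Conv C R := inferInstanceAs (FunLike (C →ₗ[K] R) C R)

/-- A linear map as an element of the algebra `Hom(C, R)`. -/
def of (E : Entwining K C R) : (C →ₗ[K] R) ≃ₗ[K] E.Conv := LinearEquiv.refl K _

@[simp] theorem of_apply (f : C →ₗ[K] R) (c : C) : of E f c = f c := rfl
@[simp] theorem of_symm_apply (f : E.Conv) (c : C) : (of E).symm f c = f c := rfl

@[ext] theorem ext {f g : E.Conv} (h : ∀ c, f c = g c) : f = g := DFunLike.ext _ _ h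

@[fun_prop]
theorem isLinearMap (f : E.Conv) : IsLinearMap K fun c => f c :=
  ⟨((of E).symm f).map_add, ((of E).symm f).map_smul⟩

@[fun_prop]
theorem isLinearMap_apply {f : M → E.Conv} (hf : IsLinearMap K f) (c : C) :
    IsLinearMap K fun x => f x c :=
  ⟨fun x y => by rw [hf.map_add]; rfl, fun k x => by rw [hf.map_smul]; rfl⟩

theorem tensorSum_apply {U V : Type*} [AddCommGroup U] [Module K U] [AddCommGroup V] [Module K V]
    (g : U → V → E.Conv) (z : U ⊗[K] V) (c : C) :
    tensorSum g z c = tensorSum (fun u v => g u v c) z :=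
  IsLinearMap.map_tensorSum (L := fun f : E.Conv => f c) (by fun_prop) g z

instance : One E.Conv := ⟨of E (Algebra.linearMap K R ∘ₗ Coalgebra.counit)⟩

instance : Mul E.Conv := ⟨fun f g => of E (IsLinearMap.mk' (fun c =>
  tensorSum (fun c₁ c₂ => tensorSum (fun s d => s * g d) (E.ψ (f c₁) c₂)) (Δ c)) (by fun_prop))⟩

theorem one_apply (c : C) : (1 : E.Conv) c = ε c • 1 := Algebra.algebraMap_eq_smul_one _

theorem mul_apply (f g : E.Conv) (c : C) : (f * g) c =
    tensorSum (fun c₁ c₂ => tensorSum (fun s d => s * g d) (E.ψ (f c₁) c₂)) (Δ c) := rfl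

@[simp] theorem add_apply (f g : E.Conv) (c : C) : (f + g) c = f c + g c := rfl
@[simp] theorem smul_apply (k : K) (f : E.Conv) (c : C) : (k • f) c = k • f c := rfl
@[simp] theorem zero_apply (c : C) : (0 : E.Conv) c = 0 := rfl

protected theorem mul_assoc (f g h : E.Conv) : f * g * h = f * (g * h) := by
  ext c
  simp (disch := fun_prop) only [mul_apply, mul_tensorSum, LinearMap.map_tensorSum,
    tensorSum_tensorSum, _root_.tensorSum_apply, E.sum_mul, E.sum_comul]
  rw [← tensorSum_coassoc (by fun_prop) (by fun_prop) (by fun_prop)]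
  simp only [mul_assoc]

instance : Ring E.Conv where
  zero_mul f := by
    ext c
    exact IsLinearMap.map_zero (f := fun g : E.Conv => tensorSum (fun c₁ c₂ =>
      tensorSum (fun s d => s * f d) (E.ψ (g c₁) c₂)) (Δ c)) (by fun_prop)
  mul_zero f := by ext c; simp [mul_apply, tensorSum_zero]
  left_distrib f g h := by
    ext c
    simp only [mul_apply, add_apply]
    exact IsLinearMap.map_add (f := fun g : E.Conv => tensorSum (fun c₁ c₂ =>
      tensorSum (fun s d => s * g d) (E.ψ (f c₁) c₂)) (Δ c)) (by fun_prop) g h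
  right_distrib f g h := by
    ext c
    simp only [mul_apply, add_apply]
    exact IsLinearMap.map_add (f := fun f : E.Conv => tensorSum (fun c₁ c₂ =>
      tensorSum (fun s d => s * h d) (E.ψ (f c₁) c₂)) (Δ c)) (by fun_prop) f g
  mul_assoc := Conv.mul_assoc
  one_mul f := by
    ext c
    simp (disch := fun_prop) only [mul_apply, one_apply, map_smul, LinearMap.smul_apply]
    have : ∀ c₁ c₂ : C, tensorSum (fun s d => s * f d) (ε c₁ • E.ψ 1 c₂) = ε c₁ • f c₂ := by
      intro c₁ c₂
      rw [(IsLinearMap.tensorSum_apply (K := K) (f := fun (s : R) d => s * f d) (by fun_prop)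
        (by fun_prop)).map_smul, E.sum_one (by fun_prop) (by fun_prop), one_mul]
    simp only [this]
    exact tensorSum_counit_left (K := K) (f := fun c => f c) (by fun_prop) c
  mul_one f := by
    ext c
    simp (disch := fun_prop) only [mul_apply, one_apply, mul_smul_comm, mul_one]
    simp only [fun (r : R) (c : C) => E.sum_counit (g := fun r => r) (by fun_prop) r c]
    exact tensorSum_counit_right (K := K) (f := fun c => f c) (by fun_prop) c
  neg_add_cancel := neg_add_cancel
  sub_eq_add_neg := sub_eq_add_neg
  zsmul := zsmulRec

instance : Algebra K E.Conv := Algebra.ofModule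
  (fun k f g => by
    ext c
    exact IsLinearMap.map_smul (f := fun f : E.Conv => tensorSum (fun c₁ c₂ =>
      tensorSum (fun s d => s * g d) (E.ψ (f c₁) c₂)) (Δ c)) (by fun_prop) k f)
  (fun k f g => by
    ext c
    exact IsLinearMap.map_smul (f := fun g : E.Conv => tensorSum (fun c₁ c₂ =>
      tensorSum (fun s d => s * g d) (E.ψ (f c₁) c₂)) (Δ c)) (by fun_prop) k g)

end Conv

/-! #### Tensor products of entwinings -/

/-- The structure map of the tensor product of two entwinings,
`(r ⊗ r') ⊗ (c ⊗ c') ↦ ψ(r ⊗ c) ⊗ ψ'(r' ⊗ c')` up to the order of the factors. -/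
def tensorψ (E : Entwining K C R) (E' : Entwining K C' R') :
    R ⊗[K] R' →ₗ[K] C ⊗[K] C' →ₗ[K] (R ⊗[K] R') ⊗[K] (C ⊗[K] C') :=
  (TensorProduct.map₂ E.ψ E'.ψ).compr₂ (TensorProduct.tensorTensorTensorComm K R C R' C')

theorem sum_tensorψ (E : Entwining K C R) (E' : Entwining K C' R')
    {g : R ⊗[K] R' → C ⊗[K] C' → M}
    (h₁ : ∀ y, IsLinearMap K fun x => g x y) (h₂ : ∀ x, IsLinearMap K fun y => g x y)
    (r : R) (r' : R') (c : C) (c' : C') :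
    tensorSum g (tensorψ E E' (r ⊗ₜ[K] r') (c ⊗ₜ[K] c')) =
      tensorSum (fun s d => tensorSum (fun s' d' => g (s ⊗ₜ[K] s') (d ⊗ₜ[K] d')) (E'.ψ r' c'))
        (E.ψ r c) := by
  simp only [tensorψ, LinearMap.compr₂_apply, TensorProduct.map₂_apply_tmul, TensorProduct.map_tmul]
  conv_lhs => rw [← tensorSum_tmul_self (E.ψ r c), ← tensorSum_tmul_self (E'.ψ r' c')]
  simp (disch := fun_prop) only [tensorSum_tmul_const, const_tmul_tensorSum,
    LinearEquiv.map_tensorSum, tensorSum_tensorSum, tensorSum_tmul,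
    TensorProduct.tensorTensorTensorComm_tmul, LinearEquiv.coe_coe]
  exact tensorSum_comm (K := K) ..

/-- The tensor product of two entwinings. -/
def tensor (E : Entwining K C R) (E' : Entwining K C' R') :
    Entwining K (C ⊗[K] C') (R ⊗[K] R') where
  ψ := tensorψ E E'
  mul' r r' c := by
    revert r; refine eq_of_tmul (by fun_prop) (by fun_prop) fun r₁ r₂ => ?_
    revert r'; refine eq_of_tmul (by fun_prop) (by fun_prop) fun r'₁ r'₂ => ?_
    revert c; refine eq_of_tmul (by fun_prop) (by fun_prop) fun c₁ c₂ => ?_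
    rw [Algebra.TensorProduct.tmul_mul_tmul, ← tensorSum_tmul_self (tensorψ E E' _ _)]
    simp (disch := fun_prop) only [sum_tensorψ, E.sum_mul, E'.sum_mul,
      Algebra.TensorProduct.tmul_mul_tmul]
    refine tensorSum_congr fun s d => ?_
    rw [tensorSum_comm]
  one' c := by
    revert c; refine eq_of_tmul (by fun_prop) (by fun_prop) fun c₁ c₂ => ?_
    rw [Algebra.TensorProduct.one_def, ← tensorSum_tmul_self (tensorψ E E' _ _)]
    simp (disch := fun_prop) only [sum_tensorψ, E.sum_one, E'.sum_one]
  counit' r c := by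
    revert r; refine eq_of_tmul (by fun_prop) (by fun_prop) fun r₁ r₂ => ?_
    revert c; refine eq_of_tmul (by fun_prop) (by fun_prop) fun c₁ c₂ => ?_
    simp (disch := fun_prop) only [sum_tensorψ, TensorProduct.counit_tmul, smul_eq_mul, mul_smul,
      E'.sum_counit]
    simp (disch := fun_prop) only [← smul_tensorSum]
    rw [E.sum_counit (g := fun s => s ⊗ₜ[K] r₂) (by fun_prop), smul_comm]
  comul' r c := by
    revert r; refine eq_of_tmul (by fun_prop) (by fun_prop) fun r₁ r₂ => ?_
    revert c; refine eq_of_tmul (by fun_prop) (by fun_prop) fun c₁ c₂ => ?_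
    simp (disch := fun_prop) only [sum_tensorψ, comul_tmul_eq, tensorSum_tensorSum, tensorSum_tmul,
      const_tmul_tensorSum]
    refine (tensorSum_congr fun s d => tensorSum_comm (K := K) _ _ _).trans ?_
    simp (disch := fun_prop) only [E.sum_comul, E'.sum_comul]
    refine tensorSum_congr fun u v => ?_
    rw [tensorSum_comm (K := K) (z := Δ c₂)]
    refine tensorSum_congr fun s d => ?_
    rw [tensorSum_comm (K := K) (w := Δ c₂)]
    refine tensorSum_congr fun u' v' => ?_
    rw [tensorSum_comm (K := K) (z := E.ψ s v)]

/-! #### Morphisms of entwinings -/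

/-- An algebra homomorphism `f : R → R'` and a coalgebra homomorphism `g : C' → C` with
`(f ⊗ ι)ψ(r ⊗ g(c)) = (ι ⊗ g)ψ'(f(r) ⊗ c)`; then `T ↦ f ∘ T ∘ g` is an algebra homomorphism
`Hom(C, R) → Hom(C', R')`. -/
structure Hom (E : Entwining K C R) (E' : Entwining K C' R') where
  f : R →ₐ[K] R'
  g : C' →ₗ[K] C
  counit' : ∀ c, ε (g c) = ε c
  comul' : ∀ c, Δ (g c) = tensorSum (fun c₁ c₂ => g c₁ ⊗ₜ[K] g c₂) (Δ c)
  compat : ∀ r c, tensorSum (fun s d => f s ⊗ₜ[K] d) (E.ψ r (g c)) =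
    tensorSum (fun s d => s ⊗ₜ[K] g d) (E'.ψ (f r) c)

namespace Hom

variable {E' : Entwining K C' R'}

theorem sum_comul (D : Hom E E') {h : C → C → M} (h₁ : ∀ y, IsLinearMap K fun x => h x y)
    (h₂ : ∀ x, IsLinearMap K fun y => h x y) (c : C') :
    tensorSum h (Δ (D.g c)) = tensorSum (fun c₁ c₂ => h (D.g c₁) (D.g c₂)) (Δ c) := by
  simp (disch := fun_prop) only [D.comul', tensorSum_tensorSum, tensorSum_tmul]

theorem sum_compat (D : Hom E E') {h : R' → C → M} (h₁ : ∀ y, IsLinearMap K fun x => h x y)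
    (h₂ : ∀ x, IsLinearMap K fun y => h x y) (r : R) (c : C') :
    tensorSum (fun s d => h (D.f s) d) (E.ψ r (D.g c)) =
      tensorSum (fun s d => h s (D.g d)) (E'.ψ (D.f r) c) := by
  have := congr_arg (fun z => tensorSum h z) (D.compat r c)
  simpa (disch := fun_prop) only [tensorSum_tensorSum, tensorSum_tmul] using this

@[fun_prop]
theorem isLinearMap_f (D : Hom E E') : IsLinearMap K fun r => D.f r :=
  ⟨map_add D.f, map_smul D.f⟩

/-- The algebra homomorphism `T ↦ f ∘ T ∘ g`. -/
def map (D : Hom E E') : E.Conv →ₐ[K] E'.Conv := AlgHom.ofLinearMap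
  { toFun := fun T => Conv.of E' (D.f.toLinearMap ∘ₗ (Conv.of E).symm T ∘ₗ D.g)
    map_add' := fun T T' => by ext c; simp
    map_smul' := fun k T => by ext c; simp }
  (by ext c; simp [Conv.one_apply, D.counit'])
  (fun T T' => by
    ext c
    simp (disch := fun_prop) only [LinearMap.coe_mk, AddHom.coe_mk, Conv.of_apply,
      LinearMap.comp_apply, Conv.of_symm_apply, Conv.mul_apply, D.sum_comul,
      D.isLinearMap_f.map_tensorSum, AlgHom.toLinearMap_apply, map_mul]
    refine tensorSum_congr fun c₁ c₂ => ?_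
    exact D.sum_compat (h := fun s d => s * D.f (T' d)) (by fun_prop) (by fun_prop) _ _)

@[simp]
theorem map_apply (D : Hom E E') (T : E.Conv) (c : C') : D.map T c = D.f (T (D.g c)) := rfl

end Hom

end Entwining
end Entwining

/-! ### Tensor products of twisted convolution algebras -/

@[fun_prop]
theorem AlgHom.isLinearMap_coe {K A A' : Type*} [Field K] [Ring A] [Algebra K A] [Ring A']
    [Algebra K A'] (f : A →ₐ[K] A') : IsLinearMap K fun x => f x :=
  ⟨map_add f, map_smul f⟩

section EntwiningTensor

variable {K C R C' R' C'' R'' M V W U : Type*} [Field K] [AddCommGroup C] [Module K C]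
  [Coalgebra K C] [Ring R] [Algebra K R] [AddCommGroup C'] [Module K C'] [Coalgebra K C']
  [Ring R'] [Algebra K R'] [AddCommGroup C''] [Module K C''] [Coalgebra K C'']
  [Ring R''] [Algebra K R''] [AddCommGroup M] [Module K M] [AddCommGroup V] [Module K V]
  [AddCommGroup W] [Module K W] [AddCommGroup U] [Module K U]

local notation "Δ" => Coalgebra.comul (R := K)
local notation "ε" => Coalgebra.counit (R := K)

namespace Entwining

variable {E : Entwining K C R} {E' : Entwining K C' R'} {E'' : Entwining K C'' R''}

theorem sum_tensor (E : Entwining K C R) (E' : Entwining K C' R')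
    {g : R ⊗[K] R' → C ⊗[K] C' → M}
    (h₁ : ∀ y, IsLinearMap K fun x => g x y) (h₂ : ∀ x, IsLinearMap K fun y => g x y)
    (r : R) (r' : R') (c : C) (c' : C') :
    tensorSum g ((E.tensor E').ψ (r ⊗ₜ[K] r') (c ⊗ₜ[K] c')) =
      tensorSum (fun s d => tensorSum (fun s' d' => g (s ⊗ₜ[K] s') (d ⊗ₜ[K] d')) (E'.ψ r' c'))
        (E.ψ r c) :=
  sum_tensorψ E E' h₁ h₂ r r' c c'

namespace Conv

theorem ext_tmul {F G : (E.tensor E').Conv} (h : ∀ c c', F (c ⊗ₜ[K] c') = G (c ⊗ₜ[K] c')) :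
    F = G := by
  ext c
  revert c
  exact eq_of_tmul (by fun_prop) (by fun_prop) h

/-- The tensor product of `f : C → R` and `f' : C' → R'`. -/
def tmul : E.Conv →ₗ[K] E'.Conv →ₗ[K] (E.tensor E').Conv :=
  LinearMap.mk₂ K (fun f f' =>
      of (E.tensor E') (TensorProduct.map ((of E).symm f) ((of E').symm f')))
    (fun f g f' => by apply ext_tmul; intro c c'; simp [TensorProduct.add_tmul])
    (fun k f f' => by apply ext_tmul; intro c c'; simp [TensorProduct.smul_tmul'])
    (fun f f' g' => by apply ext_tmul; intro c c'; simp [TensorProduct.tmul_add])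
    (fun k f f' => by apply ext_tmul; intro c c'; simp)

@[simp]
theorem tmul_apply (f : E.Conv) (f' : E'.Conv) (c : C) (c' : C') :
    tmul f f' (c ⊗ₜ[K] c') = f c ⊗ₜ[K] f' c' := by
  simp [tmul]

@[simp]
theorem tmul_one_one : tmul (1 : E.Conv) (1 : E'.Conv) = 1 := by
  apply ext_tmul; intro c c'
  simp only [tmul_apply, one_apply, TensorProduct.tmul_smul, ← TensorProduct.smul_tmul',
    TensorProduct.counit_tmul, Algebra.TensorProduct.one_def, smul_eq_mul, mul_smul]

theorem mul_tmul_apply (Z : (E.tensor E').Conv) (f : E.Conv) (f' : E'.Conv) (c : C) (c' : C') :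
    (Z * tmul f f') (c ⊗ₜ[K] c') =
      tensorSum (fun c₁ c₂ => tensorSum (fun c'₁ c'₂ => tensorSum (fun r r' =>
        tensorSum (fun s d => s * f d) (E.ψ r c₂) ⊗ₜ[K]
          tensorSum (fun s' d' => s' * f' d') (E'.ψ r' c'₂))
          (Z (c₁ ⊗ₜ[K] c'₁))) (Δ c')) (Δ c) := by
  rw [mul_apply]
  simp (disch := fun_prop) only [comul_tmul_eq, tensorSum_tensorSum, tensorSum_tmul]
  refine tensorSum_congr fun c₁ c₂ => tensorSum_congr fun c'₁ c'₂ => ?_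
  generalize Z (c₁ ⊗ₜ[K] c'₁) = z
  revert z
  refine eq_of_tmul (by fun_prop) (by fun_prop) fun r r' => ?_
  simp (disch := fun_prop) only [sum_tensor, tensorSum_tmul, tmul_apply, tensorSum_tmul_const,
    const_tmul_tensorSum, Algebra.TensorProduct.tmul_mul_tmul]
  exact tensorSum_comm (K := K) ..

theorem tmul_mul_tmul (f g : E.Conv) (f' g' : E'.Conv) :
    tmul f f' * tmul g g' = tmul (f * g) (f' * g') := by
  apply ext_tmul; intro c c'
  rw [mul_tmul_apply]
  simp (disch := fun_prop) only [tmul_apply, tensorSum_tmul, mul_apply]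
  rw [tensorSum_tmul_const]
  refine tensorSum_congr fun c₁ c₂ => ?_
  rw [const_tmul_tensorSum]

/-- `(f ⊗ 1) Z`; the entwining of the second factor does not enter. -/
theorem tmul_one_mul_apply (Z : (E.tensor E').Conv) (f : E.Conv) (c : C) (c' : C') :
    (tmul f (1 : E'.Conv) * Z) (c ⊗ₜ[K] c') = tensorSum (fun c₁ c₂ => tensorSum (fun s d =>
      (s ⊗ₜ[K] 1) * Z (d ⊗ₜ[K] c')) (E.ψ (f c₁) c₂)) (Δ c) := by
  rw [mul_apply]
  simp (disch := fun_prop) only [comul_tmul_eq, tensorSum_tensorSum, tensorSum_tmul, tmul_apply,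
    one_apply, TensorProduct.tmul_smul, map_smul, LinearMap.smul_apply]
  refine tensorSum_congr fun c₁ c₂ => ?_
  rw [← tensorSum_counit_left (K := K) (f := fun c'' => tensorSum (fun s d =>
      (s ⊗ₜ[K] 1) * Z (d ⊗ₜ[K] c'')) (E.ψ (f c₁) c₂)) (by fun_prop) c']
  refine tensorSum_congr fun c'₁ c'₂ => ?_
  rw [(IsLinearMap.tensorSum_apply (f := fun (s : R ⊗[K] R') d => s * Z d) (by fun_prop)
    (by fun_prop)).map_smul]
  simp (disch := fun_prop) only [sum_tensor, E'.sum_one]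

/-- `(1 ⊗ f) Z`; the entwining of the first factor does not enter. -/
theorem one_tmul_mul_apply (Z : (E.tensor E').Conv) (f : E'.Conv) (c : C) (c' : C') :
    (tmul (1 : E.Conv) f * Z) (c ⊗ₜ[K] c') = tensorSum (fun c₁ c₂ => tensorSum (fun s d =>
      (1 ⊗ₜ[K] s) * Z (c ⊗ₜ[K] d)) (E'.ψ (f c₁) c₂)) (Δ c') := by
  rw [mul_apply]
  simp (disch := fun_prop) only [comul_tmul_eq, tensorSum_tensorSum, tensorSum_tmul, tmul_apply,
    one_apply, ← TensorProduct.smul_tmul', map_smul, LinearMap.smul_apply]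
  rw [tensorSum_comm]
  refine tensorSum_congr fun c₁ c₂ => ?_
  rw [← tensorSum_counit_left (K := K) (f := fun c'' => tensorSum (fun s d =>
      (1 ⊗ₜ[K] s) * Z (c'' ⊗ₜ[K] d)) (E'.ψ (f c₁) c₂)) (by fun_prop) c]
  refine tensorSum_congr fun c'₁ c'₂ => ?_
  rw [(IsLinearMap.tensorSum_apply (f := fun (s : R ⊗[K] R') d => s * Z d) (by fun_prop)
    (by fun_prop)).map_smul]
  simp (disch := fun_prop) only [sum_tensor, E.sum_one]

/-- `Z (f ⊗ 1)`; the entwining of the second factor does not enter. -/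
theorem mul_tmul_one_apply (Z : (E.tensor E').Conv) (f : E.Conv) (c : C) (c' : C') :
    (Z * tmul f (1 : E'.Conv)) (c ⊗ₜ[K] c') = tensorSum (fun c₁ c₂ => tensorSum (fun r r' =>
        tensorSum (fun s d => s * f d) (E.ψ r c₂) ⊗ₜ[K] r') (Z (c₁ ⊗ₜ[K] c'))) (Δ c) := by
  rw [mul_tmul_apply]
  refine tensorSum_congr fun c₁ c₂ => ?_
  rw [← tensorSum_counit_right (K := K) (f := fun c' => tensorSum (fun r r' =>
        tensorSum (fun s d => s * f d) (E.ψ r c₂) ⊗ₜ[K] r') (Z (c₁ ⊗ₜ[K] c')))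
    (by fun_prop) c']
  refine tensorSum_congr fun c'₁ c'₂ => ?_
  simp only [one_apply, mul_smul_comm, mul_one, smul_tensorSum]
  refine tensorSum_congr fun r r' => ?_
  rw [E'.sum_counit (g := fun r => r) (by fun_prop), TensorProduct.tmul_smul]

/-- `Z (1 ⊗ f)`; the entwining of the first factor does not enter. -/
theorem mul_one_tmul_apply (Z : (E.tensor E').Conv) (f : E'.Conv) (c : C) (c' : C') :
    (Z * tmul (1 : E.Conv) f) (c ⊗ₜ[K] c') = tensorSum (fun c₁ c₂ => tensorSum (fun r r' =>
        r ⊗ₜ[K] tensorSum (fun s d => s * f d) (E'.ψ r' c₂)) (Z (c ⊗ₜ[K] c₁))) (Δ c') := by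
  rw [mul_tmul_apply, tensorSum_comm]
  refine tensorSum_congr fun c₁ c₂ => ?_
  rw [← tensorSum_counit_right (K := K) (f := fun c => tensorSum (fun r r' =>
        r ⊗ₜ[K] tensorSum (fun s d => s * f d) (E'.ψ r' c₂)) (Z (c ⊗ₜ[K] c₁)))
    (by fun_prop) c]
  refine tensorSum_congr fun c'₁ c'₂ => ?_
  simp only [one_apply, mul_smul_comm, mul_one, smul_tensorSum]
  refine tensorSum_congr fun r r' => ?_
  rw [E.sum_counit (g := fun r => r) (by fun_prop), TensorProduct.smul_tmul']

/-- The map `V ⊗ W → Hom(C ⊗ C', R ⊗ R')` given by `V → Hom(C, R)` and `W → Hom(C', R')`. -/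
def mapTensor (j : V →ₗ[K] E.Conv) (j' : W →ₗ[K] E'.Conv) : V ⊗[K] W →ₗ[K] (E.tensor E').Conv :=
  TensorProduct.lift (tmul.compl₁₂ j j')

@[simp]
theorem mapTensor_tmul (j : V →ₗ[K] E.Conv) (j' : W →ₗ[K] E'.Conv) (v : V) (w : W) :
    mapTensor j j' (v ⊗ₜ[K] w) = tmul (j v) (j' w) := by
  simp [mapTensor]

theorem mapTensor_injective {j : V →ₗ[K] E.Conv} {j' : W →ₗ[K] E'.Conv}
    (hj : Function.Injective j) (hj' : Function.Injective j') :
    Function.Injective (mapTensor j j') := by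
  refine (injective_iff_map_eq_zero _).2 fun z hz => ?_
  refine eq_zero_of_forall_map (fun c => (isLinearMap_apply j.isLinear c).mk')
    (fun c => (isLinearMap_apply j'.isLinear c).mk')
    (fun v hv => hj (by ext c; simpa using hv c)) (fun v hv => hj' (by ext c; simpa using hv c))
    z fun c c' => ?_
  have h : mapTensor j j' z (c ⊗ₜ[K] c') = 0 := by rw [hz]; rfl
  rw [← h]
  clear hz h
  revert z
  refine eq_of_tmul (by fun_prop) (by fun_prop) fun v w => ?_
  simp

end Conv

namespace Hom

/-- The identity morphism. -/
protected def id (E : Entwining K C R) : Hom E E where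
  f := AlgHom.id K R
  g := LinearMap.id
  counit' _ := rfl
  comul' _ := (tensorSum_tmul_self _).symm
  compat _ _ := rfl

/-- The tensor product of two morphisms. -/
def tensor {C₁ R₁ C'₁ R'₁ : Type*} [AddCommGroup C₁] [Module K C₁] [Coalgebra K C₁]
    [Ring R₁] [Algebra K R₁] [AddCommGroup C'₁] [Module K C'₁] [Coalgebra K C'₁]
    [Ring R'₁] [Algebra K R'₁] {E₁ : Entwining K C₁ R₁} {E'₁ : Entwining K C'₁ R'₁}
    (D : Hom E E₁) (D' : Hom E' E'₁) :
    Hom (E.tensor E') (E₁.tensor E'₁) where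
  f := Algebra.TensorProduct.map D.f D'.f
  g := TensorProduct.map D.g D'.g
  counit' c := by
    revert c
    refine eq_of_tmul (by fun_prop) (by fun_prop) fun c c' => ?_
    simp [D.counit', D'.counit']
  comul' c := by
    revert c
    refine eq_of_tmul (by fun_prop) (by fun_prop) fun c c' => ?_
    simp (disch := fun_prop) only [TensorProduct.map_tmul, comul_tmul_eq, D.sum_comul,
      D'.sum_comul, tensorSum_tensorSum, tensorSum_tmul]
  compat r c := by
    revert r
    refine eq_of_tmul (by fun_prop) (by fun_prop) fun r r' => ?_
    revert c
    refine eq_of_tmul (by fun_prop) (by fun_prop) fun c c' => ?_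
    simp (disch := fun_prop) only [TensorProduct.map_tmul, sum_tensor,
      Algebra.TensorProduct.map_tmul]
    have h := fun (s' : R'₁) (d' : C'₁) =>
      D.sum_compat (h := fun s d => (s ⊗ₜ[K] s') ⊗ₜ[K] (d ⊗ₜ[K] D'.g d'))
      (by fun_prop) (by fun_prop) r c
    have h' := fun (s : R₁) (d : C) =>
      D'.sum_compat (h := fun s' d' => (s ⊗ₜ[K] s') ⊗ₜ[K] (d ⊗ₜ[K] d'))
      (by fun_prop) (by fun_prop) r' c'
    simp only [h']
    rw [tensorSum_comm]
    simp only [h]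
    exact tensorSum_comm (K := K) ..

/-- The associativity isomorphism `(E ⊗ E') ⊗ E'' → E ⊗ (E' ⊗ E'')`. -/
def assoc (E : Entwining K C R) (E' : Entwining K C' R') (E'' : Entwining K C'' R'') :
    Hom ((E.tensor E').tensor E'') (E.tensor (E'.tensor E'')) where
  f := (Algebra.TensorProduct.assoc K K K R R' R'').toAlgHom
  g := (TensorProduct.assoc K C C' C'').symm
  counit' c := by
    revert c
    refine eq_of_tmul (by fun_prop) (by fun_prop) fun c z => ?_
    revert z
    refine eq_of_tmul (by fun_prop) (by fun_prop) fun c' c'' => ?_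
    simp [mul_assoc]
  comul' c := by
    revert c
    refine eq_of_tmul (by fun_prop) (by fun_prop) fun c z => ?_
    revert z
    refine eq_of_tmul (by fun_prop) (by fun_prop) fun c' c'' => ?_
    simp (disch := fun_prop) only [comul_tmul_eq, tensorSum_tensorSum, tensorSum_tmul,
      LinearEquiv.coe_coe, TensorProduct.assoc_symm_tmul]
  compat r c := by
    revert c
    refine eq_of_tmul (by fun_prop) (by fun_prop) fun c z => ?_
    revert z
    refine eq_of_tmul (by fun_prop) (by fun_prop) fun c' c'' => ?_
    revert r
    refine eq_of_tmul (by fun_prop) (by fun_prop) fun z r'' => ?_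
    revert z
    refine eq_of_tmul (by fun_prop) (by fun_prop) fun r r' => ?_
    have h : ∀ (x : R) (y : R') (z : R''), (Algebra.TensorProduct.assoc K K K R R' R'').toAlgHom
      ((x ⊗ₜ[K] y) ⊗ₜ[K] z) = x ⊗ₜ[K] (y ⊗ₜ[K] z) := fun _ _ _ => rfl
    simp (disch := fun_prop) only [LinearEquiv.coe_coe, TensorProduct.assoc_symm_tmul,
      sum_tensor, h]

theorem tensor_map_tmul {C₁ R₁ C'₁ R'₁ : Type*} [AddCommGroup C₁] [Module K C₁] [Coalgebra K C₁]
    [Ring R₁] [Algebra K R₁] [AddCommGroup C'₁] [Module K C'₁] [Coalgebra K C'₁]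
    [Ring R'₁] [Algebra K R'₁] {E₁ : Entwining K C₁ R₁} {E'₁ : Entwining K C'₁ R'₁}
    (D : Hom E E₁) (D' : Hom E' E'₁) (f : E.Conv) (f' : E'.Conv) :
    (D.tensor D').map (Conv.tmul f f') = Conv.tmul (D.map f) (D'.map f') := by
  apply Conv.ext_tmul; intro c c'
  rfl

theorem id_map (f : E.Conv) : (Hom.id E).map f = f := rfl

theorem assoc_map_tmul (f : E.Conv) (f' : E'.Conv) (f'' : E''.Conv) :
    (assoc E E' E'').map (Conv.tmul (Conv.tmul f f') f'') = Conv.tmul f (Conv.tmul f' f'') := by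
  apply Conv.ext_tmul; intro c z
  revert z
  refine eq_of_tmul (by fun_prop) (by fun_prop) fun c' c'' => ?_
  rfl

end Hom

end Entwining
end EntwiningTensor

/-! ### Multiplier Hopf algebras of functions -/

section Builder

variable {K C R V : Type*} [Field K] [AddCommGroup C] [Module K C] [Coalgebra K C]
  [Ring R] [Algebra K R] [AddCommGroup V] [Module K V]

local notation "Δ" => Coalgebra.comul (R := K)
local notation "ε" => Coalgebra.counit (R := K)

namespace Entwining

variable {E : Entwining K C R}

namespace Conv

/-- If `f g = 0` for enough scalar functions `g`, then `f = 0`. -/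
theorem eq_zero_of_mul_right {ι : Type*} (u : ι → E.Conv) (ℓ : ι → Module.Dual K C)
    (hu : ∀ i c, u i c = ℓ i c • 1) (hℓ : ∀ c, (∀ i, ℓ i c = 0) → c = 0) (f : E.Conv)
    (hf : ∀ i, f * u i = 0) : f = 0 := by
  ext c
  have h : tensorSum (fun c₁ c₂ => E.ψ (f c₁) c₂) (Δ c) = 0 := by
    refine eq_zero_of_forall_lTensor ℓ hℓ _ fun i => ?_
    apply (TensorProduct.rid K R).injective
    rw [map_zero, LinearMap.map_tensorSum, LinearEquiv.map_tensorSum]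
    have := DFunLike.congr_fun (hf i) c
    simp only [mul_apply, hu, mul_smul_comm, mul_one, zero_apply] at this
    refine .trans (tensorSum_congr fun c₁ c₂ => ?_) this
    conv_lhs => rw [← tensorSum_tmul_self (E.ψ (f c₁) c₂)]
    simp only [LinearMap.map_tensorSum, LinearEquiv.map_tensorSum, LinearMap.lTensor_tmul,
      TensorProduct.rid_tmul]
  have h' := congr_arg (tensorSum fun s d => ε d • s) h
  simp (disch := fun_prop) only [tensorSum_tensorSum] at h'
  rw [(IsLinearMap.tensorSum_apply (K := K) (f := fun (s : R) (d : C) => ε d • s) (by fun_prop)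
    (by fun_prop)).map_zero] at h'
  simp only [fun r c => E.sum_counit (g := fun r => r) (by fun_prop) r c] at h'
  rw [zero_apply, ← h']
  exact (tensorSum_counit_right (K := K) (f := fun c => f c) (by fun_prop) c).symm

/-- If `g f = 0` for enough scalar functions `g`, then `f = 0`. -/
theorem eq_zero_of_mul_left {ι : Type*} (u : ι → E.Conv) (ℓ : ι → Module.Dual K C)
    (hu : ∀ i c, u i c = ℓ i c • 1) (hℓ : ∀ c, (∀ i, ℓ i c = 0) → c = 0) (f : E.Conv)
    (hf : ∀ i, u i * f = 0) : f = 0 := by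
  ext c
  have h : tensorSum (fun c₁ c₂ => f c₂ ⊗ₜ[K] c₁) (Δ c) = 0 := by
    refine eq_zero_of_forall_lTensor ℓ hℓ _ fun i => ?_
    apply (TensorProduct.rid K R).injective
    rw [map_zero, LinearMap.map_tensorSum, LinearEquiv.map_tensorSum]
    have := DFunLike.congr_fun (hf i) c
    simp only [mul_apply, hu, map_smul, LinearMap.smul_apply, zero_apply] at this
    refine .trans (tensorSum_congr fun c₁ c₂ => ?_) this
    rw [(IsLinearMap.tensorSum_apply (K := K) (f := fun (s : R) (d : C) => s * f d) (by fun_prop)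
      (by fun_prop)).map_smul, E.sum_one (by fun_prop) (by fun_prop)]
    simp
  have h' := congr_arg (tensorSum fun r c => ε c • r) h
  simp (disch := fun_prop) only [tensorSum_tensorSum, tensorSum_tmul] at h'
  rw [(IsLinearMap.tensorSum_apply (K := K) (f := fun (s : R) (d : C) => ε d • s) (by fun_prop)
    (by fun_prop)).map_zero] at h'
  rw [zero_apply, ← h']
  exact (tensorSum_counit_left (K := K) (f := fun c => f c) (by fun_prop) c).symm

end Conv

/-- A vector space of functions `j : V → Hom(C, R)` that is closed under the product and contains
enough scalar functions: the functionals `ℓ` for which `ℓ(·) 1` belongs to `V` separate the points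
of `C`. -/
structure Realization (E : Entwining K C R) (V : Type*) [AddCommGroup V] [Module K V] where
  j : V →ₗ[K] E.Conv
  injective : Function.Injective j
  mul_mem : ∀ a b, j a * j b ∈ LinearMap.range j
  eq_zero : ∀ c, (∀ (v : V) (ℓ : Module.Dual K C), (∀ x, j v x = ℓ x • 1) → ℓ c = 0) → c = 0

namespace Realization

variable (ρ : Realization E V)

/-- The product of `V`. -/
def mul : V →ₗ[K] V →ₗ[K] V :=
  liftRange₂ ρ.j ρ.injective ((LinearMap.mul K E.Conv).compl₁₂ ρ.j ρ.j) ρ.mul_mem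

@[simp]
theorem j_mul (a b : V) : ρ.j (ρ.mul a b) = ρ.j a * ρ.j b :=
  apply_liftRange₂ ..

/-- The algebra `V`, with the product of `Hom(C, R)`. -/
def algebra : NondegenerateAlgebra K V where
  mul := ρ.mul
  mul_assoc a b c := ρ.injective (by simp [_root_.mul_assoc])
  eq_zero_of_mul_right a h := ρ.injective (by
    rw [map_zero]
    refine Conv.eq_zero_of_mul_right
      (ι := {p : V × Module.Dual K C // ∀ x, ρ.j p.1 x = p.2 x • 1})
      (fun i => ρ.j i.1.1) (fun i => i.1.2) (fun i => i.2)
      (fun c hc => ρ.eq_zero c fun v ℓ hℓ => hc ⟨(v, ℓ), hℓ⟩) _ fun i => ?_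
    rw [← j_mul, h, map_zero])
  eq_zero_of_mul_left a h := ρ.injective (by
    rw [map_zero]
    refine Conv.eq_zero_of_mul_left
      (ι := {p : V × Module.Dual K C // ∀ x, ρ.j p.1 x = p.2 x • 1})
      (fun i => ρ.j i.1.1) (fun i => i.1.2) (fun i => i.2)
      (fun c hc => ρ.eq_zero c fun v ℓ hℓ => hc ⟨(v, ℓ), hℓ⟩) _ fun i => ?_
    rw [← j_mul, h, map_zero])

@[simp]
theorem algebra_mul : ρ.algebra.mul = ρ.mul := rfl

/-- `V ⊗ V` as a space of functions `C ⊗ C → R ⊗ R`. -/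
def j₂ : V ⊗[K] V →ₗ[K] (E.tensor E).Conv := Conv.mapTensor ρ.j ρ.j

@[simp]
theorem j₂_tmul (a b : V) : ρ.j₂ (a ⊗ₜ[K] b) = Conv.tmul (ρ.j a) (ρ.j b) :=
  Conv.mapTensor_tmul ..

theorem j₂_injective : Function.Injective ρ.j₂ :=
  Conv.mapTensor_injective ρ.injective ρ.injective

theorem j₂_mulTensor (u w : V ⊗[K] V) :
    ρ.j₂ (ρ.algebra.mulTensor u w) = ρ.j₂ u * ρ.j₂ w := by
  revert u
  refine eq_of_tmul (by fun_prop) (by fun_prop) fun a b => ?_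
  revert w
  refine eq_of_tmul (by fun_prop) (by fun_prop) fun c d => ?_
  simp [NondegenerateAlgebra.mulTensor, algebra, Conv.tmul_mul_tmul]

theorem j₂_lTensor_mul (b : V) (u : V ⊗[K] V) :
    ρ.j₂ ((ρ.mul b).lTensor V u) = Conv.tmul 1 (ρ.j b) * ρ.j₂ u := by
  revert u
  refine eq_of_tmul (by fun_prop) (by fun_prop) fun c d => ?_
  simp [Conv.tmul_mul_tmul]

theorem j₂_rTensor_mul (b : V) (u : V ⊗[K] V) :
    ρ.j₂ ((ρ.mul b).rTensor V u) = Conv.tmul (ρ.j b) 1 * ρ.j₂ u := by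
  revert u
  refine eq_of_tmul (by fun_prop) (by fun_prop) fun c d => ?_
  simp [Conv.tmul_mul_tmul]

theorem j₂_lTensor_mul_flip (b : V) (u : V ⊗[K] V) :
    ρ.j₂ ((ρ.mul.flip b).lTensor V u) = ρ.j₂ u * Conv.tmul 1 (ρ.j b) := by
  revert u
  refine eq_of_tmul (by fun_prop) (by fun_prop) fun c d => ?_
  simp [Conv.tmul_mul_tmul]

theorem j₂_rTensor_mul_flip (b : V) (u : V ⊗[K] V) :
    ρ.j₂ ((ρ.mul.flip b).rTensor V u) = ρ.j₂ u * Conv.tmul (ρ.j b) 1 := by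
  revert u
  refine eq_of_tmul (by fun_prop) (by fun_prop) fun c d => ?_
  simp [Conv.tmul_mul_tmul]

end Realization

/-- A realization of `V` together with a coassociative comultiplication `T ↦ f ∘ T ∘ g` from
`Hom(C, R)` to `Hom(C ⊗ C, R ⊗ R)`, for which `Δ(a)(1 ⊗ b)` and its three companions lie in
`V ⊗ V` and define bijections of `V ⊗ V`. -/
structure HopfRealization (E : Entwining K C R) (V : Type*) [AddCommGroup V] [Module K V]
    extends Realization E V where
  comul : Hom E (E.tensor E)
  coassoc : ∀ f, (Hom.assoc E E E).map ((comul.tensor (Hom.id E)).map (comul.map f)) =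
    ((Hom.id E).tensor comul).map (comul.map f)
  surjective : Function.Surjective (TensorProduct.lift toRealization.mul)
  T₁ : V ⊗[K] V →ₗ[K] V ⊗[K] V
  T₂ : V ⊗[K] V →ₗ[K] V ⊗[K] V
  T₃ : V ⊗[K] V →ₗ[K] V ⊗[K] V
  T₄ : V ⊗[K] V →ₗ[K] V ⊗[K] V
  j₂_T₁ : ∀ a b, toRealization.j₂ (T₁ (a ⊗ₜ[K] b)) = comul.map (j a) * Conv.tmul 1 (j b)
  j₂_T₂ : ∀ a b, toRealization.j₂ (T₂ (a ⊗ₜ[K] b)) = Conv.tmul (j a) 1 * comul.map (j b)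
  j₂_T₃ : ∀ a b, toRealization.j₂ (T₃ (a ⊗ₜ[K] b)) = comul.map (j a) * Conv.tmul (j b) 1
  j₂_T₄ : ∀ a b, toRealization.j₂ (T₄ (a ⊗ₜ[K] b)) = Conv.tmul 1 (j a) * comul.map (j b)
  T₁_bijective : Function.Bijective T₁
  T₂_bijective : Function.Bijective T₂
  T₃_bijective : Function.Bijective T₃
  T₄_bijective : Function.Bijective T₄

namespace HopfRealization

variable (ρ : HopfRealization E V)

/-- `Δ(a)(V ⊗ V) ⊆ V ⊗ V`: since `V² = V`, it is enough to consider
`Δ(a)(c ⊗ d e) = (Δ(a)(1 ⊗ d))(c ⊗ e)`. -/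
theorem comul_mul_mem (a : V) (u : V ⊗[K] V) :
    ρ.comul.map (ρ.j a) * ρ.j₂ u ∈ LinearMap.range ρ.j₂ := by
  induction u with
  | zero => rw [map_zero, mul_zero]; exact Submodule.zero_mem _
  | add u w hu hw => rw [map_add, mul_add]; exact Submodule.add_mem _ hu hw
  | tmul c e =>
    obtain ⟨z, rfl⟩ := ρ.surjective e
    induction z with
    | zero => simp
    | add z w hz hw => rw [map_add, TensorProduct.tmul_add, map_add, mul_add]
                       exact Submodule.add_mem _ hz hw
    | tmul d e =>
      refine ⟨ρ.algebra.mulTensor (ρ.T₁ (a ⊗ₜ[K] d)) (c ⊗ₜ[K] e), ?_⟩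
      rw [ρ.j₂_mulTensor, ρ.j₂_T₁, mul_assoc, ρ.j₂_tmul, Conv.tmul_mul_tmul]
      simp

/-- `(V ⊗ V)Δ(a) ⊆ V ⊗ V`: since `V² = V`, it is enough to consider
`(c d ⊗ e)Δ(a) = (c ⊗ e)((d ⊗ 1)Δ(a))`. -/
theorem mul_comul_mem (a : V) (u : V ⊗[K] V) :
    ρ.j₂ u * ρ.comul.map (ρ.j a) ∈ LinearMap.range ρ.j₂ := by
  induction u with
  | zero => rw [map_zero, zero_mul]; exact Submodule.zero_mem _
  | add u w hu hw => rw [map_add, add_mul]; exact Submodule.add_mem _ hu hw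
  | tmul c e =>
    obtain ⟨z, rfl⟩ := ρ.surjective c
    induction z with
    | zero => simp
    | add z w hz hw => rw [map_add, TensorProduct.add_tmul, map_add, add_mul]
                       exact Submodule.add_mem _ hz hw
    | tmul c d =>
      refine ⟨ρ.algebra.mulTensor (c ⊗ₜ[K] e) (ρ.T₂ (d ⊗ₜ[K] a)), ?_⟩
      rw [ρ.j₂_mulTensor, ρ.j₂_T₂, ← mul_assoc, ρ.j₂_tmul, Conv.tmul_mul_tmul]
      simp

/-- `comulLeft a u = Δ(a) u`. -/
def comulLeft : V →ₗ[K] V ⊗[K] V →ₗ[K] V ⊗[K] V :=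
  liftRange₂ ρ.j₂ ρ.j₂_injective
    ((LinearMap.mul K (E.tensor E).Conv).compl₁₂ (ρ.comul.map.toLinearMap ∘ₗ ρ.j) ρ.j₂)
    ρ.comul_mul_mem

/-- `comulRight a u = u Δ(a)`. -/
def comulRight : V →ₗ[K] V ⊗[K] V →ₗ[K] V ⊗[K] V :=
  liftRange₂ ρ.j₂ ρ.j₂_injective
    ((LinearMap.mul K (E.tensor E).Conv).flip.compl₁₂ (ρ.comul.map.toLinearMap ∘ₗ ρ.j) ρ.j₂)
    ρ.mul_comul_mem

theorem j₂_comulLeft (a : V) (u : V ⊗[K] V) :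
    ρ.j₂ (ρ.comulLeft a u) = ρ.comul.map (ρ.j a) * ρ.j₂ u :=
  apply_liftRange₂ ..

theorem j₂_comulRight (a : V) (u : V ⊗[K] V) :
    ρ.j₂ (ρ.comulRight a u) = ρ.j₂ u * ρ.comul.map (ρ.j a) :=
  apply_liftRange₂ ..

/-- `V ⊗ (V ⊗ V)` as a space of functions. -/
def j₃ : V ⊗[K] (V ⊗[K] V) →ₗ[K] (E.tensor (E.tensor E)).Conv := Conv.mapTensor ρ.j ρ.j₂

/-- `(T₂ ⊗ ι)(a ⊗ z)` as a function is `(a ⊗ 1 ⊗ 1)(Δ ⊗ ι)(z)`. -/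
theorem j₃_assoc_rTensor (a : V) (z : V ⊗[K] V) :
    ρ.j₃ (TensorProduct.assoc K V V V ((ρ.T₂ ∘ₗ TensorProduct.mk K V V a).rTensor V z)) =
      Conv.tmul (ρ.j a) 1 * (Hom.assoc E E E).map ((ρ.comul.tensor (Hom.id E)).map (ρ.j₂ z)) := by
  revert z
  refine eq_of_tmul (by fun_prop) (by fun_prop) fun c d => ?_
  have h : ∀ w : V ⊗[K] V, ρ.j₃ (TensorProduct.assoc K V V V (w ⊗ₜ[K] d)) =
      (Hom.assoc E E E).map (Conv.tmul (ρ.j₂ w) (ρ.j d)) := by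
    refine eq_of_tmul (by fun_prop) (by fun_prop) fun p q => ?_
    simp [j₃, Hom.assoc_map_tmul]
  have h₁ : Conv.tmul (ρ.j a) (1 : (E.tensor E).Conv) =
      (Hom.assoc E E E).map (Conv.tmul (Conv.tmul (ρ.j a) 1) 1) := by
    rw [Hom.assoc_map_tmul, Conv.tmul_one_one]
  simp only [LinearMap.rTensor_tmul, LinearMap.comp_apply, TensorProduct.mk_apply, h, ρ.j₂_T₂,
    ρ.j₂_tmul, Hom.tensor_map_tmul, Hom.id_map, h₁, ← map_mul, Conv.tmul_mul_tmul, one_mul]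

/-- `(ι ⊗ T₁)(z ⊗ c)` as a function is `(ι ⊗ Δ)(z)(1 ⊗ 1 ⊗ c)`. -/
theorem j₃_lTensor (c : V) (z : V ⊗[K] V) :
    ρ.j₃ ((ρ.T₁ ∘ₗ (TensorProduct.mk K V V).flip c).lTensor V z) =
      ((Hom.id E).tensor ρ.comul).map (ρ.j₂ z) * Conv.tmul 1 (Conv.tmul 1 (ρ.j c)) := by
  revert z
  refine eq_of_tmul (by fun_prop) (by fun_prop) fun p q => ?_
  simp only [LinearMap.lTensor_tmul, LinearMap.comp_apply, TensorProduct.mk_apply, ρ.j₂_T₁,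
    ρ.j₂_tmul, Hom.tensor_map_tmul, Hom.id_map, Conv.tmul_mul_tmul, mul_one, j₃,
    Conv.mapTensor_tmul, LinearMap.flip_apply]

/-- The regular multiplier Hopf algebra `V`. -/
def regularMultiplierHopfAlgebra : RegularMultiplierHopfAlgebra K V where
  toNondegenerateAlgebra := ρ.algebra
  comulLeft := ρ.comulLeft
  comulRight := ρ.comulRight
  comul_multiplier a u w := ρ.j₂_injective (by
    simp only [ρ.j₂_mulTensor, ρ.j₂_comulLeft, ρ.j₂_comulRight, mul_assoc])
  comulLeft_mul a b u := ρ.j₂_injective (by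
    simp only [ρ.j₂_comulLeft, Realization.algebra_mul, Realization.j_mul, map_mul, mul_assoc])
  comulRight_mul a b u := ρ.j₂_injective (by
    simp only [ρ.j₂_comulRight, Realization.algebra_mul, Realization.j_mul, map_mul, mul_assoc])
  T₁ := ρ.T₁
  T₂ := ρ.T₂
  T₃ := ρ.T₃
  T₄ := ρ.T₄
  T₁_spec a b u := ρ.j₂_injective (by
    simp only [ρ.j₂_mulTensor, ρ.j₂_T₁, ρ.j₂_comulLeft, Realization.algebra_mul, ρ.j₂_lTensor_mul,
      mul_assoc])
  T₂_spec a b u := ρ.j₂_injective (by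
    simp only [ρ.j₂_mulTensor, ρ.j₂_T₂, ρ.j₂_comulRight, Realization.algebra_mul,
      ρ.j₂_rTensor_mul_flip, mul_assoc])
  T₃_spec a b u := ρ.j₂_injective (by
    simp only [ρ.j₂_mulTensor, ρ.j₂_T₃, ρ.j₂_comulLeft, Realization.algebra_mul, ρ.j₂_rTensor_mul,
      mul_assoc])
  T₄_spec a b u := ρ.j₂_injective (by
    simp only [ρ.j₂_mulTensor, ρ.j₂_T₄, ρ.j₂_comulRight, Realization.algebra_mul,
      ρ.j₂_lTensor_mul_flip, mul_assoc])
  coassoc a b c := by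
    refine Conv.mapTensor_injective ρ.injective ρ.j₂_injective ?_
    change ρ.j₃ _ = ρ.j₃ _
    have h : (Hom.assoc E E E).map (Conv.tmul 1 (ρ.j c)) = Conv.tmul 1 (Conv.tmul 1 (ρ.j c)) := by
      rw [← Conv.tmul_one_one, Hom.assoc_map_tmul]
    rw [j₃_assoc_rTensor, j₃_lTensor, ρ.j₂_T₁, ρ.j₂_T₂]
    simp only [map_mul, Hom.tensor_map_tmul, Hom.id_map, map_one, ρ.coassoc, h,
      mul_assoc]
  T₁_bijective := ρ.T₁_bijective
  T₂_bijective := ρ.T₂_bijective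
  T₃_bijective := ρ.T₃_bijective
  T₄_bijective := ρ.T₄_bijective

end HopfRealization

end Entwining
end Builder

/-! ### Galois maps and their transposes -/

section Galois

variable {K B M : Type*} [Field K] [Ring B] [HopfAlgebra K B] [AddCommGroup M] [Module K M]

local notation "Δ" => Coalgebra.comul (R := K)
local notation "ε" => Coalgebra.counit (R := K)

/-- The trivial entwining of `K` with a coalgebra; its algebra `Hom(C, K)` is the dual algebra of
`C`. -/
def Entwining.trivial (K C : Type*) [Field K] [AddCommGroup C] [Module K C] [Coalgebra K C] :
    Entwining K C K where
  ψ := TensorProduct.mk K K C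
  mul' r r' c := by simp (disch := fun_prop) only [TensorProduct.mk_apply, tensorSum_tmul]
  one' c := rfl
  counit' r c := by simp (disch := fun_prop) only [TensorProduct.mk_apply, tensorSum_tmul]
  comul' r c := by
    simp (disch := fun_prop) only [TensorProduct.mk_apply, tensorSum_tmul]
    rw [← const_tmul_tensorSum, tensorSum_tmul_self]

theorem Entwining.trivial_ψ (C : Type*) [AddCommGroup C] [Module K C] [Coalgebra K C] (r : K)
    (c : C) : (Entwining.trivial K C).ψ r c = r ⊗ₜ[K] c := rfl

variable {φ : Module.Dual K B}

@[simp]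
theorem evalAA_tmul (a b : DualAlg φ) (x y : B) :
    evalAA φ (a ⊗ₜ[K] b) (x ⊗ₜ[K] y) = a x * b y := rfl

/-- `A ⊗ A` as a space of functions on `B ⊗ B`, with values in `K ⊗ K`. -/
theorem mapTensor_pairing_apply (z : DualAlg φ ⊗[K] DualAlg φ) (w : B ⊗[K] B) :
    Entwining.Conv.mapTensor
      ((Entwining.Conv.of (Entwining.trivial K B)).toLinearMap ∘ₗ pairing φ)
      ((Entwining.Conv.of (Entwining.trivial K B)).toLinearMap ∘ₗ pairing φ) z w =
      evalAA φ z w • 1 := by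
  revert z
  refine eq_of_tmul (by fun_prop) (by fun_prop) fun a b => ?_
  revert w
  refine eq_of_tmul (by fun_prop) (by fun_prop) fun x y => ?_
  simp [Algebra.TensorProduct.one_def, TensorProduct.smul_tmul']
  rw [← mul_one (b y), ← smul_eq_mul (b y), TensorProduct.tmul_smul, TensorProduct.smul_tmul']
  simp [mul_comm]

theorem evalAA_injective (φ : Module.Dual K B) : Function.Injective (evalAA φ) := by
  refine (injective_iff_map_eq_zero _).2 fun z hz => ?_
  refine Entwining.Conv.mapTensor_injective (pairing_injective φ) (pairing_injective φ)
    (E := Entwining.trivial K B) (E' := Entwining.trivial K B) ?_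
  rw [map_zero]
  ext w
  refine (mapTensor_pairing_apply z w).trans ?_
  rw [hz]
  simp

/-- The transpose of a linear map `G` of `B ⊗ B` that preserves `A ⊗ A`. -/
def transposeAA (G : B ⊗[K] B →ₗ[K] B ⊗[K] B)
    (hG : ∀ a b : DualAlg φ, ∃ z, ∀ x y,
      evalAA φ z (x ⊗ₜ[K] y) = evalAA φ (a ⊗ₜ[K] b) (G (x ⊗ₜ[K] y))) :
    DualAlg φ ⊗[K] DualAlg φ →ₗ[K] DualAlg φ ⊗[K] DualAlg φ :=
  liftRange (evalAA φ) (evalAA_injective φ) (G.dualMap ∘ₗ evalAA φ) fun z => by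
    induction z with
    | zero => rw [map_zero]; exact Submodule.zero_mem _
    | add z w hz hw => rw [map_add]; exact Submodule.add_mem _ hz hw
    | tmul a b =>
      obtain ⟨z, hz⟩ := hG a b
      exact ⟨z, TensorProduct.ext' hz⟩

theorem evalAA_transposeAA (G : B ⊗[K] B →ₗ[K] B ⊗[K] B)
    (hG : ∀ a b : DualAlg φ, ∃ z, ∀ x y,
      evalAA φ z (x ⊗ₜ[K] y) = evalAA φ (a ⊗ₜ[K] b) (G (x ⊗ₜ[K] y)))
    (z : DualAlg φ ⊗[K] DualAlg φ) (w : B ⊗[K] B) :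
    evalAA φ (transposeAA G hG z) w = evalAA φ z (G w) := by
  simp [transposeAA]

theorem transposeAA_bijective (G G' : B ⊗[K] B →ₗ[K] B ⊗[K] B)
    (hG : ∀ a b : DualAlg φ, ∃ z, ∀ x y,
      evalAA φ z (x ⊗ₜ[K] y) = evalAA φ (a ⊗ₜ[K] b) (G (x ⊗ₜ[K] y)))
    (hG' : ∀ a b : DualAlg φ, ∃ z, ∀ x y,
      evalAA φ z (x ⊗ₜ[K] y) = evalAA φ (a ⊗ₜ[K] b) (G' (x ⊗ₜ[K] y)))
    (h : ∀ x y, G (G' (x ⊗ₜ[K] y)) = x ⊗ₜ[K] y) (h' : ∀ x y, G' (G (x ⊗ₜ[K] y)) = x ⊗ₜ[K] y) :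
    Function.Bijective (transposeAA G hG) := by
  have e : ∀ w, G (G' w) = w := eq_of_tmul (K := K) (by fun_prop) (by fun_prop) h
  have e' : ∀ w, G' (G w) = w := eq_of_tmul (K := K) (by fun_prop) (by fun_prop) h'
  refine Function.bijective_iff_has_inverse.2 ⟨transposeAA G' hG', fun z => ?_, fun z => ?_⟩ <;>
  · apply evalAA_injective φ
    ext w
    simp [evalAA_transposeAA, e, e']

variable (S : B ≃ₗ[K] B)

/-- `x ⊗ y ↦ x y₍₁₎ ⊗ y₍₂₎` -/
def galois₁ (K B : Type*) [Field K] [Ring B] [HopfAlgebra K B] : B ⊗[K] B →ₗ[K] B ⊗[K] B :=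
  TensorProduct.lift (bilin (fun x y => tensorSum (fun y₁ y₂ => (x * y₁) ⊗ₜ[K] y₂)
    (Coalgebra.comul (R := K) y)) (by fun_prop) (by fun_prop))

/-- `x ⊗ y ↦ x S(y₍₁₎) ⊗ y₍₂₎` -/
def galoisInv₁ : B ⊗[K] B →ₗ[K] B ⊗[K] B :=
  TensorProduct.lift (bilin (fun x y => tensorSum (fun y₁ y₂ => (x * S y₁) ⊗ₜ[K] y₂)
    (Δ y)) (by fun_prop) (by fun_prop))

/-- `x ⊗ y ↦ x₍₁₎ ⊗ x₍₂₎ y` -/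
def galois₂ (K B : Type*) [Field K] [Ring B] [HopfAlgebra K B] : B ⊗[K] B →ₗ[K] B ⊗[K] B :=
  TensorProduct.lift (bilin (fun x y => tensorSum (fun x₁ x₂ => x₁ ⊗ₜ[K] (x₂ * y))
    (Coalgebra.comul (R := K) x)) (by fun_prop) (by fun_prop))

/-- `x ⊗ y ↦ x₍₁₎ ⊗ S(x₍₂₎) y` -/
def galoisInv₂ : B ⊗[K] B →ₗ[K] B ⊗[K] B :=
  TensorProduct.lift (bilin (fun x y => tensorSum (fun x₁ x₂ => x₁ ⊗ₜ[K] (S x₂ * y))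
    (Δ x)) (by fun_prop) (by fun_prop))

/-- `x ⊗ y ↦ x₍₁₎ y ⊗ x₍₂₎` -/
def galois₃ (K B : Type*) [Field K] [Ring B] [HopfAlgebra K B] : B ⊗[K] B →ₗ[K] B ⊗[K] B :=
  TensorProduct.lift (bilin (fun x y => tensorSum (fun x₁ x₂ => (x₁ * y) ⊗ₜ[K] x₂)
    (Coalgebra.comul (R := K) x)) (by fun_prop) (by fun_prop))

/-- `x ⊗ y ↦ y₍₂₎ ⊗ S⁻¹(y₍₁₎) x` -/
def galoisInv₃ : B ⊗[K] B →ₗ[K] B ⊗[K] B :=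
  TensorProduct.lift (bilin (fun x y => tensorSum (fun y₁ y₂ => y₂ ⊗ₜ[K] (S.symm y₁ * x))
    (Δ y)) (by fun_prop) (by fun_prop))

/-- `x ⊗ y ↦ y₍₁₎ ⊗ x y₍₂₎` -/
def galois₄ (K B : Type*) [Field K] [Ring B] [HopfAlgebra K B] : B ⊗[K] B →ₗ[K] B ⊗[K] B :=
  TensorProduct.lift (bilin (fun x y => tensorSum (fun y₁ y₂ => y₁ ⊗ₜ[K] (x * y₂))
    (Coalgebra.comul (R := K) y)) (by fun_prop) (by fun_prop))

/-- `x ⊗ y ↦ y S⁻¹(x₍₂₎) ⊗ x₍₁₎` -/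
def galoisInv₄ : B ⊗[K] B →ₗ[K] B ⊗[K] B :=
  TensorProduct.lift (bilin (fun x y => tensorSum (fun x₁ x₂ => (y * S.symm x₂) ⊗ₜ[K] x₁)
    (Δ x)) (by fun_prop) (by fun_prop))

theorem galois₁_tmul (x y : B) : galois₁ K B (x ⊗ₜ[K] y) =
    tensorSum (fun y₁ y₂ => (x * y₁) ⊗ₜ[K] y₂) (Δ y) := by simp [galois₁]
theorem galois₂_tmul (x y : B) : galois₂ K B (x ⊗ₜ[K] y) =
    tensorSum (fun x₁ x₂ => x₁ ⊗ₜ[K] (x₂ * y)) (Δ x) := by simp [galois₂]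
theorem galois₃_tmul (x y : B) : galois₃ K B (x ⊗ₜ[K] y) =
    tensorSum (fun x₁ x₂ => (x₁ * y) ⊗ₜ[K] x₂) (Δ x) := by simp [galois₃]
theorem galois₄_tmul (x y : B) : galois₄ K B (x ⊗ₜ[K] y) =
    tensorSum (fun y₁ y₂ => y₁ ⊗ₜ[K] (x * y₂)) (Δ y) := by simp [galois₄]
theorem galoisInv₁_tmul (x y : B) : galoisInv₁ S (x ⊗ₜ[K] y) =
    tensorSum (fun y₁ y₂ => (x * S y₁) ⊗ₜ[K] y₂) (Δ y) := by simp [galoisInv₁]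
theorem galoisInv₂_tmul (x y : B) : galoisInv₂ S (x ⊗ₜ[K] y) =
    tensorSum (fun x₁ x₂ => x₁ ⊗ₜ[K] (S x₂ * y)) (Δ x) := by simp [galoisInv₂]
theorem galoisInv₃_tmul (x y : B) : galoisInv₃ S (x ⊗ₜ[K] y) =
    tensorSum (fun y₁ y₂ => y₂ ⊗ₜ[K] (S.symm y₁ * x)) (Δ y) := by simp [galoisInv₃]
theorem galoisInv₄_tmul (x y : B) : galoisInv₄ S (x ⊗ₜ[K] y) =
    tensorSum (fun x₁ x₂ => (y * S.symm x₂) ⊗ₜ[K] x₁) (Δ x) := by simp [galoisInv₄]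

variable {S} (hS : (S : B →ₗ[K] B) = HopfAlgebra.antipode K)
include hS

theorem galois₁_galoisInv₁ (x y : B) : galois₁ K B (galoisInv₁ S (x ⊗ₜ[K] y)) = x ⊗ₜ[K] y := by
  simp only [galois₁_tmul, galoisInv₁_tmul, LinearMap.map_tensorSum]
  exact ((isCounital_antipodeEquiv_mul hS).sum_left (fun u v => (x * u) ⊗ₜ[K] v) (by fun_prop)
    (by fun_prop) (fun u v w => by rw [mul_assoc]) y).trans (by rw [mul_one])

theorem galoisInv₁_galois₁ (x y : B) : galoisInv₁ S (galois₁ K B (x ⊗ₜ[K] y)) = x ⊗ₜ[K] y := by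
  simp only [galois₁_tmul, galoisInv₁_tmul, LinearMap.map_tensorSum]
  exact ((isCounital_mul_antipodeEquiv hS).sum_left (fun u v => (x * u) ⊗ₜ[K] v) (by fun_prop)
    (by fun_prop) (fun u v w => by rw [mul_assoc]) y).trans (by rw [mul_one])

theorem galois₂_galoisInv₂ (x y : B) : galois₂ K B (galoisInv₂ S (x ⊗ₜ[K] y)) = x ⊗ₜ[K] y := by
  simp (disch := fun_prop) only [galois₂_tmul, galoisInv₂_tmul, LinearMap.map_tensorSum,
    tensorSum_coassoc]
  exact ((isCounital_mul_antipodeEquiv hS).sum_right (fun u v => u ⊗ₜ[K] (v * y)) (by fun_prop)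
    (by fun_prop) (fun u v w => by rw [mul_assoc]) x).trans (by rw [one_mul])

theorem galoisInv₂_galois₂ (x y : B) : galoisInv₂ S (galois₂ K B (x ⊗ₜ[K] y)) = x ⊗ₜ[K] y := by
  simp (disch := fun_prop) only [galois₂_tmul, galoisInv₂_tmul, LinearMap.map_tensorSum,
    tensorSum_coassoc]
  exact ((isCounital_antipodeEquiv_mul hS).sum_right (fun u v => u ⊗ₜ[K] (v * y)) (by fun_prop)
    (by fun_prop) (fun u v w => by rw [mul_assoc]) x).trans (by rw [one_mul])

theorem galois₃_galoisInv₃ (x y : B) : galois₃ K B (galoisInv₃ S (x ⊗ₜ[K] y)) = x ⊗ₜ[K] y := by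
  simp (disch := fun_prop) only [galois₃_tmul, galoisInv₃_tmul, LinearMap.map_tensorSum]
  exact ((isCounital_mul_antipodeEquiv_symm hS).sum_left (fun u v => (u * x) ⊗ₜ[K] v) (by fun_prop)
    (by fun_prop) (fun u v w => by rw [mul_assoc]) y).trans (by rw [one_mul])

theorem galoisInv₃_galois₃ (x y : B) : galoisInv₃ S (galois₃ K B (x ⊗ₜ[K] y)) = x ⊗ₜ[K] y := by
  simp (disch := fun_prop) only [galois₃_tmul, galoisInv₃_tmul, LinearMap.map_tensorSum]
  exact ((isCounital_antipodeEquiv_symm_mul hS).sum_left (fun u v => v ⊗ₜ[K] (u * y))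
    (by fun_prop) (by fun_prop) (fun u v w => by rw [mul_assoc]) x).trans (by rw [one_mul])

theorem galois₄_galoisInv₄ (x y : B) : galois₄ K B (galoisInv₄ S (x ⊗ₜ[K] y)) = x ⊗ₜ[K] y := by
  simp (disch := fun_prop) only [galois₄_tmul, galoisInv₄_tmul, LinearMap.map_tensorSum,
    tensorSum_coassoc]
  exact ((isCounital_antipodeEquiv_symm_mul hS).sum_right (fun u v => u ⊗ₜ[K] (y * v)) (by fun_prop)
    (by fun_prop) (fun u v w => by rw [mul_assoc]) x).trans (by rw [mul_one])

theorem galoisInv₄_galois₄ (x y : B) : galoisInv₄ S (galois₄ K B (x ⊗ₜ[K] y)) = x ⊗ₜ[K] y := by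
  simp (disch := fun_prop) only [galois₄_tmul, galoisInv₄_tmul, LinearMap.map_tensorSum,
    tensorSum_coassoc]
  exact ((isCounital_mul_antipodeEquiv_symm hS).sum_right (fun u v => (x * v) ⊗ₜ[K] u) (by fun_prop)
    (by fun_prop) (fun u v w => by rw [mul_assoc]) y).trans (by rw [mul_one])

end Galois

/-! ### The dual multiplier Hopf algebra -/

section DualHopf

variable {K B M : Type*} [Field K] [Ring B] [HopfAlgebra K B] [AddCommGroup M] [Module K M]

local notation "Δ" => Coalgebra.comul (R := K)
local notation "ε" => Coalgebra.counit (R := K)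

theorem tmul_eq_smul_one (k l : K) : k ⊗ₜ[K] l = (k * l) • (1 : K ⊗[K] K) := by
  have : (k * l) • (1 : K ⊗[K] K) = (k • 1) ⊗ₜ[K] (l • 1) := by
    rw [TensorProduct.smul_tmul_smul, Algebra.TensorProduct.one_def]
  rw [this, smul_eq_mul, mul_one, smul_eq_mul, mul_one]

open Entwining in
/-- `Δ(a) = a ∘ μ` for `a ∈ B*` and the product `μ` of `B`. -/
def dualComul (K B : Type*) [Field K] [Ring B] [HopfAlgebra K B] :
    Hom (trivial K B) ((trivial K B).tensor (trivial K B)) where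
  f := Algebra.ofId K (K ⊗[K] K)
  g := LinearMap.mul' K B
  counit' c := by
    revert c
    refine eq_of_tmul (by fun_prop) (by fun_prop) fun c d => ?_
    simp [mul_comm]
  comul' c := by
    revert c
    refine eq_of_tmul (by fun_prop) (by fun_prop) fun c d => ?_
    simp (disch := fun_prop) only [comul_tmul_eq, tensorSum_tensorSum, tensorSum_tmul,
      LinearMap.mul'_apply, comul_mul_eq]
  compat r c := by
    revert c
    refine eq_of_tmul (by fun_prop) (by fun_prop) fun c d => ?_
    have h : Algebra.ofId K (K ⊗[K] K) r = r ⊗ₜ[K] 1 := rfl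
    simp (disch := fun_prop) only [h, trivial_ψ, tensorSum_tmul, sum_tensor, LinearMap.mul'_apply]

open Entwining in
theorem dualComul_map_apply (f : (trivial K B).Conv) (x y : B) :
    (dualComul K B).map f (x ⊗ₜ[K] y) = f (x * y) • (1 ⊗ₜ[K] 1) := by
  rw [Hom.map_apply]
  exact Algebra.algebraMap_eq_smul_one _

variable {φ : Module.Dual K B} {S : B ≃ₗ[K] B}

namespace IsRationalDual

variable (h : IsRationalDual φ)
include h

/-- `∑ ⟨a, x₍₂₎⟩ F(x₍₁₎)` as a value of an element of `A ⊗ B`. -/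
theorem exists_sum_right (a : DualAlg φ) : ∃ t : DualAlg φ ⊗[K] B, ∀ (x : B) (F : B →ₗ[K] K),
    tensorSum (fun x₁ x₂ => F x₁ * a x₂) (Δ x) =
      tensorSum (fun (b : DualAlg φ) c => F c * b x) t := by
  obtain ⟨t, ht⟩ := h.exists_right a
  refine ⟨t, fun x F => ?_⟩
  have := congr_arg F (ht x)
  simpa only [LinearMap.map_tensorSum, map_smul, smul_eq_mul, mul_comm (F _)] using this

/-- `∑ ⟨a, x₍₁₎⟩ F(x₍₂₎)` as a value of an element of `A ⊗ B`. -/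
theorem exists_sum_left (a : DualAlg φ) : ∃ t : DualAlg φ ⊗[K] B, ∀ (x : B) (F : B →ₗ[K] K),
    tensorSum (fun x₁ x₂ => a x₁ * F x₂) (Δ x) =
      tensorSum (fun (b : DualAlg φ) c => b x * F c) t := by
  obtain ⟨t, ht⟩ := h.exists_left a
  refine ⟨t, fun x F => ?_⟩
  have := congr_arg F (ht x)
  simpa only [LinearMap.map_tensorSum, map_smul, smul_eq_mul] using this

/-- The transpose of `galois₁` preserves `A ⊗ A`: rationality writes `∑ ⟨b, y₍₂₎⟩ y₍₁₎` as
`∑ ⟨b', y⟩ c` with fixed `b'` and `c`, and `A` is a bimodule. The same applies to the other Galois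
maps and to their inverses. -/
theorem exists_galois₁ (a b : DualAlg φ) : ∃ z, ∀ x y,
    evalAA φ z (x ⊗ₜ[K] y) = evalAA φ (a ⊗ₜ[K] b) (galois₁ K B (x ⊗ₜ[K] y)) := by
  obtain ⟨t, ht⟩ := h.exists_sum_right b
  refine ⟨tensorSum (fun b' c => h.bimodule 1 c a ⊗ₜ[K] b') t, fun x y => ?_⟩
  simp only [galois₁_tmul, LinearMap.map_tensorSum, tensorSum_apply, evalAA_tmul, bimodule_apply,
    one_mul]
  exact (ht y (pairing φ a ∘ₗ LinearMap.mulLeft K x)).symm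

theorem exists_galoisInv₁ (a b : DualAlg φ) : ∃ z, ∀ x y,
    evalAA φ z (x ⊗ₜ[K] y) = evalAA φ (a ⊗ₜ[K] b) (galoisInv₁ S (x ⊗ₜ[K] y)) := by
  obtain ⟨t, ht⟩ := h.exists_sum_right b
  refine ⟨tensorSum (fun b' c => h.bimodule 1 (S c) a ⊗ₜ[K] b') t, fun x y => ?_⟩
  simp only [galoisInv₁_tmul, LinearMap.map_tensorSum, tensorSum_apply, evalAA_tmul, bimodule_apply,
    one_mul]
  exact (ht y (pairing φ a ∘ₗ LinearMap.mulLeft K x ∘ₗ S)).symm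

theorem exists_galois₂ (a b : DualAlg φ) : ∃ z, ∀ x y,
    evalAA φ z (x ⊗ₜ[K] y) = evalAA φ (a ⊗ₜ[K] b) (galois₂ K B (x ⊗ₜ[K] y)) := by
  obtain ⟨t, ht⟩ := h.exists_sum_left a
  refine ⟨tensorSum (fun a' c => a' ⊗ₜ[K] h.bimodule c 1 b) t, fun x y => ?_⟩
  simp only [galois₂_tmul, LinearMap.map_tensorSum, tensorSum_apply, evalAA_tmul, bimodule_apply,
    mul_one]
  exact (ht x (pairing φ b ∘ₗ LinearMap.mulRight K y)).symm

theorem exists_galoisInv₂ (a b : DualAlg φ) : ∃ z, ∀ x y,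
    evalAA φ z (x ⊗ₜ[K] y) = evalAA φ (a ⊗ₜ[K] b) (galoisInv₂ S (x ⊗ₜ[K] y)) := by
  obtain ⟨t, ht⟩ := h.exists_sum_left a
  refine ⟨tensorSum (fun a' c => a' ⊗ₜ[K] h.bimodule (S c) 1 b) t, fun x y => ?_⟩
  simp only [galoisInv₂_tmul, LinearMap.map_tensorSum, tensorSum_apply, evalAA_tmul, bimodule_apply,
    mul_one]
  exact (ht x (pairing φ b ∘ₗ LinearMap.mulRight K y ∘ₗ S)).symm

theorem exists_galois₃ (a b : DualAlg φ) : ∃ z, ∀ x y,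
    evalAA φ z (x ⊗ₜ[K] y) = evalAA φ (a ⊗ₜ[K] b) (galois₃ K B (x ⊗ₜ[K] y)) := by
  obtain ⟨t, ht⟩ := h.exists_sum_right b
  refine ⟨tensorSum (fun b' c => b' ⊗ₜ[K] h.bimodule c 1 a) t, fun x y => ?_⟩
  simp only [galois₃_tmul, LinearMap.map_tensorSum, tensorSum_apply, evalAA_tmul, bimodule_apply,
    mul_one, mul_comm (pairing φ _ x)]
  exact (ht x (pairing φ a ∘ₗ LinearMap.mulRight K y)).symm

theorem exists_galoisInv₃ (a b : DualAlg φ) : ∃ z, ∀ x y,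
    evalAA φ z (x ⊗ₜ[K] y) = evalAA φ (a ⊗ₜ[K] b) (galoisInv₃ S (x ⊗ₜ[K] y)) := by
  obtain ⟨t, ht⟩ := h.exists_sum_right a
  refine ⟨tensorSum (fun a' c => h.bimodule (S.symm c) 1 b ⊗ₜ[K] a') t, fun x y => ?_⟩
  simp only [galoisInv₃_tmul, LinearMap.map_tensorSum, tensorSum_apply, evalAA_tmul, bimodule_apply,
    mul_one, mul_comm (pairing φ a _)]
  exact (ht y (pairing φ b ∘ₗ LinearMap.mulRight K x ∘ₗ S.symm)).symm

theorem exists_galois₄ (a b : DualAlg φ) : ∃ z, ∀ x y,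
    evalAA φ z (x ⊗ₜ[K] y) = evalAA φ (a ⊗ₜ[K] b) (galois₄ K B (x ⊗ₜ[K] y)) := by
  obtain ⟨t, ht⟩ := h.exists_sum_left a
  refine ⟨tensorSum (fun a' c => h.bimodule 1 c b ⊗ₜ[K] a') t, fun x y => ?_⟩
  simp only [galois₄_tmul, LinearMap.map_tensorSum, tensorSum_apply, evalAA_tmul, bimodule_apply,
    one_mul, mul_comm _ (pairing φ _ y)]
  exact (ht y (pairing φ b ∘ₗ LinearMap.mulLeft K x)).symm

theorem exists_galoisInv₄ (a b : DualAlg φ) : ∃ z, ∀ x y,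
    evalAA φ z (x ⊗ₜ[K] y) = evalAA φ (a ⊗ₜ[K] b) (galoisInv₄ S (x ⊗ₜ[K] y)) := by
  obtain ⟨t, ht⟩ := h.exists_sum_left b
  refine ⟨tensorSum (fun b' c => b' ⊗ₜ[K] h.bimodule 1 (S.symm c) a) t, fun x y => ?_⟩
  simp only [galoisInv₄_tmul, LinearMap.map_tensorSum, tensorSum_apply, evalAA_tmul, bimodule_apply,
    one_mul, mul_comm (pairing φ a _)]
  exact (ht x (pairing φ a ∘ₗ LinearMap.mulLeft K y ∘ₗ S.symm)).symm

open Entwining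

/-- `A` as a subalgebra of the dual algebra of `B`. -/
def realization : Realization (trivial K B) (DualAlg φ) where
  j := (Conv.of (trivial K B)).toLinearMap ∘ₗ pairing φ
  injective := pairing_injective φ
  mul_mem a b := by
    obtain ⟨t, ht⟩ := h.exists_sum_right b
    refine ⟨tensorSum (fun b' c => a c • b') t, ?_⟩
    ext x
    simp (disch := fun_prop) only [LinearMap.map_tensorSum, Conv.tensorSum_apply, Conv.mul_apply,
      trivial_ψ, tensorSum_tmul, LinearMap.comp_apply, LinearEquiv.coe_coe, Conv.of_apply, map_smul,
      Conv.smul_apply]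
    exact (ht x (pairing φ a)).symm
  eq_zero c hc := h.eq_zero c fun a => hc a (pairing φ a) fun x => by simp

theorem realization_j_apply (a : DualAlg φ) (x : B) : h.realization.j a x = a x := rfl

theorem realization_mul_apply (a b : DualAlg φ) (x : B) :
    (h.realization.mul a b) x = tensorSum (fun x₁ x₂ => a x₁ * b x₂) (Δ x) := by
  have := DFunLike.congr_fun (h.realization.j_mul a b) x
  rw [Conv.mul_apply] at this
  refine this.trans (tensorSum_congr fun x₁ x₂ => ?_)
  simp (disch := fun_prop) only [trivial_ψ, tensorSum_tmul]
  rfl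

theorem realization_j₂_apply (z : DualAlg φ ⊗[K] DualAlg φ) (w : B ⊗[K] B) :
    h.realization.j₂ z w = evalAA φ z w • 1 :=
  mapTensor_pairing_apply z w

/-- `A A = A`: as `T₁` is surjective, `a ⊗ b = ∑ a'₍₁₎ ⊗ a'₍₂₎ b'` for some `∑ a' ⊗ b'`, and
evaluating the first factor at `1` gives `⟨a, 1⟩ b = ∑ a' b'`. -/
theorem realization_mul_surjective (hS : (S : B →ₗ[K] B) = HopfAlgebra.antipode K) :
    Function.Surjective (TensorProduct.lift h.realization.mul) := by
  intro b
  by_cases h₁ : ∃ a : DualAlg φ, a 1 ≠ 0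
  · obtain ⟨a, ha⟩ := h₁
    obtain ⟨z, hz⟩ := (transposeAA_bijective _ (galoisInv₁ S) h.exists_galois₁
      h.exists_galoisInv₁ (galois₁_galoisInv₁ hS) (galoisInv₁_galois₁ hS)).2 (a ⊗ₜ[K] b)
    refine ⟨(a 1)⁻¹ • z, DualAlg.ext fun x => ?_⟩
    -- `x ↦ T₁(z)(1 ⊗ x)` is the product of the factors of `z`
    have h₂ : ∀ z, pairing φ (TensorProduct.lift h.realization.mul z) x =
        evalAA φ (transposeAA (galois₁ K B) h.exists_galois₁ z) (1 ⊗ₜ[K] x) := by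
      refine eq_of_tmul (by fun_prop) (by fun_prop) fun a b => ?_
      simp only [TensorProduct.lift.tmul, realization_mul_apply, evalAA_transposeAA, galois₁_tmul,
        LinearMap.map_tensorSum, evalAA_tmul, one_mul]
    rw [h₂, map_smul, map_smul, hz, LinearMap.smul_apply, evalAA_tmul, smul_eq_mul,
      inv_mul_cancel_left₀ ha]
  · push Not at h₁
    -- `A` separates points, so `1 = 0` in `B`
    have h₀ := h.eq_zero 1 h₁
    refine ⟨0, DualAlg.ext fun x => ?_⟩
    rw [← mul_one x, h₀, mul_zero, map_zero, map_zero]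

/-- The dual multiplier Hopf algebra of `B`, as functions on `B`. -/
def hopfRealization (hS : (S : B →ₗ[K] B) = HopfAlgebra.antipode K) :
    HopfRealization (trivial K B) (DualAlg φ) where
  toRealization := h.realization
  comul := dualComul K B
  coassoc f := by
    apply Conv.ext_tmul; intro x w
    revert w
    refine eq_of_tmul (by fun_prop) (by fun_prop) fun y z => ?_
    simp only [Hom.map_apply, Hom.assoc, Hom.tensor, Hom.id, dualComul, TensorProduct.map_tmul,
      LinearEquiv.coe_coe, TensorProduct.assoc_symm_tmul, LinearMap.mul'_apply, LinearMap.id_apply,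
      Algebra.ofId_apply, AlgHom.commutes, mul_assoc]
  surjective := h.realization_mul_surjective hS
  T₁ := transposeAA (galois₁ K B) h.exists_galois₁
  T₂ := transposeAA (galois₂ K B) h.exists_galois₂
  T₃ := transposeAA (galois₃ K B) h.exists_galois₃
  T₄ := transposeAA (galois₄ K B) h.exists_galois₄
  j₂_T₁ a b := by
    apply Conv.ext_tmul; intro x y
    rw [realization_j₂_apply, evalAA_transposeAA, Conv.mul_one_tmul_apply]
    simp (disch := fun_prop) only [galois₁_tmul, dualComul_map_apply, tensorSum_tmul,
      tensorSum_smul_arg, trivial_ψ, realization_j_apply, LinearMap.map_tensorSum, evalAA_tmul,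
      tensorSum_smul]
    refine tensorSum_congr fun u v => ?_
    simp [tmul_eq_smul_one, smul_smul]
  j₂_T₂ a b := by
    apply Conv.ext_tmul; intro x y
    rw [realization_j₂_apply, evalAA_transposeAA, Conv.tmul_one_mul_apply]
    simp (disch := fun_prop) only [galois₂_tmul, dualComul_map_apply, tensorSum_tmul,
      trivial_ψ, realization_j_apply, LinearMap.map_tensorSum, evalAA_tmul,
      tensorSum_smul]
    refine tensorSum_congr fun u v => ?_
    simp [tmul_eq_smul_one, smul_smul, mul_comm]
  j₂_T₃ a b := by
    apply Conv.ext_tmul; intro x y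
    rw [realization_j₂_apply, evalAA_transposeAA, Conv.mul_tmul_one_apply]
    simp (disch := fun_prop) only [galois₃_tmul, dualComul_map_apply, tensorSum_tmul,
      tensorSum_smul_arg, trivial_ψ, realization_j_apply, LinearMap.map_tensorSum, evalAA_tmul,
      tensorSum_smul]
    refine tensorSum_congr fun u v => ?_
    simp [tmul_eq_smul_one, smul_smul, mul_comm]
  j₂_T₄ a b := by
    apply Conv.ext_tmul; intro x y
    rw [realization_j₂_apply, evalAA_transposeAA, Conv.one_tmul_mul_apply]
    simp (disch := fun_prop) only [galois₄_tmul, dualComul_map_apply, tensorSum_tmul,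
      trivial_ψ, realization_j_apply, LinearMap.map_tensorSum, evalAA_tmul,
      tensorSum_smul]
    refine tensorSum_congr fun u v => ?_
    simp [tmul_eq_smul_one, smul_smul, mul_comm]
  T₁_bijective := transposeAA_bijective _ (galoisInv₁ S) _ h.exists_galoisInv₁
    (galois₁_galoisInv₁ hS) (galoisInv₁_galois₁ hS)
  T₂_bijective := transposeAA_bijective _ (galoisInv₂ S) _ h.exists_galoisInv₂
    (galois₂_galoisInv₂ hS) (galoisInv₂_galois₂ hS)
  T₃_bijective := transposeAA_bijective _ (galoisInv₃ S) _ h.exists_galoisInv₃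
    (galois₃_galoisInv₃ hS) (galoisInv₃_galois₃ hS)
  T₄_bijective := transposeAA_bijective _ (galoisInv₄ S) _ h.exists_galoisInv₄
    (galois₄_galoisInv₄ hS) (galoisInv₄_galois₄ hS)

theorem isDualOf (hS : (S : B →ₗ[K] B) = HopfAlgebra.antipode K) :
    IsDualOf φ (h.hopfRealization hS).regularMultiplierHopfAlgebra := by
  refine ⟨fun a a' x => ?_, fun a a' x y => ?_⟩
  · rw [sweedler₂_eq_tensorSum (by fun_prop) (by fun_prop)]
    exact h.realization_mul_apply a a' x
  · rw [sweedler₂_eq_tensorSum (by fun_prop) (by fun_prop)]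
    refine (evalAA_transposeAA _ h.exists_galois₁ _ _).trans ?_
    simp only [galois₁_tmul, LinearMap.map_tensorSum, evalAA_tmul]

end IsRationalDual

end DualHopf

/-! ### The entwinings of the Drinfel'd and Heisenberg doubles -/

section DoubleEntwinings

variable {K B M : Type*} [Field K] [Ring B] [HopfAlgebra K B] [AddCommGroup M] [Module K M]

local notation "Δ" => Coalgebra.comul (R := K)
local notation "ε" => Coalgebra.counit (R := K)

theorem comul_one_eq : Δ (1 : B) = 1 ⊗ₜ[K] 1 := Bialgebra.comul_one

theorem comul_tmul {C N : Type*} [AddCommGroup C] [Module K C] [Coalgebra K C] [AddCommGroup N]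
    [Module K N] (x : C) (n : N) :
    Δ x ⊗ₜ[K] n = tensorSum (fun u v => (u ⊗ₜ[K] v) ⊗ₜ[K] n) (Δ x) := by
  rw [← tensorSum_tmul_const, tensorSum_tmul_self]

theorem Entwining.sum_tensor_tmul {C R C' R' : Type*} [AddCommGroup C] [Module K C] [Coalgebra K C]
    [Ring R] [Algebra K R] [AddCommGroup C'] [Module K C'] [Coalgebra K C']
    [Ring R'] [Algebra K R'] (E : Entwining K C R) (E' : Entwining K C' R')
    {g : R ⊗[K] R' → C ⊗[K] C' → M}
    (h₁ : ∀ y, IsLinearMap K fun x => g x y) (h₂ : ∀ x, IsLinearMap K fun y => g x y)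
    (z : R ⊗[K] R') (c : C) (c' : C') :
    tensorSum g ((E.tensor E').ψ z (c ⊗ₜ[K] c')) =
      tensorSum (fun r r' => tensorSum (fun s d => tensorSum (fun s' d' =>
        g (s ⊗ₜ[K] s') (d ⊗ₜ[K] d')) (E'.ψ r' c')) (E.ψ r c)) z := by
  revert z
  refine eq_of_tmul (by fun_prop) (by fun_prop) fun r r' => ?_
  simp (disch := fun_prop) only [sum_tensor, tensorSum_tmul]

open Entwining

variable (K B) in
/-- The entwining `ψ(r ⊗ c) = r₍₂₎ ⊗ c r₍₁₎` of the Heisenberg double. -/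
def heisenbergEntwining : Entwining K B B where
  ψ := bilin (fun r c => tensorSum (fun r₁ r₂ => r₂ ⊗ₜ[K] (c * r₁)) (Δ r))
    (by fun_prop) (by fun_prop)
  mul' r r' c := by
    simp (disch := fun_prop) only [bilin_apply, comul_mul_eq, tensorSum_tensorSum, tensorSum_tmul,
      mul_assoc]
  one' c := by
    simp (disch := fun_prop) only [bilin_apply, comul_one_eq, tensorSum_tmul, mul_one]
  counit' r c := by
    simp (disch := fun_prop) only [bilin_apply, tensorSum_tensorSum, tensorSum_tmul,
      Bialgebra.counit_mul, mul_smul, ← smul_tensorSum]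
    rw [tensorSum_counit_left (K := K) (f := fun x => x) (by fun_prop)]
  comul' r c := by
    simp (disch := fun_prop) only [bilin_apply, comul_mul_eq, tensorSum_tensorSum, tensorSum_tmul,
      const_tmul_tensorSum]
    rw [tensorSum_comm]
    refine tensorSum_congr fun c₁ c₂ => ?_
    rw [tensorSum_coassoc (by fun_prop) (by fun_prop) (by fun_prop)]

theorem sum_heisenbergEntwining {g : B → B → M} (h₁ : ∀ y, IsLinearMap K fun x => g x y)
    (h₂ : ∀ x, IsLinearMap K fun y => g x y) (r c : B) :
    tensorSum g ((heisenbergEntwining K B).ψ r c) =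
      tensorSum (fun r₁ r₂ => g r₂ (c * r₁)) (Δ r) := by
  simp (disch := fun_prop) only [heisenbergEntwining, bilin_apply, tensorSum_tensorSum,
    tensorSum_tmul]

variable {S : B ≃ₗ[K] B} (hS : (S : B →ₗ[K] B) = HopfAlgebra.antipode K)

/-- The entwining `ψ(r ⊗ c) = r₍₂₎ ⊗ S⁻¹(r₍₃₎) c r₍₁₎` of the Drinfel'd double. -/
def drinfeldEntwining (hS : (S : B →ₗ[K] B) = HopfAlgebra.antipode K) :
    Entwining K B B where
  ψ := bilin (fun r c => tensorSum (fun r₁ s => tensorSum (fun r₂ r₃ =>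
      r₂ ⊗ₜ[K] (S.symm r₃ * c * r₁)) (Δ s)) (Δ r)) (by fun_prop) (by fun_prop)
  mul' r r' c := by
    simp (disch := fun_prop) only [bilin_apply, comul_mul_eq, tensorSum_tensorSum, tensorSum_tmul,
      antipodeEquiv_symm_mul hS]
    refine tensorSum_congr fun r₁ s => ?_
    rw [tensorSum_comm]
    simp only [mul_assoc]
  one' c := by
    simp (disch := fun_prop) only [bilin_apply, comul_one_eq, tensorSum_tmul, mul_one,
      antipodeEquiv_symm_one hS, one_mul]
  counit' r c := by
    simp (disch := fun_prop) only [bilin_apply, tensorSum_tensorSum, tensorSum_tmul,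
      Bialgebra.counit_mul, counit_antipodeEquiv_symm hS]
    rw [← tensorSum_counit_left (K := K) (f := fun r => ε c • r) (by fun_prop) r]
    refine tensorSum_congr fun r₁ s => ?_
    rw [← tensorSum_counit_right (K := K) (f := fun s => ε r₁ • ε c • s) (by fun_prop) s]
    refine tensorSum_congr fun r₂ r₃ => ?_
    simp only [smul_smul]
    congr 1
    ring
  comul' r c := by
    simp (disch := fun_prop) only [bilin_apply, comul_mul_eq, comul_antipodeEquiv_symm hS,
      tensorSum_tensorSum, tensorSum_tmul, const_tmul_tensorSum]
    simp (disch := fun_prop) only [tensorSum_coassoc]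
    simp only [tensorSum_comm (w := Δ c)]
    refine tensorSum_congr fun c₁ c₂ => ?_
    simp (disch := fun_prop) only [tensorSum_coassoc_two]

theorem sum_drinfeldEntwining {g : B → B → M} (h₁ : ∀ y, IsLinearMap K fun x => g x y)
    (h₂ : ∀ x, IsLinearMap K fun y => g x y) (r c : B) :
    tensorSum g ((drinfeldEntwining hS).ψ r c) =
      tensorSum (fun r₁ s => tensorSum (fun r₂ r₃ => g r₂ (S.symm r₃ * c * r₁)) (Δ s)) (Δ r) := by
  simp (disch := fun_prop) only [drinfeldEntwining, bilin_apply, tensorSum_tensorSum,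
    tensorSum_tmul]

/-- The product of the opposite algebra. -/
def mulOp (K B : Type*) [Field K] [Ring B] [Algebra K B] : B ⊗[K] B →ₗ[K] B :=
  TensorProduct.lift (LinearMap.mul K B).flip

@[simp]
theorem mulOp_tmul (x y : B) : mulOp K B (x ⊗ₜ[K] y) = y * x := by simp [mulOp]

open Entwining

/-- The comultiplication of the Drinfel'd double, `Δ(T) = Δ ∘ T ∘ μ` with the opposite product
`μ`. -/
def drinfeldComul :
    Hom (drinfeldEntwining hS) ((drinfeldEntwining hS).tensor (drinfeldEntwining hS)) where
  f := Bialgebra.comulAlgHom K B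
  g := mulOp K B
  counit' c := by
    revert c
    refine eq_of_tmul (by fun_prop) (by fun_prop) fun c d => ?_
    simp
  comul' c := by
    revert c
    refine eq_of_tmul (by fun_prop) (by fun_prop) fun c d => ?_
    simp (disch := fun_prop) only [comul_tmul_eq, tensorSum_tensorSum, tensorSum_tmul,
      mulOp_tmul, comul_mul_eq]
    exact tensorSum_comm (K := K) ..
  compat r c := by
    revert c
    refine eq_of_tmul (by fun_prop) (by fun_prop) fun x y => ?_
    simp (disch := fun_prop) only [mulOp_tmul, sum_drinfeldEntwining, Bialgebra.comulAlgHom_apply,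
      sum_tensor_tmul, comul_tmul, tensorSum_coassoc]
    refine tensorSum_congr fun r₁ s => tensorSum_congr fun r₂ s => ?_
    refine .trans ?_ ((isCounital_mul_antipodeEquiv_symm hS).sum_left (fun u v => tensorSum
      (fun r₃ r₄ => (r₂ ⊗ₜ[K] r₃) ⊗ₜ[K] (S.symm r₄ * y * u * (x * r₁))) (Δ v))
      (by fun_prop) (by fun_prop) (fun u v w => by simp only [mul_assoc]) s).symm
    simp only [mul_assoc, one_mul]

/-- The coaction of the Drinfel'd double on the Heisenberg double, `Γ(T) = Δ ∘ T ∘ μ` with the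
opposite product `μ`. -/
def heisenbergCoact : Hom (heisenbergEntwining K B)
    ((drinfeldEntwining hS).tensor (heisenbergEntwining K B)) where
  f := Bialgebra.comulAlgHom K B
  g := mulOp K B
  counit' := (drinfeldComul hS).counit'
  comul' := (drinfeldComul hS).comul'
  compat r c := by
    revert c
    refine eq_of_tmul (by fun_prop) (by fun_prop) fun x y => ?_
    simp (disch := fun_prop) only [mulOp_tmul, sum_heisenbergEntwining,
      Bialgebra.comulAlgHom_apply, sum_tensor_tmul, comul_tmul, sum_drinfeldEntwining,
      tensorSum_coassoc]
    refine tensorSum_congr fun r₁ s => tensorSum_congr fun r₂ s => ?_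
    refine .trans ?_ ((isCounital_mul_antipodeEquiv_symm hS).sum_left
      (fun u v => (r₂ ⊗ₜ[K] v) ⊗ₜ[K] (y * u * (x * r₁)))
      (by fun_prop) (by fun_prop) (fun u v w => by simp only [mul_assoc]) s).symm
    simp only [mul_assoc, mul_one]

end DoubleEntwinings

/-! ### Functions given by elements of `A ⊗ B` -/

open Entwining

section Smash

variable {K B M C' R' : Type*} [Field K] [Ring B] [HopfAlgebra K B] [AddCommGroup M] [Module K M]
  [AddCommGroup C'] [Module K C'] [Coalgebra K C'] [Ring R'] [Algebra K R']

local notation "Δ" => Coalgebra.comul (R := K)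
local notation "ε" => Coalgebra.counit (R := K)

/-- A functional on `B` as a scalar function in `Hom(B, B)`. -/
def scalarConv (E : Entwining K B B) : Module.Dual K B →ₗ[K] E.Conv where
  toFun f := Conv.of E (f.smulRight 1)
  map_add' f g := by ext x; simp [add_smul]
  map_smul' k f := by ext x; simp [mul_smul]

/-- An element `b` of `B` as the function `x ↦ ε(x) b` in `Hom(B, B)`. -/
def constConv (E : Entwining K B B) : B →ₗ[K] E.Conv where
  toFun b := Conv.of E ((Coalgebra.counit (R := K)).smulRight b)
  map_add' f g := by ext x; simp
  map_smul' k f := by ext x; simp [smul_comm k]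

variable {E : Entwining K B B} {E' : Entwining K C' R'}

theorem scalarConv_apply (f : Module.Dual K B) (x : B) : scalarConv E f x = f x • 1 := rfl

theorem constConv_apply (b x : B) : constConv E b x = ε x • b := rfl

theorem scalarConv_mul_apply (f : Module.Dual K B) (T : E.Conv) (x : B) :
    (scalarConv E f * T) x = tensorSum (fun x₁ x₂ => f x₁ • T x₂) (Δ x) := by
  rw [Conv.mul_apply]
  refine tensorSum_congr fun x₁ x₂ => ?_
  simp (disch := fun_prop) only [scalarConv_apply, map_smul, LinearMap.smul_apply,
    tensorSum_smul_arg, E.sum_one, one_mul]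

theorem mul_constConv_apply (T : E.Conv) (b x : B) : (T * constConv E b) x = T x * b := by
  rw [Conv.mul_apply]
  simp only [constConv_apply, mul_smul_comm,
    fun (r c : B) => E.sum_counit (g := fun r => r * b) (by fun_prop) r c]
  exact tensorSum_counit_right (K := K) (f := fun x => T x * b) (by fun_prop) x

theorem constConv_mul (b c : B) : constConv E (b * c) = constConv E b * constConv E c := by
  ext x
  rw [mul_constConv_apply, constConv_apply, constConv_apply, smul_mul_assoc]

theorem constConv_one : constConv E 1 = 1 := by
  ext x
  rw [constConv_apply, Conv.one_apply]

variable {φ : Module.Dual K B}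

/-- An element of `A ⊗ B` as a function in `Hom(B, B)`. -/
def evalConv (φ : Module.Dual K B) (E : Entwining K B B) : DualAlg φ ⊗[K] B →ₗ[K] E.Conv :=
  (Conv.of E).toLinearMap ∘ₗ evalAB φ

theorem evalConv_apply (z : DualAlg φ ⊗[K] B) (x : B) : evalConv φ E z x = evalAB φ z x := rfl

theorem evalConv_tmul_apply (a : DualAlg φ) (b x : B) : evalConv φ E (a ⊗ₜ[K] b) x = a x • b := rfl

theorem evalConv_tmul (a : DualAlg φ) (b : B) :
    evalConv φ E (a ⊗ₜ[K] b) = scalarConv E (pairing φ a) * constConv E b := by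
  ext x
  rw [mul_constConv_apply, scalarConv_apply, evalConv_tmul_apply, smul_mul_assoc, one_mul]

theorem evalConv_injective : Function.Injective (evalConv φ E) := by
  refine (injective_iff_map_eq_zero _).2 fun z hz => ?_
  refine eq_zero_of_forall_map (κ := Unit) (fun x => (Module.Dual.eval K B x) ∘ₗ pairing φ)
    (fun _ => LinearMap.id) (fun a ha => DualAlg.ext ha) (fun b hb => hb ()) z fun x _ => ?_
  apply (TensorProduct.lid K B).injective
  have h₀ := DFunLike.congr_fun hz x
  rw [map_zero]
  refine .trans ?_ h₀
  clear h₀ hz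
  revert z
  refine eq_of_tmul (by fun_prop) (by fun_prop) fun a b => ?_
  simp [evalConv_tmul_apply]

theorem scalarConv_mul (h : IsRationalDual φ) (a a' : DualAlg φ) :
    scalarConv E (pairing φ (h.realization.mul a a')) =
      scalarConv E (pairing φ a) * scalarConv E (pairing φ a') := by
  ext x
  rw [scalarConv_mul_apply]
  simp only [scalarConv_apply, h.realization_mul_apply, tensorSum_smul, mul_smul]

/-- `∑ q ⊗ p` for an element `∑ p ⊗ q` of `A ⊗ A`, as a scalar function on `B ⊗ B`. -/
def scalarConvFlip (φ : Module.Dual K B) (E E' : Entwining K B B) :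
    DualAlg φ ⊗[K] DualAlg φ →ₗ[K] (E.tensor E').Conv :=
  TensorProduct.lift (Conv.tmul.flip.compl₁₂ (scalarConv E' ∘ₗ pairing φ)
    (scalarConv E ∘ₗ pairing φ))

theorem scalarConvFlip_tmul {E' : Entwining K B B} (p q : DualAlg φ) :
    scalarConvFlip φ E E' (p ⊗ₜ[K] q) =
      Conv.tmul (scalarConv E (pairing φ q)) (scalarConv E' (pairing φ p)) := by
  simp [scalarConvFlip]

theorem scalarConvFlip_apply {E' : Entwining K B B} (z : DualAlg φ ⊗[K] DualAlg φ) (x y : B) :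
    scalarConvFlip φ E E' z (x ⊗ₜ[K] y) = evalAA φ z (y ⊗ₜ[K] x) • (1 ⊗ₜ[K] 1) := by
  revert z
  refine eq_of_tmul (by fun_prop) (by fun_prop) fun p q => ?_
  rw [scalarConvFlip_tmul, Conv.tmul_apply, evalAA_tmul, scalarConv_apply, scalarConv_apply,
    TensorProduct.smul_tmul_smul, mul_comm]

end Smash

section Drinfeld

variable {K B M : Type*} [Field K] [Ring B] [HopfAlgebra K B] [AddCommGroup M] [Module K M]

local notation "Δ" => Coalgebra.comul (R := K)
local notation "ε" => Coalgebra.counit (R := K)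

variable {φ : Module.Dual K B} {S : B ≃ₗ[K] B} (h : IsRationalDual φ)
  (hS : (S : B →ₗ[K] B) = HopfAlgebra.antipode K)

theorem IsRationalDual.bimodule_bimodule (c b c' b' : B) (a : DualAlg φ) :
    h.bimodule c b (h.bimodule c' b' a) = h.bimodule (c' * c) (b * b') a :=
  DualAlg.ext fun x => by simp [mul_assoc]

theorem IsRationalDual.bimodule_one_one (a : DualAlg φ) : h.bimodule 1 1 a = a :=
  DualAlg.ext fun x => by simp

/-- `b ⊗ a ↦ (b₍₁₎ ▸ a ◂ S⁻¹(b₍₃₎)) ⊗ b₍₂₎`, the product `b a` in the Drinfel'd double. -/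
def crossMul (S : B ≃ₗ[K] B) : B ⊗[K] DualAlg φ →ₗ[K] DualAlg φ ⊗[K] B :=
  TensorProduct.lift (bilin (fun b a => tensorSum (fun b₁ s => tensorSum (fun b₂ b₃ =>
    h.bimodule (S.symm b₃) b₁ a ⊗ₜ[K] b₂) (Δ s)) (Δ b)) (by fun_prop) (by fun_prop))

theorem crossMul_tmul (b : B) (a : DualAlg φ) : crossMul h S (b ⊗ₜ[K] a) =
    tensorSum (fun b₁ s => tensorSum (fun b₂ b₃ =>
      h.bimodule (S.symm b₃) b₁ a ⊗ₜ[K] b₂) (Δ s)) (Δ b) := by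
  simp [crossMul]

/-- `a ⊗ b ↦ b₍₂₎ ⊗ (S⁻¹(b₍₁₎) ▸ a ◂ b₍₃₎)`, the inverse of `crossMul`. -/
def crossMulInv (S : B ≃ₗ[K] B) : DualAlg φ ⊗[K] B →ₗ[K] B ⊗[K] DualAlg φ :=
  TensorProduct.lift (bilin (fun a b => tensorSum (fun b₁ s => tensorSum (fun b₂ b₃ =>
    b₂ ⊗ₜ[K] h.bimodule b₃ (S.symm b₁) a) (Δ s)) (Δ b)) (by fun_prop) (by fun_prop))

theorem crossMulInv_tmul (b : B) (a : DualAlg φ) : crossMulInv h S (a ⊗ₜ[K] b) =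
    tensorSum (fun b₁ s => tensorSum (fun b₂ b₃ =>
      b₂ ⊗ₜ[K] h.bimodule b₃ (S.symm b₁) a) (Δ s)) (Δ b) := by
  simp [crossMulInv]

/-- Multiplication as an isomorphism `B ⊗ A ≃ A ⊗ B` onto the Drinfel'd double. -/
def crossMulEquiv (hS : (S : B →ₗ[K] B) = HopfAlgebra.antipode K) :
    B ⊗[K] DualAlg φ ≃ₗ[K] DualAlg φ ⊗[K] B :=
  LinearEquiv.ofLinearMap (crossMul h S) (crossMulInv h S)
    (TensorProduct.ext' fun a b => by
      simp (disch := fun_prop) only [LinearMap.comp_apply, crossMul_tmul, crossMulInv_tmul,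
        LinearMap.map_tensorSum, h.bimodule_bimodule, tensorSum_coassoc, LinearMap.id_apply]
      refine ((isCounital_mul_antipodeEquiv_symm hS).sum_left (fun u v => tensorSum (fun x y =>
        tensorSum (fun y₁ y₂ => h.bimodule (y₂ * S.symm y₁) u a ⊗ₜ[K] x) (Δ y)) (Δ v))
        (by fun_prop) (by fun_prop) (fun _ _ _ => rfl) b).trans ?_
      refine ((isCounital_mul_antipodeEquiv_symm hS).sum_right
        (fun u v => h.bimodule v 1 a ⊗ₜ[K] u)
        (by fun_prop) (by fun_prop) (fun _ _ _ => rfl) b).trans ?_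
      rw [h.bimodule_one_one])
    (TensorProduct.ext' fun b a => by
      simp (disch := fun_prop) only [LinearMap.comp_apply, crossMul_tmul, crossMulInv_tmul,
        LinearMap.map_tensorSum, h.bimodule_bimodule, tensorSum_coassoc, LinearMap.id_apply]
      refine ((isCounital_antipodeEquiv_symm_mul hS).sum_left (fun u v => tensorSum (fun x y =>
        tensorSum (fun y₁ y₂ => x ⊗ₜ[K] h.bimodule (S.symm y₂ * y₁) u a) (Δ y)) (Δ v))
        (by fun_prop) (by fun_prop) (fun _ _ _ => rfl) b).trans ?_
      refine ((isCounital_antipodeEquiv_symm_mul hS).sum_right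
        (fun u v => u ⊗ₜ[K] h.bimodule v 1 a)
        (by fun_prop) (by fun_prop) (fun _ _ _ => rfl) b).trans ?_
      rw [h.bimodule_one_one])

@[simp]
theorem crossMulEquiv_apply (z : B ⊗[K] DualAlg φ) :
    crossMulEquiv h hS z = crossMul h S z := rfl

theorem constConv_mul_scalarConv (f : Module.Dual K B) (b x : B) :
    (constConv (drinfeldEntwining hS) b * scalarConv (drinfeldEntwining hS) f) x =
      tensorSum (fun b₁ s => tensorSum (fun b₂ b₃ =>
        f (S.symm b₃ * x * b₁) • b₂) (Δ s)) (Δ b) := by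
  rw [Conv.mul_apply]
  simp (disch := fun_prop) only [constConv_apply, map_smul, LinearMap.smul_apply,
    tensorSum_smul_arg, scalarConv_apply, sum_drinfeldEntwining, mul_smul_comm, mul_one]
  exact tensorSum_counit_left (K := K) (f := fun x => tensorSum (fun b₁ s =>
    tensorSum (fun b₂ b₃ => f (S.symm b₃ * x * b₁) • b₂) (Δ s)) (Δ b)) (by fun_prop) x

/-- The product `b a` in the Drinfel'd double is the product of functions, so `crossMul` and its
inverse show that the double is spanned by the `b a` as well as by the `a b`. -/
theorem evalConv_crossMul (b : B) (a : DualAlg φ) :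
    evalConv φ (drinfeldEntwining hS) (crossMul h S (b ⊗ₜ[K] a)) =
      constConv _ b * scalarConv _ (pairing φ a) := by
  ext x
  rw [constConv_mul_scalarConv, crossMul_tmul]
  simp only [LinearMap.map_tensorSum, Conv.tensorSum_apply, evalConv_tmul_apply, h.bimodule_apply]

end Drinfeld

/-! ### The product of the Drinfel'd double -/

section ModuleGalois

variable {K B V : Type*} [Field K] [Ring B] [HopfAlgebra K B] [AddCommGroup V] [Module K V]

local notation "Δ" => Coalgebra.comul (R := K)
local notation "ε" => Coalgebra.counit (R := K)

/-- `b ⊗ v ↦ b₍₁₎ ⊗ L(b₍₂₎) v`, where `L'` is the convolution inverse of `L : B → End(V)`. -/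
def galoisRight (L L' : B →ₗ[K] V →ₗ[K] V)
    (h : ∀ b v, tensorSum (fun b₁ b₂ => L b₁ (L' b₂ v)) (Δ b) = ε b • v)
    (h' : ∀ b v, tensorSum (fun b₁ b₂ => L' b₁ (L b₂ v)) (Δ b) = ε b • v) :
    B ⊗[K] V ≃ₗ[K] B ⊗[K] V :=
  LinearEquiv.ofLinearMap
    (TensorProduct.lift (bilin (fun b v => tensorSum (fun b₁ b₂ => b₁ ⊗ₜ[K] L b₂ v) (Δ b))
      (by fun_prop) (by fun_prop)))
    (TensorProduct.lift (bilin (fun b v => tensorSum (fun b₁ b₂ => b₁ ⊗ₜ[K] L' b₂ v) (Δ b))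
      (by fun_prop) (by fun_prop)))
    (TensorProduct.ext' fun b v => by
      simp (disch := fun_prop) only [LinearMap.comp_apply, TensorProduct.lift.tmul, bilin_apply,
        LinearMap.map_tensorSum, tensorSum_coassoc, ← const_tmul_tensorSum, h,
        TensorProduct.tmul_smul]
      exact tensorSum_counit_right (K := K) (f := fun x => x ⊗ₜ[K] v) (by fun_prop) b)
    (TensorProduct.ext' fun b v => by
      simp (disch := fun_prop) only [LinearMap.comp_apply, TensorProduct.lift.tmul, bilin_apply,
        LinearMap.map_tensorSum, tensorSum_coassoc, ← const_tmul_tensorSum, h',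
        TensorProduct.tmul_smul]
      exact tensorSum_counit_right (K := K) (f := fun x => x ⊗ₜ[K] v) (by fun_prop) b)

theorem galoisRight_tmul (L L' : B →ₗ[K] V →ₗ[K] V) (h h') (b : B) (v : V) :
    galoisRight L L' h h' (b ⊗ₜ[K] v) = tensorSum (fun b₁ b₂ => b₁ ⊗ₜ[K] L b₂ v) (Δ b) := by
  simp [galoisRight]

/-- `b ⊗ v ↦ b₍₂₎ ⊗ L(b₍₁₎) v`, where `L'` is the convolution inverse of `L : B → End(V)` for the
opposite coproduct. -/
def galoisLeft (L L' : B →ₗ[K] V →ₗ[K] V)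
    (h : ∀ b v, tensorSum (fun b₁ b₂ => L b₂ (L' b₁ v)) (Δ b) = ε b • v)
    (h' : ∀ b v, tensorSum (fun b₁ b₂ => L' b₂ (L b₁ v)) (Δ b) = ε b • v) :
    B ⊗[K] V ≃ₗ[K] B ⊗[K] V :=
  LinearEquiv.ofLinearMap
    (TensorProduct.lift (bilin (fun b v => tensorSum (fun b₁ b₂ => b₂ ⊗ₜ[K] L b₁ v) (Δ b))
      (by fun_prop) (by fun_prop)))
    (TensorProduct.lift (bilin (fun b v => tensorSum (fun b₁ b₂ => b₂ ⊗ₜ[K] L' b₁ v) (Δ b))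
      (by fun_prop) (by fun_prop)))
    (TensorProduct.ext' fun b v => by
      simp (disch := fun_prop) only [LinearMap.comp_apply, TensorProduct.lift.tmul, bilin_apply,
        LinearMap.map_tensorSum]
      rw [← tensorSum_coassoc (by fun_prop) (by fun_prop) (by fun_prop)]
      simp only [← const_tmul_tensorSum, h, TensorProduct.tmul_smul]
      exact tensorSum_counit_left (K := K) (f := fun x => x ⊗ₜ[K] v) (by fun_prop) b)
    (TensorProduct.ext' fun b v => by
      simp (disch := fun_prop) only [LinearMap.comp_apply, TensorProduct.lift.tmul, bilin_apply,
        LinearMap.map_tensorSum]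
      rw [← tensorSum_coassoc (by fun_prop) (by fun_prop) (by fun_prop)]
      simp only [← const_tmul_tensorSum, h', TensorProduct.tmul_smul]
      exact tensorSum_counit_left (K := K) (f := fun x => x ⊗ₜ[K] v) (by fun_prop) b)

theorem galoisLeft_tmul (L L' : B →ₗ[K] V →ₗ[K] V) (h h') (b : B) (v : V) :
    galoisLeft L L' h h' (b ⊗ₜ[K] v) = tensorSum (fun b₁ b₂ => b₂ ⊗ₜ[K] L b₁ v) (Δ b) := by
  simp [galoisLeft]

end ModuleGalois

section Drinfeld

variable {K B : Type*} [Field K] [Ring B] [HopfAlgebra K B]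

local notation "Δ" => Coalgebra.comul (R := K)
local notation "ε" => Coalgebra.counit (R := K)

variable {φ : Module.Dual K B} {S : B ≃ₗ[K] B} (h : IsRationalDual φ)
  (hS : (S : B →ₗ[K] B) = HopfAlgebra.antipode K)

/-- Left multiplication by `a ∈ A` on `A ⊗ B`. -/
def smulLeftA : DualAlg φ →ₗ[K] DualAlg φ ⊗[K] B →ₗ[K] DualAlg φ ⊗[K] B :=
  LinearMap.rTensorHom B ∘ₗ h.realization.mul

/-- Right multiplication by `b ∈ B` on `A ⊗ B`. -/
def smulRightB (φ : Module.Dual K B) : B →ₗ[K] DualAlg φ ⊗[K] B →ₗ[K] DualAlg φ ⊗[K] B :=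
  LinearMap.lTensorHom (DualAlg φ) ∘ₗ (LinearMap.mul K B).flip

/-- Left multiplication by `b ∈ B` on the Drinfel'd double `A ⊗ B`. -/
def smulLeftB (S : B ≃ₗ[K] B) : B →ₗ[K] DualAlg φ ⊗[K] B →ₗ[K] DualAlg φ ⊗[K] B :=
  bilin (fun b z => tensorSum (fun a c => smulRightB φ c (crossMul h S (b ⊗ₜ[K] a))) z)
    (by fun_prop) (by fun_prop)

theorem smulLeftB_tmul (b : B) (a : DualAlg φ) (c : B) : smulLeftB h S b (a ⊗ₜ[K] c) =
    smulRightB φ c (crossMul h S (b ⊗ₜ[K] a)) := by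
  simp (disch := fun_prop) only [smulLeftB, bilin_apply, tensorSum_tmul]

section

variable (E : Entwining K B B)

theorem evalConv_smulLeftA (a : DualAlg φ) (z : DualAlg φ ⊗[K] B) :
    evalConv φ E (smulLeftA h a z) = scalarConv E (pairing φ a) * evalConv φ E z := by
  revert z
  refine eq_of_tmul (by fun_prop) (by fun_prop) fun a' b => ?_
  simp only [smulLeftA, LinearMap.comp_apply, LinearMap.coe_rTensorHom, LinearMap.rTensor_tmul,
    evalConv_tmul, scalarConv_mul, mul_assoc]

theorem evalConv_smulRightB (b : B) (z : DualAlg φ ⊗[K] B) :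
    evalConv φ E (smulRightB φ b z) = evalConv φ E z * constConv E b := by
  revert z
  refine eq_of_tmul (by fun_prop) (by fun_prop) fun a' c => ?_
  simp only [smulRightB, LinearMap.comp_apply, LinearMap.coe_lTensorHom, LinearMap.lTensor_tmul,
    evalConv_tmul, constConv_mul, mul_assoc, LinearMap.flip_apply, LinearMap.mul_apply']

theorem smulRightB_mul (b c : B) (z : DualAlg φ ⊗[K] B) :
    smulRightB φ (b * c) z = smulRightB φ c (smulRightB φ b z) := by
  revert z
  refine eq_of_tmul (by fun_prop) (by fun_prop) fun a' d => ?_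
  simp [smulRightB, mul_assoc]

theorem smulRightB_one (z : DualAlg φ ⊗[K] B) : smulRightB φ 1 z = z := by
  revert z
  refine eq_of_tmul (by fun_prop) (by fun_prop) fun a' d => ?_
  simp [smulRightB]

end

theorem evalConv_smulLeftB (b : B) (z : DualAlg φ ⊗[K] B) :
    evalConv φ (drinfeldEntwining hS) (smulLeftB h S b z) =
      constConv _ b * evalConv φ (drinfeldEntwining hS) z := by
  revert z
  refine eq_of_tmul (by fun_prop) (by fun_prop) fun a' d => ?_
  rw [smulLeftB_tmul, evalConv_smulRightB, evalConv_crossMul, evalConv_tmul, mul_assoc]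

include hS in
theorem smulLeftB_mul (b c : B) (z : DualAlg φ ⊗[K] B) :
    smulLeftB h S (b * c) z = smulLeftB h S b (smulLeftB h S c z) := by
  apply evalConv_injective (E := drinfeldEntwining hS)
  simp only [evalConv_smulLeftB, constConv_mul, mul_assoc]

include hS in
theorem smulLeftB_one (z : DualAlg φ ⊗[K] B) : smulLeftB h S 1 z = z := by
  apply evalConv_injective (E := drinfeldEntwining hS)
  simp only [evalConv_smulLeftB, constConv_one, one_mul]

/-- The Drinfel'd double as functions on `B` with values in `B`. -/
def drinfeldRealization : Realization (drinfeldEntwining hS) (DualAlg φ ⊗[K] B) where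
  j := evalConv φ (drinfeldEntwining hS)
  injective := evalConv_injective
  mul_mem z w := by
    refine ⟨tensorSum (fun a b => smulLeftA h a (smulLeftB h S b w)) z, ?_⟩
    revert z
    refine eq_of_tmul (by fun_prop) (by fun_prop) fun a b => ?_
    simp (disch := fun_prop) only [tensorSum_tmul, evalConv_smulLeftA, evalConv_smulLeftB,
      evalConv_tmul, mul_assoc]
  eq_zero c hc := h.eq_zero c fun a => hc (a ⊗ₜ[K] 1) (pairing φ a) fun x => rfl

theorem drinfeldRealization_j :
    (drinfeldRealization h hS).j = evalConv φ (drinfeldEntwining hS) := rfl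

end Drinfeld

/-! ### The map `T₁` of the Drinfel'd double -/

section Drinfeld

variable {K B : Type*} [Field K] [Ring B] [HopfAlgebra K B]

local notation "Δ" => Coalgebra.comul (R := K)
local notation "ε" => Coalgebra.counit (R := K)

variable {φ : Module.Dual K B} {S : B ≃ₗ[K] B} (h : IsRationalDual φ)
  (hS : (S : B →ₗ[K] B) = HopfAlgebra.antipode K)

theorem drinfeldRealization_mul_surjective :
    Function.Surjective (TensorProduct.lift (drinfeldRealization h hS).mul) := by
  rw [← LinearMap.range_eq_top, eq_top_iff]
  rintro z -
  induction z with
  | zero => exact Submodule.zero_mem _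
  | add z w hz hw => exact Submodule.add_mem _ hz hw
  | tmul a b =>
    obtain ⟨z, rfl⟩ := h.realization_mul_surjective hS a
    induction z with
    | zero => simp
    | add z w hz hw => rw [map_add, TensorProduct.add_tmul]; exact Submodule.add_mem _ hz hw
    | tmul a a' =>
      refine ⟨(a ⊗ₜ[K] 1) ⊗ₜ[K] (a' ⊗ₜ[K] b), (drinfeldRealization h hS).injective ?_⟩
      rw [TensorProduct.lift.tmul, Realization.j_mul]
      simp only [drinfeldRealization_j, evalConv_tmul, constConv_one, mul_one,
        TensorProduct.lift.tmul, scalarConv_mul, mul_assoc]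

theorem drinfeldComul_map_scalarConv_apply (f : Module.Dual K B) (x y : B) :
    (drinfeldComul hS).map (scalarConv _ f) (x ⊗ₜ[K] y) = f (y * x) • (1 ⊗ₜ[K] 1) := by
  rw [Hom.map_apply]
  simp [drinfeldComul, scalarConv_apply, Algebra.TensorProduct.one_def]

theorem drinfeldComul_map_constConv (b : B) :
    (drinfeldComul hS).map (constConv _ b) =
      tensorSum (fun b₁ b₂ => Conv.tmul (constConv _ b₁) (constConv _ b₂)) (Δ b) := by
  apply Conv.ext_tmul; intro x y
  rw [Hom.map_apply]
  simp only [drinfeldComul, mulOp_tmul, constConv_apply, Bialgebra.counit_mul, map_smul,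
    Bialgebra.comulAlgHom_apply, Conv.tensorSum_apply, Conv.tmul_apply,
    TensorProduct.smul_tmul_smul, ← smul_tensorSum, tensorSum_tmul_self, mul_comm]

/-- On scalar functions `Δ` is the opposite coproduct of `A`, so that each of the products
`Δ(a)(a' ⊗ 1)`, `(a' ⊗ 1)Δ(a)`, `Δ(a)(1 ⊗ a')` and `(1 ⊗ a')Δ(a)` is one of the `Tᵢ` of `A`,
flipped. -/
theorem map_scalarConv_mul_tmul_scalarConv_one (a a' : DualAlg φ) :
    (drinfeldComul hS).map (scalarConv _ (pairing φ a)) *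
        Conv.tmul (scalarConv _ (pairing φ a')) 1 =
      scalarConvFlip φ _ _ ((h.hopfRealization hS).T₁ (a ⊗ₜ[K] a')) := by
  apply Conv.ext_tmul; intro x y
  rw [Conv.mul_tmul_one_apply, scalarConvFlip_apply]
  refine .trans ?_ (congr_arg (· • _) (evalAA_transposeAA _ h.exists_galois₁ _ _).symm)
  simp (disch := fun_prop) only [drinfeldComul_map_scalarConv_apply, tensorSum_smul_arg,
    tensorSum_tmul, Entwining.sum_one,
    scalarConv_apply, mul_smul_comm, mul_one, galois₁_tmul, LinearMap.map_tensorSum, evalAA_tmul,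
    tensorSum_smul, mul_smul, ← TensorProduct.smul_tmul']

theorem tmul_scalarConv_one_mul_map_scalarConv (a a' : DualAlg φ) :
    Conv.tmul (scalarConv _ (pairing φ a')) 1 *
        (drinfeldComul hS).map (scalarConv _ (pairing φ a)) =
      scalarConvFlip φ _ _ ((h.hopfRealization hS).T₄ (a' ⊗ₜ[K] a)) := by
  apply Conv.ext_tmul; intro x y
  rw [Conv.tmul_one_mul_apply, scalarConvFlip_apply]
  refine .trans ?_ (congr_arg (· • _) (evalAA_transposeAA _ h.exists_galois₄ _ _).symm)
  simp (disch := fun_prop) only [drinfeldComul_map_scalarConv_apply, tensorSum_smul_arg,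
    Entwining.sum_one,
    scalarConv_apply, mul_smul_comm, mul_one, galois₄_tmul, LinearMap.map_tensorSum, evalAA_tmul,
    tensorSum_smul, mul_smul, map_smul, LinearMap.smul_apply, Algebra.TensorProduct.tmul_mul_tmul]

theorem map_scalarConv_mul_tmul_one_scalarConv (a a' : DualAlg φ) :
    (drinfeldComul hS).map (scalarConv _ (pairing φ a)) *
        Conv.tmul 1 (scalarConv _ (pairing φ a')) =
      scalarConvFlip φ _ _ ((h.hopfRealization hS).T₃ (a ⊗ₜ[K] a')) := by
  apply Conv.ext_tmul; intro x y
  rw [Conv.mul_one_tmul_apply, scalarConvFlip_apply]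
  refine .trans ?_ (congr_arg (· • _) (evalAA_transposeAA _ h.exists_galois₃ _ _).symm)
  simp (disch := fun_prop) only [drinfeldComul_map_scalarConv_apply, tensorSum_smul_arg,
    tensorSum_tmul, Entwining.sum_one,
    scalarConv_apply, mul_smul_comm, mul_one, galois₃_tmul, LinearMap.map_tensorSum, evalAA_tmul,
    tensorSum_smul, mul_smul, TensorProduct.tmul_smul]

theorem tmul_one_scalarConv_mul_map_scalarConv (a a' : DualAlg φ) :
    Conv.tmul 1 (scalarConv _ (pairing φ a')) *
        (drinfeldComul hS).map (scalarConv _ (pairing φ a)) =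
      scalarConvFlip φ _ _ ((h.hopfRealization hS).T₂ (a' ⊗ₜ[K] a)) := by
  apply Conv.ext_tmul; intro x y
  rw [Conv.one_tmul_mul_apply, scalarConvFlip_apply]
  refine .trans ?_ (congr_arg (· • _) (evalAA_transposeAA _ h.exists_galois₂ _ _).symm)
  simp (disch := fun_prop) only [drinfeldComul_map_scalarConv_apply, tensorSum_smul_arg,
    Entwining.sum_one,
    scalarConv_apply, mul_smul_comm, mul_one, galois₂_tmul, LinearMap.map_tensorSum, evalAA_tmul,
    tensorSum_smul, mul_smul, map_smul, LinearMap.smul_apply, Algebra.TensorProduct.tmul_mul_tmul]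

/-- `(a ⊗ b) ⊗ (a' ⊗ b') ↦ ∑ (p ⊗ b) ⊗ (q ⊗ b')` with `∑ p ⊗ q = θ(a ⊗ a')`. -/
def mapFst {A : Type*} [AddCommGroup A] [Module K A] (θ : A ⊗[K] A ≃ₗ[K] A ⊗[K] A) :
    (A ⊗[K] B) ⊗[K] (A ⊗[K] B) ≃ₗ[K] (A ⊗[K] B) ⊗[K] (A ⊗[K] B) :=
  TensorProduct.tensorTensorTensorComm K A B A B ≪≫ₗ
    TensorProduct.congr θ (LinearEquiv.refl K (B ⊗[K] B)) ≪≫ₗ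
    (TensorProduct.tensorTensorTensorComm K A B A B).symm

theorem mapFst_tmul {A : Type*} [AddCommGroup A] [Module K A] (θ : A ⊗[K] A ≃ₗ[K] A ⊗[K] A)
    (a a' : A) (b b' : B) : mapFst θ ((a ⊗ₜ[K] b) ⊗ₜ[K] (a' ⊗ₜ[K] b')) =
      tensorSum (fun p q => (p ⊗ₜ[K] b) ⊗ₜ[K] (q ⊗ₜ[K] b')) (θ (a ⊗ₜ[K] a')) := by
  simp only [mapFst, LinearEquiv.trans_apply, TensorProduct.tensorTensorTensorComm_tmul,
    TensorProduct.congr_tmul]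
  conv_lhs => rw [← tensorSum_tmul_self (θ (a ⊗ₜ[K] a'))]
  simp only [tensorSum_tmul_const, LinearEquiv.map_tensorSum, LinearEquiv.refl_apply,
    TensorProduct.tensorTensorTensorComm_symm, TensorProduct.tensorTensorTensorComm_tmul]

/-- The bijection `T₁` of the Drinfel'd double,
`(a ⊗ b) ⊗ e ↦ a₍₂₎ b₍₁₎ ⊗ a₍₁₎ b₍₂₎ e`. -/
def drinfeldT₁ : (DualAlg φ ⊗[K] B) ⊗[K] (DualAlg φ ⊗[K] B) ≃ₗ[K]
    (DualAlg φ ⊗[K] B) ⊗[K] (DualAlg φ ⊗[K] B) :=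
  TensorProduct.assoc K _ _ _ ≪≫ₗ
    TensorProduct.congr (LinearEquiv.refl K _) (galoisRight (smulLeftB h S) (smulLeftB h S ∘ₗ S)
      (fun b v => by
        simp only [LinearMap.comp_apply, LinearEquiv.coe_coe, ← smulLeftB_mul h hS]
        rw [(isCounital_mul_antipodeEquiv hS).sum (fun c => smulLeftB h S c v) (by fun_prop)
          (fun _ _ => rfl), smulLeftB_one h hS])
      (fun b v => by
        simp only [LinearMap.comp_apply, LinearEquiv.coe_coe, ← smulLeftB_mul h hS]
        rw [(isCounital_antipodeEquiv_mul hS).sum (fun c => smulLeftB h S c v) (by fun_prop)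
          (fun _ _ => rfl), smulLeftB_one h hS])) ≪≫ₗ
    (TensorProduct.assoc K _ _ _).symm ≪≫ₗ
    mapFst (LinearEquiv.ofBijective _ (h.hopfRealization hS).T₃_bijective ≪≫ₗ
      TensorProduct.comm K _ _)

theorem drinfeldT₁_tmul (a : DualAlg φ) (b : B) (e : DualAlg φ ⊗[K] B) :
    drinfeldT₁ h hS ((a ⊗ₜ[K] b) ⊗ₜ[K] e) =
      tensorSum (fun b₁ b₂ => mapFst (LinearEquiv.ofBijective _
        (h.hopfRealization hS).T₃_bijective ≪≫ₗ TensorProduct.comm K _ _)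
        ((a ⊗ₜ[K] b₁) ⊗ₜ[K] smulLeftB h S b₂ e)) (Δ b) := by
  simp only [drinfeldT₁, LinearEquiv.trans_apply, TensorProduct.assoc_tmul,
    TensorProduct.congr_tmul, LinearEquiv.refl_apply, galoisRight_tmul, const_tmul_tensorSum,
    LinearEquiv.map_tensorSum, TensorProduct.assoc_symm_tmul]

theorem j₂_drinfeldT₁ (d e : DualAlg φ ⊗[K] B) :
    (drinfeldRealization h hS).j₂ (drinfeldT₁ h hS (d ⊗ₜ[K] e)) =
      (drinfeldComul hS).map ((drinfeldRealization h hS).j d) *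
        Conv.tmul 1 ((drinfeldRealization h hS).j e) := by
  have key : ∀ (a : DualAlg φ) (b : B) (e : DualAlg φ ⊗[K] B),
      (drinfeldRealization h hS).j₂ (mapFst (LinearEquiv.ofBijective _
        (h.hopfRealization hS).T₃_bijective ≪≫ₗ TensorProduct.comm K _ _)
        ((a ⊗ₜ[K] b) ⊗ₜ[K] e)) =
      (drinfeldComul hS).map (scalarConv _ (pairing φ a)) *
        Conv.tmul (constConv _ b) (evalConv φ _ e) := by
    intro a b
    refine eq_of_tmul (by fun_prop) (by fun_prop) fun a' b' => ?_
    rw [evalConv_tmul, ← one_mul (constConv _ b), ← Conv.tmul_mul_tmul, ← mul_assoc,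
      map_scalarConv_mul_tmul_one_scalarConv h]
    simp only [mapFst_tmul, LinearEquiv.trans_apply, LinearEquiv.ofBijective_apply]
    generalize (h.hopfRealization hS).T₃ (a ⊗ₜ[K] a') = z
    revert z
    refine eq_of_tmul (by fun_prop) (by fun_prop) fun p q => ?_
    simp (disch := fun_prop) only [TensorProduct.comm_tmul, tensorSum_tmul, Realization.j₂_tmul,
      drinfeldRealization_j, evalConv_tmul, Conv.tmul_mul_tmul, scalarConvFlip_tmul]
  revert d
  refine eq_of_tmul (by fun_prop) (by fun_prop) fun a b => ?_
  simp only [drinfeldT₁_tmul, LinearMap.map_tensorSum, key, evalConv_smulLeftB]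
  simp only [drinfeldRealization_j, evalConv_tmul, map_mul, drinfeldComul_map_constConv, mul_assoc,
    tensorSum_mul, Conv.tmul_mul_tmul, mul_one, mul_tensorSum]

end Drinfeld

/-! ### The maps `T₂`, `T₃`, `T₄` of the Drinfel'd double -/

section Drinfeld

variable {K B : Type*} [Field K] [Ring B] [HopfAlgebra K B]

local notation "Δ" => Coalgebra.comul (R := K)
local notation "ε" => Coalgebra.counit (R := K)

variable {φ : Module.Dual K B} {S : B ≃ₗ[K] B} (h : IsRationalDual φ)
  (hS : (S : B →ₗ[K] B) = HopfAlgebra.antipode K)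

/-- The bijection `T₃` of the Drinfel'd double,
`(a ⊗ b) ⊗ e ↦ a₍₂₎ b₍₁₎ e ⊗ a₍₁₎ b₍₂₎`. -/
def drinfeldT₃ : (DualAlg φ ⊗[K] B) ⊗[K] (DualAlg φ ⊗[K] B) ≃ₗ[K]
    (DualAlg φ ⊗[K] B) ⊗[K] (DualAlg φ ⊗[K] B) :=
  TensorProduct.assoc K _ _ _ ≪≫ₗ
    TensorProduct.congr (LinearEquiv.refl K _)
      (galoisLeft (smulLeftB h S) (smulLeftB h S ∘ₗ S.symm)
      (fun b v => by
        simp only [LinearMap.comp_apply, LinearEquiv.coe_coe, ← smulLeftB_mul h hS]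
        rw [(isCounital_mul_antipodeEquiv_symm hS).sum (fun c => smulLeftB h S c v) (by fun_prop)
          (fun _ _ => rfl), smulLeftB_one h hS])
      (fun b v => by
        simp only [LinearMap.comp_apply, LinearEquiv.coe_coe, ← smulLeftB_mul h hS]
        rw [(isCounital_antipodeEquiv_symm_mul hS).sum (fun c => smulLeftB h S c v) (by fun_prop)
          (fun _ _ => rfl), smulLeftB_one h hS])) ≪≫ₗ
    (TensorProduct.assoc K _ _ _).symm ≪≫ₗ
    mapFst (LinearEquiv.ofBijective _ (h.hopfRealization hS).T₁_bijective) ≪≫ₗ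
    TensorProduct.comm K _ _

theorem drinfeldT₃_tmul (a : DualAlg φ) (b : B) (e : DualAlg φ ⊗[K] B) :
    drinfeldT₃ h hS ((a ⊗ₜ[K] b) ⊗ₜ[K] e) =
      tensorSum (fun b₁ b₂ => TensorProduct.comm K _ _ (mapFst (LinearEquiv.ofBijective _
        (h.hopfRealization hS).T₁_bijective)
        ((a ⊗ₜ[K] b₂) ⊗ₜ[K] smulLeftB h S b₁ e))) (Δ b) := by
  simp only [drinfeldT₃, LinearEquiv.trans_apply, TensorProduct.assoc_tmul,
    TensorProduct.congr_tmul, LinearEquiv.refl_apply, galoisLeft_tmul, const_tmul_tensorSum,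
    LinearEquiv.map_tensorSum, TensorProduct.assoc_symm_tmul]

theorem j₂_drinfeldT₃ (d e : DualAlg φ ⊗[K] B) :
    (drinfeldRealization h hS).j₂ (drinfeldT₃ h hS (d ⊗ₜ[K] e)) =
      (drinfeldComul hS).map ((drinfeldRealization h hS).j d) *
        Conv.tmul ((drinfeldRealization h hS).j e) 1 := by
  have key : ∀ (a : DualAlg φ) (b : B) (e : DualAlg φ ⊗[K] B),
      (drinfeldRealization h hS).j₂ (TensorProduct.comm K _ _ (mapFst (LinearEquiv.ofBijective _
        (h.hopfRealization hS).T₁_bijective)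
        ((a ⊗ₜ[K] b) ⊗ₜ[K] e))) =
      (drinfeldComul hS).map (scalarConv _ (pairing φ a)) *
        Conv.tmul (evalConv φ _ e) (constConv _ b) := by
    intro a b
    refine eq_of_tmul (by fun_prop) (by fun_prop) fun a' b' => ?_
    rw [evalConv_tmul, ← one_mul (constConv _ b), ← Conv.tmul_mul_tmul, ← mul_assoc,
      map_scalarConv_mul_tmul_scalarConv_one h]
    simp only [mapFst_tmul, LinearEquiv.ofBijective_apply]
    generalize (h.hopfRealization hS).T₁ (a ⊗ₜ[K] a') = z
    revert z
    refine eq_of_tmul (by fun_prop) (by fun_prop) fun p q => ?_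
    simp (disch := fun_prop) only [TensorProduct.comm_tmul, tensorSum_tmul, Realization.j₂_tmul,
      drinfeldRealization_j, evalConv_tmul, Conv.tmul_mul_tmul, scalarConvFlip_tmul]
  revert d
  refine eq_of_tmul (by fun_prop) (by fun_prop) fun a b => ?_
  simp only [drinfeldT₃_tmul, LinearMap.map_tensorSum, key, evalConv_smulLeftB]
  simp only [drinfeldRealization_j, evalConv_tmul, map_mul, drinfeldComul_map_constConv, mul_assoc,
    tensorSum_mul, Conv.tmul_mul_tmul, mul_one, mul_tensorSum]

/-- The bijection `T₂` of the Drinfel'd double, `d ⊗ (a ⊗ b) ↦ d a₍₂₎ b₍₁₎ ⊗ a₍₁₎ b₍₂₎`. With `d`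
written as `∑ b' a'` by `crossMulEquiv`, the product `a' a₍₂₎ ⊗ a₍₁₎` is given by `T₄` of `A`. -/
def drinfeldT₂ : (DualAlg φ ⊗[K] B) ⊗[K] (DualAlg φ ⊗[K] B) ≃ₗ[K]
    (DualAlg φ ⊗[K] B) ⊗[K] (DualAlg φ ⊗[K] B) :=
  TensorProduct.congr ((crossMulEquiv h hS).symm ≪≫ₗ TensorProduct.comm K _ _)
      (LinearEquiv.refl K _) ≪≫ₗ
    mapFst (LinearEquiv.ofBijective _ (h.hopfRealization hS).T₄_bijective ≪≫ₗ
      TensorProduct.comm K _ _) ≪≫ₗ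
    TensorProduct.congr (TensorProduct.comm K _ _ ≪≫ₗ crossMulEquiv h hS)
      (LinearEquiv.refl K _) ≪≫ₗ
    TensorProduct.comm K _ _ ≪≫ₗ
    TensorProduct.assoc K _ _ _ ≪≫ₗ
    TensorProduct.congr (LinearEquiv.refl K _)
      (galoisLeft (smulRightB φ) (smulRightB φ ∘ₗ S)
      (fun b v => by
        simp only [LinearMap.comp_apply, LinearEquiv.coe_coe, ← smulRightB_mul]
        rw [(isCounital_antipodeEquiv_mul hS).sum (fun c => smulRightB φ c v) (by fun_prop)
          (fun _ _ => rfl), smulRightB_one])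
      (fun b v => by
        simp only [LinearMap.comp_apply, LinearEquiv.coe_coe, ← smulRightB_mul]
        rw [(isCounital_mul_antipodeEquiv hS).sum (fun c => smulRightB φ c v) (by fun_prop)
          (fun _ _ => rfl), smulRightB_one])) ≪≫ₗ
    (TensorProduct.assoc K _ _ _).symm ≪≫ₗ
    TensorProduct.comm K _ _

theorem drinfeldT₂_tmul (a a' : DualAlg φ) (b b' : B) :
    drinfeldT₂ h hS (crossMul h S (b' ⊗ₜ[K] a') ⊗ₜ[K] (a ⊗ₜ[K] b)) =
      tensorSum (fun p q => tensorSum (fun b₁ b₂ =>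
        smulRightB φ b₁ (crossMul h S (b' ⊗ₜ[K] q)) ⊗ₜ[K] (p ⊗ₜ[K] b₂)) (Δ b))
        ((h.hopfRealization hS).T₄ (a' ⊗ₜ[K] a)) := by
  rw [← crossMulEquiv_apply h hS]
  simp only [drinfeldT₂, LinearEquiv.trans_apply, TensorProduct.congr_tmul,
    LinearEquiv.symm_apply_apply, TensorProduct.comm_tmul, LinearEquiv.refl_apply, mapFst_tmul,
    LinearEquiv.ofBijective_apply]
  generalize (h.hopfRealization hS).T₄ (a' ⊗ₜ[K] a) = z
  revert z
  refine eq_of_tmul (by fun_prop) (by fun_prop) fun p q => ?_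
  simp (disch := fun_prop) only [TensorProduct.comm_tmul, tensorSum_tmul, TensorProduct.congr_tmul,
    LinearEquiv.trans_apply, LinearEquiv.refl_apply, TensorProduct.assoc_tmul, galoisLeft_tmul,
    const_tmul_tensorSum, LinearEquiv.map_tensorSum, TensorProduct.assoc_symm_tmul,
    crossMulEquiv_apply]

theorem j₂_drinfeldT₂ (d e : DualAlg φ ⊗[K] B) :
    (drinfeldRealization h hS).j₂ (drinfeldT₂ h hS (d ⊗ₜ[K] e)) =
      Conv.tmul ((drinfeldRealization h hS).j d) 1 *
        (drinfeldComul hS).map ((drinfeldRealization h hS).j e) := by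
  obtain ⟨z, rfl⟩ := (crossMulEquiv h hS).surjective d
  rw [crossMulEquiv_apply]
  revert z
  refine eq_of_tmul (by fun_prop) (by fun_prop) fun b' a' => ?_
  revert e
  refine eq_of_tmul (by fun_prop) (by fun_prop) fun a b => ?_
  rw [drinfeldT₂_tmul]
  simp only [drinfeldRealization_j, evalConv_crossMul, evalConv_tmul, map_mul,
    drinfeldComul_map_constConv]
  rw [← one_mul (1 : (drinfeldEntwining hS).Conv), ← Conv.tmul_mul_tmul, mul_assoc,
    ← mul_assoc (Conv.tmul (scalarConv _ (pairing φ a')) 1),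
    tmul_scalarConv_one_mul_map_scalarConv h]
  generalize (h.hopfRealization hS).T₄ (a' ⊗ₜ[K] a) = z
  revert z
  refine eq_of_tmul (by fun_prop) (by fun_prop) fun p q => ?_
  simp (disch := fun_prop) only [tensorSum_tmul, LinearMap.map_tensorSum, Realization.j₂_tmul,
    drinfeldRealization_j, evalConv_smulRightB, evalConv_crossMul, evalConv_tmul,
    scalarConvFlip_tmul, mul_tensorSum, Conv.tmul_mul_tmul, one_mul, mul_assoc]

/-- The bijection `T₄` of the Drinfel'd double, `d ⊗ (a ⊗ b) ↦ a₍₂₎ b₍₁₎ ⊗ d a₍₁₎ b₍₂₎`. With `d`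
written as `∑ b' a'` by `crossMulEquiv`, the product `a₍₂₎ ⊗ a' a₍₁₎` is given by `T₂` of `A`. -/
def drinfeldT₄ : (DualAlg φ ⊗[K] B) ⊗[K] (DualAlg φ ⊗[K] B) ≃ₗ[K]
    (DualAlg φ ⊗[K] B) ⊗[K] (DualAlg φ ⊗[K] B) :=
  TensorProduct.congr ((crossMulEquiv h hS).symm ≪≫ₗ TensorProduct.comm K _ _)
      (LinearEquiv.refl K _) ≪≫ₗ
    mapFst (LinearEquiv.ofBijective _ (h.hopfRealization hS).T₂_bijective) ≪≫ₗ
    TensorProduct.congr (TensorProduct.comm K _ _ ≪≫ₗ crossMulEquiv h hS)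
      (LinearEquiv.refl K _) ≪≫ₗ
    TensorProduct.comm K _ _ ≪≫ₗ
    TensorProduct.assoc K _ _ _ ≪≫ₗ
    TensorProduct.congr (LinearEquiv.refl K _)
      (galoisRight (smulRightB φ) (smulRightB φ ∘ₗ S.symm)
      (fun b v => by
        simp only [LinearMap.comp_apply, LinearEquiv.coe_coe, ← smulRightB_mul]
        rw [(isCounital_antipodeEquiv_symm_mul hS).sum (fun c => smulRightB φ c v) (by fun_prop)
          (fun _ _ => rfl), smulRightB_one])
      (fun b v => by
        simp only [LinearMap.comp_apply, LinearEquiv.coe_coe, ← smulRightB_mul]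
        rw [(isCounital_mul_antipodeEquiv_symm hS).sum (fun c => smulRightB φ c v) (by fun_prop)
          (fun _ _ => rfl), smulRightB_one])) ≪≫ₗ
    (TensorProduct.assoc K _ _ _).symm

theorem drinfeldT₄_tmul (a a' : DualAlg φ) (b b' : B) :
    drinfeldT₄ h hS (crossMul h S (b' ⊗ₜ[K] a') ⊗ₜ[K] (a ⊗ₜ[K] b)) =
      tensorSum (fun p q => tensorSum (fun b₁ b₂ =>
        (q ⊗ₜ[K] b₁) ⊗ₜ[K] smulRightB φ b₂ (crossMul h S (b' ⊗ₜ[K] p))) (Δ b))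
        ((h.hopfRealization hS).T₂ (a' ⊗ₜ[K] a)) := by
  rw [← crossMulEquiv_apply h hS]
  simp only [drinfeldT₄, LinearEquiv.trans_apply, TensorProduct.congr_tmul,
    LinearEquiv.symm_apply_apply, TensorProduct.comm_tmul, LinearEquiv.refl_apply, mapFst_tmul,
    LinearEquiv.ofBijective_apply]
  generalize (h.hopfRealization hS).T₂ (a' ⊗ₜ[K] a) = z
  revert z
  refine eq_of_tmul (by fun_prop) (by fun_prop) fun p q => ?_
  simp (disch := fun_prop) only [TensorProduct.comm_tmul, tensorSum_tmul, TensorProduct.congr_tmul,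
    LinearEquiv.trans_apply, LinearEquiv.refl_apply, TensorProduct.assoc_tmul, galoisRight_tmul,
    const_tmul_tensorSum, LinearEquiv.map_tensorSum, TensorProduct.assoc_symm_tmul,
    crossMulEquiv_apply]

theorem j₂_drinfeldT₄ (d e : DualAlg φ ⊗[K] B) :
    (drinfeldRealization h hS).j₂ (drinfeldT₄ h hS (d ⊗ₜ[K] e)) =
      Conv.tmul 1 ((drinfeldRealization h hS).j d) *
        (drinfeldComul hS).map ((drinfeldRealization h hS).j e) := by
  obtain ⟨z, rfl⟩ := (crossMulEquiv h hS).surjective d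
  rw [crossMulEquiv_apply]
  revert z
  refine eq_of_tmul (by fun_prop) (by fun_prop) fun b' a' => ?_
  revert e
  refine eq_of_tmul (by fun_prop) (by fun_prop) fun a b => ?_
  rw [drinfeldT₄_tmul]
  simp only [drinfeldRealization_j, evalConv_crossMul, evalConv_tmul, map_mul,
    drinfeldComul_map_constConv]
  rw [← one_mul (1 : (drinfeldEntwining hS).Conv), ← Conv.tmul_mul_tmul, mul_assoc,
    ← mul_assoc (Conv.tmul 1 (scalarConv _ (pairing φ a'))),
    tmul_one_scalarConv_mul_map_scalarConv h]
  generalize (h.hopfRealization hS).T₂ (a' ⊗ₜ[K] a) = z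
  revert z
  refine eq_of_tmul (by fun_prop) (by fun_prop) fun p q => ?_
  simp (disch := fun_prop) only [tensorSum_tmul, LinearMap.map_tensorSum, Realization.j₂_tmul,
    drinfeldRealization_j, evalConv_smulRightB, evalConv_crossMul, evalConv_tmul,
    scalarConvFlip_tmul, mul_tensorSum, Conv.tmul_mul_tmul, one_mul, mul_assoc]

theorem comulAlgHom_coassoc (b : B) : Algebra.TensorProduct.assoc K K K B B B
    (Algebra.TensorProduct.map (Bialgebra.comulAlgHom K B) (AlgHom.id K B) (Δ b)) =
      Algebra.TensorProduct.map (AlgHom.id K B) (Bialgebra.comulAlgHom K B) (Δ b) :=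
  Coalgebra.coassoc_apply (R := K) b

/-- The Drinfel'd double as functions on `B`, with its comultiplication. -/
def drinfeldHopfRealization : HopfRealization (drinfeldEntwining hS) (DualAlg φ ⊗[K] B) where
  toRealization := drinfeldRealization h hS
  comul := drinfeldComul hS
  coassoc f := by
    apply Conv.ext_tmul; intro x w
    revert w
    refine eq_of_tmul (by fun_prop) (by fun_prop) fun y z => ?_
    simp only [Hom.map_apply, Hom.assoc, Hom.tensor, Hom.id, drinfeldComul, TensorProduct.map_tmul,
      LinearEquiv.coe_coe, TensorProduct.assoc_symm_tmul, mulOp_tmul, LinearMap.id_apply,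
      mul_assoc]
    exact comulAlgHom_coassoc _
  surjective := drinfeldRealization_mul_surjective h hS
  T₁ := (drinfeldT₁ h hS).toLinearMap
  T₂ := (drinfeldT₂ h hS).toLinearMap
  T₃ := (drinfeldT₃ h hS).toLinearMap
  T₄ := (drinfeldT₄ h hS).toLinearMap
  j₂_T₁ := j₂_drinfeldT₁ h hS
  j₂_T₂ := j₂_drinfeldT₂ h hS
  j₂_T₃ := j₂_drinfeldT₃ h hS
  j₂_T₄ := j₂_drinfeldT₄ h hS
  T₁_bijective := (drinfeldT₁ h hS).bijective
  T₂_bijective := (drinfeldT₂ h hS).bijective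
  T₃_bijective := (drinfeldT₃ h hS).bijective
  T₄_bijective := (drinfeldT₄ h hS).bijective

/-- The Drinfel'd double. -/
def drinfeldDouble : RegularMultiplierHopfAlgebra K (DualAlg φ ⊗[K] B) :=
  (drinfeldHopfRealization h hS).regularMultiplierHopfAlgebra

end Drinfeld

/-! ### The Heisenberg double -/

section Heisenberg

variable {K B : Type*} [Field K] [Ring B] [HopfAlgebra K B]

local notation "Δ" => Coalgebra.comul (R := K)
local notation "ε" => Coalgebra.counit (R := K)

variable {φ : Module.Dual K B} {S : B ≃ₗ[K] B} (h : IsRationalDual φ)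
  (hS : (S : B →ₗ[K] B) = HopfAlgebra.antipode K)

theorem mapTensor_evalConv_apply (E E' : Entwining K B B)
    (z : (DualAlg φ ⊗[K] B) ⊗[K] (DualAlg φ ⊗[K] B)) (w : B ⊗[K] B) :
    Conv.mapTensor (evalConv φ E) (evalConv φ E') z w = evalABAB φ z w := by
  revert z
  refine eq_of_tmul (by fun_prop) (by fun_prop) fun u v => ?_
  revert w
  refine eq_of_tmul (by fun_prop) (by fun_prop) fun x y => ?_
  simp [evalABAB, evalConv_apply]

theorem evalABAB_tmul (u v : DualAlg φ ⊗[K] B) (x y : B) :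
    evalABAB φ (u ⊗ₜ[K] v) (x ⊗ₜ[K] y) = evalAB φ u x ⊗ₜ[K] evalAB φ v y := by
  simp [evalABAB]

theorem isDrinfeldDouble_drinfeldDouble : IsDrinfeldDouble S φ (drinfeldDouble h hS) := by
  refine ⟨fun a a' b b' x => ?_, fun a a' b b' x y => ?_⟩
  · refine (DFunLike.congr_fun ((drinfeldRealization h hS).j_mul (a ⊗ₜ[K] b) (a' ⊗ₜ[K] b')) x).trans
      ?_
    rw [Conv.mul_apply]
    simp (disch := fun_prop) only [sweedler₂_eq_tensorSum, sweedler₃_eq_tensorSum,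
      drinfeldRealization_j, evalConv_tmul_apply, map_smul, LinearMap.smul_apply,
      tensorSum_smul_arg, sum_drinfeldEntwining, smul_tensorSum, mul_smul_comm, mul_smul]
  · rw [← mapTensor_evalConv_apply (drinfeldEntwining hS) (drinfeldEntwining hS)]
    refine (DFunLike.congr_fun (j₂_drinfeldT₁ h hS (a ⊗ₜ[K] b) (a' ⊗ₜ[K] b')) (x ⊗ₜ[K] y)).trans ?_
    rw [Conv.mul_one_tmul_apply]
    simp (disch := fun_prop) only [sweedler₂_eq_tensorSum, sweedler₄_eq_tensorSum,
      drinfeldRealization_j, evalConv_tmul_apply, map_smul, Hom.map_apply,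
      drinfeldComul, mulOp_tmul, Bialgebra.comulAlgHom_apply,
      tensorSum_smul_arg, sum_drinfeldEntwining, smul_tensorSum, const_tmul_tensorSum,
      TensorProduct.tmul_smul, mul_smul_comm, mul_smul]

/-- Left multiplication by `b ∈ B` on the Heisenberg double `A ⊗ B`. -/
def heisenbergSmulLeftB : B →ₗ[K] DualAlg φ ⊗[K] B →ₗ[K] DualAlg φ ⊗[K] B :=
  bilin (fun b z => tensorSum (fun a c => tensorSum (fun b₁ b₂ =>
    h.bimodule 1 b₁ a ⊗ₜ[K] (b₂ * c)) (Δ b)) z)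
    (by fun_prop) (by fun_prop)

theorem constConv_mul_apply_heisenberg (T : (heisenbergEntwining K B).Conv) (b x : B) :
    (constConv (heisenbergEntwining K B) b * T) x =
      tensorSum (fun b₁ b₂ => b₂ * T (x * b₁)) (Δ b) := by
  rw [Conv.mul_apply]
  simp (disch := fun_prop) only [constConv_apply, map_smul, LinearMap.smul_apply,
    tensorSum_smul_arg, sum_heisenbergEntwining]
  exact tensorSum_counit_left (K := K) (f := fun x => tensorSum (fun b₁ b₂ =>
    b₂ * T (x * b₁)) (Δ b)) (by fun_prop) x

theorem evalConv_heisenbergSmulLeftB (b : B) (z : DualAlg φ ⊗[K] B) :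
    evalConv φ (heisenbergEntwining K B) (heisenbergSmulLeftB h b z) =
      constConv _ b * evalConv φ (heisenbergEntwining K B) z := by
  revert z
  refine eq_of_tmul (by fun_prop) (by fun_prop) fun a c => ?_
  ext x
  rw [constConv_mul_apply_heisenberg]
  simp (disch := fun_prop) only [heisenbergSmulLeftB, bilin_apply, tensorSum_tmul,
    LinearMap.map_tensorSum, Conv.tensorSum_apply, evalConv_tmul_apply, h.bimodule_apply, one_mul,
    mul_smul_comm]

/-- The Heisenberg double as functions on `B` with values in `B`. -/
def heisenbergRealization : Realization (heisenbergEntwining K B) (DualAlg φ ⊗[K] B) where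
  j := evalConv φ (heisenbergEntwining K B)
  injective := evalConv_injective
  mul_mem z w := by
    refine ⟨tensorSum (fun a b => smulLeftA h a (heisenbergSmulLeftB h b w)) z, ?_⟩
    revert z
    refine eq_of_tmul (by fun_prop) (by fun_prop) fun a b => ?_
    simp (disch := fun_prop) only [tensorSum_tmul, evalConv_smulLeftA,
      evalConv_heisenbergSmulLeftB, evalConv_tmul, mul_assoc]
  eq_zero c hc := h.eq_zero c fun a => hc (a ⊗ₜ[K] 1) (pairing φ a) fun x => rfl

theorem heisenbergRealization_j :
    (heisenbergRealization h).j = evalConv φ (heisenbergEntwining K B) := rfl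

/-- The Heisenberg double. -/
def heisenbergDouble : NondegenerateAlgebra K (DualAlg φ ⊗[K] B) :=
  (heisenbergRealization h).algebra

theorem evalConv_heisenbergDouble_mul (u v : DualAlg φ ⊗[K] B) :
    evalConv φ (heisenbergEntwining K B) ((heisenbergDouble h).mul u v) =
      evalConv φ _ u * evalConv φ _ v :=
  (heisenbergRealization h).j_mul u v

theorem evalAB_heisenbergDouble_mul (u v : DualAlg φ ⊗[K] B) (x : B) :
    evalAB φ ((heisenbergDouble h).mul u v) x = tensorSum (fun x₁ x₂ => tensorSum (fun r₁ r₂ =>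
      r₂ * evalAB φ v (x₂ * r₁)) (Δ (evalAB φ u x₁))) (Δ x) := by
  rw [← evalConv_apply (E := heisenbergEntwining K B), evalConv_heisenbergDouble_mul,
    Conv.mul_apply]
  simp (disch := fun_prop) only [sum_heisenbergEntwining, evalConv_apply]

theorem isHeisenbergDouble_heisenbergDouble : IsHeisenbergDouble φ (heisenbergDouble h) := by
  intro a a' b b' x
  rw [evalAB_heisenbergDouble_mul]
  simp (disch := fun_prop) only [sweedler₂_eq_tensorSum, evalAB_tmul, map_smul, tensorSum_smul_arg,
    smul_tensorSum, mul_smul_comm, mul_smul]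

end Heisenberg

/-! ### Functionals and elements of `B` acting on the Heisenberg double -/

section Action

variable {K B : Type*} [Field K] [Ring B] [HopfAlgebra K B]

local notation "Δ" => Coalgebra.comul (R := K)
local notation "ε" => Coalgebra.counit (R := K)

variable {φ : Module.Dual K B} {S : B ≃ₗ[K] B} (h : IsRationalDual φ)
  (hS : (S : B →ₗ[K] B) = HopfAlgebra.antipode K)

theorem evalAB_injective : Function.Injective (evalAB φ) :=
  evalConv_injective (E := heisenbergEntwining K B)

/-- The action `(f · X)(x) = ∑ ⟨f, S⁻¹(c₍₁₎) S⁻¹(x₍₃₎) x₍₁₎⟩ c₍₂₎`, `c = X(x₍₂₎)`, of functionals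
on linear maps `B → B`. -/
def dualActHom (S : B ≃ₗ[K] B) : Module.Dual K B →ₗ[K] (B →ₗ[K] B) →ₗ[K] B →ₗ[K] B :=
  LinearMap.mk₂ K (fun f X => IsLinearMap.mk' (fun x => tensorSum (fun x₁ s =>
      tensorSum (fun x₂ x₃ => tensorSum (fun c₁ c₂ =>
        f (S.symm c₁ * S.symm x₃ * x₁) • c₂) (Δ (X x₂))) (Δ s)) (Δ x)) (by fun_prop))
    (fun f g X => by
      ext x
      exact IsLinearMap.map_add (R := K) (f := fun f : Module.Dual K B => tensorSum (fun x₁ s =>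
        tensorSum (fun x₂ x₃ => tensorSum (fun c₁ c₂ =>
        f (S.symm c₁ * S.symm x₃ * x₁) • c₂) (Δ (X x₂))) (Δ s)) (Δ x)) (by fun_prop) f g)
    (fun k f X => by
      ext x
      exact IsLinearMap.map_smul (f := fun f : Module.Dual K B => tensorSum (fun x₁ s =>
        tensorSum (fun x₂ x₃ => tensorSum (fun c₁ c₂ =>
        f (S.symm c₁ * S.symm x₃ * x₁) • c₂) (Δ (X x₂))) (Δ s)) (Δ x)) (by fun_prop) k f)
    (fun f X Y => by
      ext x
      exact IsLinearMap.map_add (R := K) (f := fun X : B →ₗ[K] B => tensorSum (fun x₁ s =>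
        tensorSum (fun x₂ x₃ => tensorSum (fun c₁ c₂ =>
        f (S.symm c₁ * S.symm x₃ * x₁) • c₂) (Δ (X x₂))) (Δ s)) (Δ x)) (by fun_prop) X Y)
    (fun k f X => by
      ext x
      exact IsLinearMap.map_smul (f := fun X : B →ₗ[K] B => tensorSum (fun x₁ s =>
        tensorSum (fun x₂ x₃ => tensorSum (fun c₁ c₂ =>
        f (S.symm c₁ * S.symm x₃ * x₁) • c₂) (Δ (X x₂))) (Δ s)) (Δ x)) (by fun_prop) k X)

theorem dualActHom_apply (f : Module.Dual K B) (X : B →ₗ[K] B) (x : B) :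
    dualActHom S f X x = tensorSum (fun x₁ s => tensorSum (fun x₂ x₃ => tensorSum (fun c₁ c₂ =>
        f (S.symm c₁ * S.symm x₃ * x₁) • c₂) (Δ (X x₂))) (Δ s)) (Δ x) := rfl

include h in
/-- The action of functionals preserves `A ⊗ B`, and it is rational. -/
theorem exists_dualActHom (z : DualAlg φ ⊗[K] B) : ∃ t : (DualAlg φ ⊗[K] B) ⊗[K] B,
    ∀ f : Module.Dual K B, dualActHom S f (evalAB φ z) =
      evalAB φ (tensorSum (fun w u => f u • w) t) := by
  induction z with
  | zero =>
    refine ⟨0, fun f => ?_⟩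
    rw [map_zero, map_zero, tensorSum_zero_arg (K := K) (by fun_prop) (by fun_prop), map_zero]
  | add z w hz hw =>
    obtain ⟨t, ht⟩ := hz
    obtain ⟨u, hu⟩ := hw
    refine ⟨t + u, fun f => ?_⟩
    rw [map_add, map_add, ht, hu, ← map_add, (IsLinearMap.tensorSum_apply (K := K)
      (f := fun (w : DualAlg φ ⊗[K] B) u => f u • w) (by fun_prop) (by fun_prop)).map_add]
  | tmul a b =>
    obtain ⟨t, ht⟩ := h.exists_right a
    choose u hu using h.exists_left
    refine ⟨tensorSum (fun a' c => tensorSum (fun a'' c' => tensorSum (fun b₁ b₂ =>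
      (a'' ⊗ₜ[K] b₂) ⊗ₜ[K] (S.symm b₁ * S.symm c' * c)) (Δ b)) (u a')) t, fun f => ?_⟩
    ext x
    simp (disch := fun_prop) only [dualActHom_apply, evalAB_tmul, map_smul, tensorSum_smul_arg,
      tensorSum_tensorSum, tensorSum_tmul, LinearMap.map_tensorSum, tensorSum_apply,
      LinearMap.smul_apply]
    rw [← tensorSum_coassoc (by fun_prop) (by fun_prop) (by fun_prop)]
    have e₁ : ∀ y v : B, tensorSum (fun x₁ x₂ => a x₂ • tensorSum (fun b₁ b₂ =>
        f (S.symm b₁ * S.symm v * x₁) • b₂) (Δ b)) (Δ y) = tensorSum (fun (a' : DualAlg φ) c =>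
          a' y • tensorSum (fun b₁ b₂ => f (S.symm b₁ * S.symm v * c) • b₂) (Δ b)) t := by
      intro y v
      have hL : IsLinearMap K fun c : B =>
        tensorSum (fun b₁ b₂ => f (S.symm b₁ * S.symm v * c) • b₂) (Δ b) := by fun_prop
      have := congr_arg (fun c : B =>
        tensorSum (fun b₁ b₂ => f (S.symm b₁ * S.symm v * c) • b₂) (Δ b)) (ht y)
      simpa only [hL.map_tensorSum, hL.map_smul] using this
    simp only [e₁]
    rw [tensorSum_comm]
    refine tensorSum_congr fun a' c => ?_
    have hL : IsLinearMap K fun v : B =>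
      tensorSum (fun b₁ b₂ => f (S.symm b₁ * S.symm v * c) • b₂) (Δ b) := by fun_prop
    have := congr_arg (fun v : B =>
        tensorSum (fun b₁ b₂ => f (S.symm b₁ * S.symm v * c) • b₂) (Δ b)) (hu a' x)
    simp only [hL.map_tensorSum, hL.map_smul] at this
    rw [this]
    refine tensorSum_congr fun a'' c' => ?_
    rw [smul_tensorSum]
    exact tensorSum_congr fun b₁ b₂ => smul_comm ..

/-- The action of functionals on the Heisenberg double. -/
def dualAct (S : B ≃ₗ[K] B) :
    Module.Dual K B →ₗ[K] DualAlg φ ⊗[K] B →ₗ[K] DualAlg φ ⊗[K] B :=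
  liftRange₂ (evalAB φ) evalAB_injective ((dualActHom S).compl₁₂ LinearMap.id (evalAB φ))
    fun f z => by
      obtain ⟨t, ht⟩ := exists_dualActHom (S := S) h z
      exact ⟨_, (ht f).symm⟩

theorem evalAB_dualAct (f : Module.Dual K B) (z : DualAlg φ ⊗[K] B) :
    evalAB φ (dualAct h S f z) = dualActHom S f (evalAB φ z) :=
  apply_liftRange₂ ..

/-- Rationality of the action of functionals on the Heisenberg double. -/
theorem exists_dualAct (z : DualAlg φ ⊗[K] B) : ∃ t : (DualAlg φ ⊗[K] B) ⊗[K] B,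
    ∀ f : Module.Dual K B, dualAct h S f z = tensorSum (fun w u => f u • w) t := by
  obtain ⟨t, ht⟩ := exists_dualActHom (S := S) h z
  exact ⟨t, fun f => evalAB_injective (by rw [evalAB_dualAct, ht])⟩

/-- The action `b · X = ∑ b₍₁₎ X S(b₍₂₎)` of `B` on the Heisenberg double. -/
def adjAct (S : B ≃ₗ[K] B) : B →ₗ[K] DualAlg φ ⊗[K] B →ₗ[K] DualAlg φ ⊗[K] B :=
  bilin (fun b z => tensorSum (fun b₁ b₂ =>
    smulRightB φ (S b₂) (heisenbergSmulLeftB h b₁ z)) (Δ b)) (by fun_prop) (by fun_prop)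

theorem adjAct_eq (b : B) (z : DualAlg φ ⊗[K] B) : adjAct h S b z = tensorSum (fun b₁ b₂ =>
    smulRightB φ (S b₂) (heisenbergSmulLeftB h b₁ z)) (Δ b) := rfl

theorem evalAB_smulRightB (b : B) (z : DualAlg φ ⊗[K] B) (x : B) :
    evalAB φ (smulRightB φ b z) x = evalAB φ z x * b := by
  rw [← evalConv_apply (E := heisenbergEntwining K B), evalConv_smulRightB, mul_constConv_apply,
    evalConv_apply]

theorem evalAB_heisenbergSmulLeftB (b : B) (z : DualAlg φ ⊗[K] B) (x : B) :
    evalAB φ (heisenbergSmulLeftB h b z) x =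
      tensorSum (fun b₁ b₂ => b₂ * evalAB φ z (x * b₁)) (Δ b) := by
  rw [← evalConv_apply (E := heisenbergEntwining K B), evalConv_heisenbergSmulLeftB,
    constConv_mul_apply_heisenberg]
  rfl

theorem evalAB_smulLeftA (a : DualAlg φ) (z : DualAlg φ ⊗[K] B) (x : B) :
    evalAB φ (smulLeftA h a z) x = tensorSum (fun x₁ x₂ => a x₁ • evalAB φ z x₂) (Δ x) := by
  rw [← evalConv_apply (E := heisenbergEntwining K B), evalConv_smulLeftA,
    scalarConv_mul_apply]
  rfl

theorem evalAB_adjAct (b : B) (z : DualAlg φ ⊗[K] B) (x : B) :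
    evalAB φ (adjAct h S b z) x = tensorSum (fun b₁ s => tensorSum (fun b₂ b₃ =>
      b₂ * evalAB φ z (x * b₁) * S b₃) (Δ s)) (Δ b) := by
  simp (disch := fun_prop) only [adjAct_eq, LinearMap.map_tensorSum, tensorSum_apply,
    evalAB_smulRightB, evalAB_heisenbergSmulLeftB, tensorSum_mul, tensorSum_coassoc]

/-! #### The Heisenberg double as operators on `B` -/

/-- The operator `x ↦ ∑ x₍₂₎ X(x₍₁₎)` on `B` given by an element `X` of the Heisenberg double. -/
def heisenbergOp (φ : Module.Dual K B) : DualAlg φ ⊗[K] B →ₗ[K] B →ₗ[K] B :=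
  bilin (fun z x => tensorSum (fun x₁ x₂ => x₂ * evalAB φ z x₁) (Δ x)) (by fun_prop) (by fun_prop)

theorem heisenbergOp_apply (z : DualAlg φ ⊗[K] B) (x : B) :
    heisenbergOp φ z x = tensorSum (fun x₁ x₂ => x₂ * evalAB φ z x₁) (Δ x) := rfl

include hS in
/-- The inversion formula `X(x) = ∑ S⁻¹(x₍₂₎) T(x₍₁₎)` for the operator `T` given by `X`. -/
theorem evalAB_eq_heisenbergOp (z : DualAlg φ ⊗[K] B) (x : B) :
    evalAB φ z x = tensorSum (fun x₁ x₂ => S.symm x₂ * heisenbergOp φ z x₁) (Δ x) := by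
  simp (disch := fun_prop) only [heisenbergOp_apply, mul_tensorSum, tensorSum_coassoc]
  refine .trans ?_ ((isCounital_antipodeEquiv_symm_mul hS).sum_right
    (fun u v => v * evalAB φ z u) (by fun_prop) (by fun_prop)
    (fun _ _ _ => by rw [mul_assoc]) x).symm
  rw [one_mul]

include hS in
theorem heisenbergOp_injective : Function.Injective (heisenbergOp φ) := by
  intro z w hzw
  apply evalAB_injective
  ext x
  rw [evalAB_eq_heisenbergOp hS, hzw, ← evalAB_eq_heisenbergOp hS]

/-- The product of the Heisenberg double becomes composition of operators, in reverse order. -/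
theorem heisenbergOp_mul (u v : DualAlg φ ⊗[K] B) (x : B) :
    heisenbergOp φ ((heisenbergDouble h).mul u v) x = heisenbergOp φ v (heisenbergOp φ u x) := by
  simp (disch := fun_prop) only [heisenbergOp_apply, evalAB_heisenbergDouble_mul,
    LinearMap.map_tensorSum, comul_mul_eq, tensorSum_tensorSum, tensorSum_tmul, mul_tensorSum,
    tensorSum_coassoc]
  simp only [mul_assoc]

include hS in
theorem heisenbergOp_dualAct (f : Module.Dual K B) (z : DualAlg φ ⊗[K] B) (x : B) :
    heisenbergOp φ (dualAct h S f z) x = tensorSum (fun x₁ x₂ => tensorSum (fun w₁ w₂ =>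
      f (S.symm w₁ * x₁) • w₂) (Δ (heisenbergOp φ z x₂))) (Δ x) := by
  simp (disch := fun_prop) only [heisenbergOp_apply, evalAB_dualAct, dualActHom_apply,
    LinearMap.map_tensorSum, comul_mul_eq, tensorSum_tensorSum, tensorSum_tmul, mul_tensorSum,
    tensorSum_coassoc, antipodeEquiv_symm_mul hS]
  simp only [mul_smul_comm]

theorem heisenbergOp_adjAct (b : B) (z : DualAlg φ ⊗[K] B) (x : B) :
    heisenbergOp φ (adjAct h S b z) x =
      tensorSum (fun b₁ b₂ => heisenbergOp φ z (x * b₁) * S b₂) (Δ b) := by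
  simp (disch := fun_prop) only [heisenbergOp_apply, evalAB_adjAct,
    comul_mul_eq, tensorSum_tensorSum, tensorSum_tmul, mul_tensorSum,
    tensorSum_coassoc_one, tensorSum_mul]
  rw [tensorSum_comm]
  refine tensorSum_congr fun b₁ s => ?_
  rw [tensorSum_comm]
  simp only [mul_assoc]

end Action

/-! ### Relations between the two actions -/

section Action

variable {K B : Type*} [Field K] [Ring B] [HopfAlgebra K B]

local notation "Δ" => Coalgebra.comul (R := K)
local notation "ε" => Coalgebra.counit (R := K)

variable {φ : Module.Dual K B} {S : B ≃ₗ[K] B} (h : IsRationalDual φ)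
  (hS : (S : B →ₗ[K] B) = HopfAlgebra.antipode K)

theorem heisenbergOp_tmul_one (a : DualAlg φ) (x : B) :
    heisenbergOp φ (a ⊗ₜ[K] (1 : B)) x = tensorSum (fun x₁ x₂ => a x₁ • x₂) (Δ x) := by
  simp only [heisenbergOp_apply, evalAB_tmul, mul_smul_comm, mul_one]

theorem heisenbergOp_smulLeftA (a : DualAlg φ) (z : DualAlg φ ⊗[K] B) (x : B) :
    heisenbergOp φ (smulLeftA h a z) x =
      tensorSum (fun x₁ x₂ => a x₁ • heisenbergOp φ z x₂) (Δ x) := by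
  simp (disch := fun_prop) only [heisenbergOp_apply, evalAB_smulLeftA, mul_tensorSum,
    mul_smul_comm, smul_tensorSum, tensorSum_coassoc]

include hS

theorem dualAct_mul (a a' : DualAlg φ) (z : DualAlg φ ⊗[K] B) :
    dualAct h S (pairing φ (h.realization.mul a a')) z =
      dualAct h S (pairing φ a) (dualAct h S (pairing φ a') z) := by
  apply heisenbergOp_injective hS
  ext x
  simp (disch := fun_prop) only [heisenbergOp_dualAct h hS, h.realization_mul_apply, comul_mul_eq,
    comul_antipodeEquiv_symm hS, LinearMap.map_tensorSum, map_smul, tensorSum_smul_arg,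
    tensorSum_tensorSum, tensorSum_tmul, tensorSum_smul, tensorSum_coassoc, smul_tensorSum]
  rw [tensorSum_coassoc_two (by fun_prop) (by fun_prop) (by intros; fun_prop)]
  refine tensorSum_congr fun x₁ s => tensorSum_congr fun x₂ x₃ => tensorSum_congr fun w₁ s =>
    tensorSum_congr fun w₂ w₃ => ?_
  rw [mul_comm, mul_smul]

theorem dualAct_counit (z : DualAlg φ ⊗[K] B) : dualAct h S ε z = z := by
  apply heisenbergOp_injective hS
  ext x
  simp (disch := fun_prop) only [heisenbergOp_dualAct h hS, Bialgebra.counit_mul,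
    counit_antipodeEquiv_symm hS]
  have e : ∀ x₁ x₂ : B, tensorSum (fun w₁ w₂ => (ε w₁ * ε x₁) • w₂)
      (Δ (heisenbergOp φ z x₂)) = ε x₁ • heisenbergOp φ z x₂ := by
    intro x₁ x₂
    simp only [mul_smul, smul_comm _ (ε x₁), ← smul_tensorSum]
    rw [tensorSum_counit_left (K := K) (f := fun y : B => y) (by fun_prop)]
  simp only [e]
  exact tensorSum_counit_left (by fun_prop) x

theorem adjAct_mul (b c : B) (z : DualAlg φ ⊗[K] B) :
    adjAct h S (b * c) z = adjAct h S b (adjAct h S c z) := by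
  apply heisenbergOp_injective hS
  ext x
  simp (disch := fun_prop) only [heisenbergOp_adjAct h, comul_mul_eq,
    tensorSum_mul, tensorSum_tensorSum, tensorSum_tmul, antipodeEquiv_mul hS, mul_assoc]

theorem adjAct_one (z : DualAlg φ ⊗[K] B) :
    adjAct h S 1 z = z := by
  apply heisenbergOp_injective hS
  ext x
  simp (disch := fun_prop) only [heisenbergOp_adjAct h, comul_one_eq,
    tensorSum_tmul, antipodeEquiv_one hS, mul_one]

/-- The relation between the actions of `A` and `B` is the commutation relation of the Drinfel'd
double. -/
theorem adjAct_dualAct (b : B) (a : DualAlg φ) (z : DualAlg φ ⊗[K] B) :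
    adjAct h S b (dualAct h S (pairing φ a) z) = tensorSum (fun b₁ s => tensorSum (fun b₂ b₃ =>
      dualAct h S (pairing φ (h.bimodule (S.symm b₃) b₁ a)) (adjAct h S b₂ z)) (Δ s)) (Δ b) := by
  apply heisenbergOp_injective hS
  ext x
  simp (disch := fun_prop) only [heisenbergOp_adjAct h, heisenbergOp_dualAct h hS, comul_mul_eq,
    LinearMap.map_tensorSum, _root_.tensorSum_apply, h.bimodule_apply, tensorSum_tensorSum,
    tensorSum_tmul,
    comul_antipodeEquiv hS, antipodeEquiv_symm_mul hS, LinearEquiv.symm_apply_apply,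
    tensorSum_coassoc_one, tensorSum_coassoc_two, tensorSum_mul]
  refine tensorSum_congr fun b₁ s => ?_
  simp only [tensorSum_comm (w := Δ x)]
  refine tensorSum_congr fun x₁ x₂ => ?_
  refine tensorSum_congr fun b₂ t => ?_
  simp only [tensorSum_comm (w := Δ (heisenbergOp φ z (x₂ * b₂)))]
  refine tensorSum_congr fun w₁ w₂ => ?_
  refine .trans ?_ ((isCounital_antipodeEquiv_symm_mul hS).sum_right
    (fun p q => pairing φ a (q * (S.symm w₁ * (x₁ * b₁))) • (w₂ * S p))
    (by fun_prop) (by fun_prop) (fun _ _ _ => by simp only [mul_assoc]) t).symm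
  simp only [one_mul, smul_mul_assoc]

/-- The Heisenberg double is a module algebra over `B`. -/
theorem adjAct_heisenbergDouble_mul (b : B) (u v : DualAlg φ ⊗[K] B) :
    adjAct h S b ((heisenbergDouble h).mul u v) = tensorSum (fun b₁ b₂ =>
      (heisenbergDouble h).mul (adjAct h S b₁ u) (adjAct h S b₂ v)) (Δ b) := by
  apply heisenbergOp_injective hS
  ext x
  simp (disch := fun_prop) only [heisenbergOp_adjAct h, heisenbergOp_mul h,
    LinearMap.map_tensorSum, tensorSum_apply, tensorSum_mul,
    tensorSum_coassoc_one]
  refine tensorSum_congr fun b₁ s => ?_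
  refine .trans ?_ ((isCounital_antipodeEquiv_mul hS).sum_left
      (fun p q => heisenbergOp φ v (heisenbergOp φ u (x * b₁) * p) * S q)
      (by fun_prop) (by fun_prop) (fun _ _ _ => by simp only [mul_assoc]) s).symm
  rw [mul_one]

/-- `∑ (q · X)(p · Y) = a · ((a' · X) Y)` for `∑ p ⊗ q = a₍₁₎ ⊗ a₍₂₎ a'`: the Heisenberg double is a
module algebra over `A` with the opposite coproduct. -/
theorem dualAct_heisenbergDouble_mul (a a' : DualAlg φ) (u v : DualAlg φ ⊗[K] B) :
    tensorSum (fun (p q : DualAlg φ) => (heisenbergDouble h).mul (dualAct h S (pairing φ q) u)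
      (dualAct h S (pairing φ p) v)) ((h.hopfRealization hS).T₁ (a ⊗ₜ[K] a')) =
    dualAct h S (pairing φ a) ((heisenbergDouble h).mul (dualAct h S (pairing φ a') u) v) := by
  apply heisenbergOp_injective hS
  ext x
  have key : ∀ z, tensorSum (fun (p q : DualAlg φ) =>
      heisenbergOp φ ((heisenbergDouble h).mul (dualAct h S (pairing φ q) u)
        (dualAct h S (pairing φ p) v)) x) z =
      tensorSum (fun x₁ x₂ => tensorSum (fun w₁ s => tensorSum (fun w₂ w₃ =>
        tensorSum (fun z₁ z₂ => evalAA φ z ((S.symm z₁ * w₂) ⊗ₜ[K] (S.symm w₁ * x₁)) • z₂)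
          (Δ (heisenbergOp φ v w₃))) (Δ s)) (Δ (heisenbergOp φ u x₂))) (Δ x) := by
    refine eq_of_tmul (by fun_prop) (by fun_prop) fun p q => ?_
    simp (disch := fun_prop) only [tensorSum_tmul, heisenbergOp_mul h, heisenbergOp_dualAct h hS,
      LinearMap.map_tensorSum, map_smul, smul_tensorSum, evalAA_tmul, tensorSum_smul_arg,
      tensorSum_tensorSum]
    simp only [mul_smul, smul_comm (pairing φ p _)]
  simp only [LinearMap.map_tensorSum, tensorSum_apply, key]
  change tensorSum (fun x₁ x₂ => tensorSum (fun w₁ s => tensorSum (fun w₂ w₃ =>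
    tensorSum (fun z₁ z₂ => evalAA φ (transposeAA _ h.exists_galois₁ _) _ • z₂) _) _) _) _ = _
  simp (disch := fun_prop) only [evalAA_transposeAA, galois₁_tmul, LinearMap.map_tensorSum,
    comul_mul_eq, comul_antipodeEquiv_symm hS, tensorSum_tensorSum, tensorSum_tmul, evalAA_tmul,
    heisenbergOp_mul h, heisenbergOp_dualAct h hS, map_smul, tensorSum_smul_arg, tensorSum_smul,
    tensorSum_coassoc_two]
  refine .trans (b := tensorSum (fun x₁ s => tensorSum (fun x₂ x₃ => tensorSum (fun w₁ w₂ =>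
    tensorSum (fun z₁ z₂ =>
      (pairing φ a (S.symm z₁ * x₁) * pairing φ a' (S.symm w₁ * x₂)) • z₂)
      (Δ (heisenbergOp φ v w₂))) (Δ (heisenbergOp φ u x₃))) (Δ s)) (Δ x)) ?_ ?_
  · rw [← tensorSum_coassoc (by fun_prop) (by fun_prop) (by fun_prop)]
    refine tensorSum_congr fun x₁ x₂ => ?_
    simp only [tensorSum_comm (w := Δ x₁)]
    refine tensorSum_congr fun x₁ x₁' => tensorSum_congr fun w₁ s => ?_
    refine .trans ((isCounital_mul_antipodeEquiv_symm hS).sum_left (fun p q =>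
      tensorSum (fun z₁ z₂ => (pairing φ a (S.symm z₁ * p * x₁) *
        pairing φ a' (S.symm w₁ * x₁')) • z₂) (Δ (heisenbergOp φ v q)))
      (by fun_prop) (by fun_prop) (fun _ _ _ => by simp only [mul_assoc]) s) ?_
    simp only [mul_one]
  · simp only [smul_tensorSum, mul_smul, smul_comm (pairing φ a _)]

/-- `∑ (q · X) p = a (a' · X)` in the Heisenberg double, for `∑ p ⊗ q = a₍₁₎ ⊗ a₍₂₎ a'`; this is
braided commutativity for the factor `a ∈ A`. -/
theorem heisenbergDouble_mul_dualAct (a a' : DualAlg φ) (u : DualAlg φ ⊗[K] B) :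
    tensorSum (fun (p q : DualAlg φ) => (heisenbergDouble h).mul (dualAct h S (pairing φ q) u)
      (p ⊗ₜ[K] 1)) ((h.hopfRealization hS).T₁ (a ⊗ₜ[K] a')) =
    smulLeftA h a (dualAct h S (pairing φ a') u) := by
  apply heisenbergOp_injective hS
  ext x
  have key : ∀ z, tensorSum (fun (p q : DualAlg φ) =>
      heisenbergOp φ ((heisenbergDouble h).mul (dualAct h S (pairing φ q) u)
        (p ⊗ₜ[K] 1)) x) z =
      tensorSum (fun x₁ x₂ => tensorSum (fun w₁ s => tensorSum (fun w₂ w₃ =>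
        evalAA φ z (w₂ ⊗ₜ[K] (S.symm w₁ * x₁)) • w₃)
          (Δ s)) (Δ (heisenbergOp φ u x₂))) (Δ x) := by
    refine eq_of_tmul (by fun_prop) (by fun_prop) fun p q => ?_
    simp (disch := fun_prop) only [tensorSum_tmul, heisenbergOp_mul h, heisenbergOp_dualAct h hS,
      LinearMap.map_tensorSum, map_smul, smul_tensorSum, evalAA_tmul, heisenbergOp_tmul_one]
    simp only [mul_smul, smul_comm (pairing φ p _)]
  simp only [LinearMap.map_tensorSum, tensorSum_apply, key]
  change tensorSum (fun x₁ x₂ => tensorSum (fun w₁ s => tensorSum (fun w₂ w₃ =>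
    evalAA φ (transposeAA _ h.exists_galois₁ _) _ • w₃) _) _) _ = _
  simp (disch := fun_prop) only [evalAA_transposeAA, galois₁_tmul, LinearMap.map_tensorSum,
    comul_mul_eq, comul_antipodeEquiv_symm hS, tensorSum_tensorSum, tensorSum_tmul, evalAA_tmul,
    heisenbergOp_smulLeftA h, heisenbergOp_dualAct h hS, tensorSum_smul,
    tensorSum_coassoc_one, smul_tensorSum]
  rw [← tensorSum_coassoc (by fun_prop) (by fun_prop) (by fun_prop)]
  refine tensorSum_congr fun x₁ x₂ => ?_
  simp only [tensorSum_comm (w := Δ x₁)]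
  refine tensorSum_congr fun x₁ x₁' => tensorSum_congr fun w₁ s => ?_
  refine .trans ((isCounital_mul_antipodeEquiv_symm hS).sum_left (fun p q =>
      (pairing φ a (p * x₁) * pairing φ a' (S.symm w₁ * x₁')) • q)
      (by fun_prop) (by fun_prop) (fun _ _ _ => by simp only [mul_assoc]) s) ?_
  rw [one_mul, mul_smul]

end Action

/-! ### The coaction -/

section Regular

variable {K C R V : Type*} [Field K] [AddCommGroup C] [Module K C] [Coalgebra K C]
  [Ring R] [Algebra K R] [AddCommGroup V] [Module K V] {E : Entwining K C R}

namespace Entwining.HopfRealization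

variable (ρ : HopfRealization E V)

/-- The comultiplication of `V` as a left coaction of `V` on itself: `(d ⊗ 1)Δ(v)`. -/
def coactRight : V →ₗ[K] V →ₗ[K] V ⊗[K] V := (TensorProduct.mk K V V).flip.compr₂ ρ.T₂

/-- The comultiplication of `V` as a left coaction of `V` on itself: `Δ(v)(d ⊗ 1)`. -/
def coactLeft : V →ₗ[K] V →ₗ[K] V ⊗[K] V := (TensorProduct.mk K V V).compr₂ ρ.T₃

theorem coactRight_apply (v d : V) : ρ.coactRight v d = ρ.T₂ (d ⊗ₜ[K] v) := rfl

theorem coactLeft_apply (v d : V) : ρ.coactLeft v d = ρ.T₃ (v ⊗ₜ[K] d) := rfl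

theorem coact_compat (v d e : V) : (ρ.mul d).rTensor V (ρ.coactLeft v e) =
    (ρ.mul.flip e).rTensor V (ρ.coactRight v d) := by
  apply ρ.j₂_injective
  rw [ρ.j₂_rTensor_mul, ρ.j₂_rTensor_mul_flip, coactLeft_apply, coactRight_apply, ρ.j₂_T₃,
    ρ.j₂_T₂, mul_assoc]

/-- If `Γ(v) = Γ(w)` then `T₂((v - w) ⊗ (v - w)) = 0`, hence `(v - w) ⊗ (v - w) = 0`. -/
theorem coact_injective : Function.Injective fun v => (ρ.coactLeft v, ρ.coactRight v) := by
  intro v w h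
  have h₂ : ρ.coactRight v = ρ.coactRight w := congr_arg Prod.snd h
  have h₀ : ρ.coactRight (v - w) (v - w) = 0 := by
    rw [map_sub ρ.coactRight, h₂, sub_self, LinearMap.zero_apply]
  rw [coactRight_apply, map_eq_zero_iff _ ρ.T₂_bijective.1] at h₀
  refine sub_eq_zero.1 ((Module.forall_dual_apply_eq_zero_iff K _).1 fun f => ?_)
  have h₃ := congr_arg (TensorProduct.dualDistrib K V V (f ⊗ₜ[K] f)) h₀
  rw [TensorProduct.dualDistrib_apply, map_zero] at h₃
  exact mul_self_eq_zero.1 h₃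

/-- Both sides, as functions, are `(d ⊗ 1 ⊗ 1)(Δ ⊗ ι)((e ⊗ 1)Δ(v))`. -/
theorem coact_coassoc (d e v : V) :
    TensorProduct.assoc K V V V
        ((ρ.T₂ ∘ₗ TensorProduct.mk K V V d).rTensor V (ρ.coactRight v e)) =
      (TensorProduct.lift ρ.coactRight).lTensor V
        (TensorProduct.assoc K V V V ((ρ.coactRight v).rTensor V (ρ.T₂ (d ⊗ₜ[K] e)))) := by
  refine Conv.mapTensor_injective ρ.injective ρ.j₂_injective ?_
  change ρ.j₃ _ = ρ.j₃ _
  have h₁ : ∀ (q : V) (w : V ⊗[K] V), ρ.j₃ ((TensorProduct.lift ρ.coactRight).lTensor V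
      (TensorProduct.assoc K V V V (w ⊗ₜ[K] q))) =
      Conv.tmul 1 (Conv.tmul (ρ.j q) 1) * ((Hom.id E).tensor ρ.comul).map (ρ.j₂ w) := by
    intro q
    refine eq_of_tmul (by fun_prop) (by fun_prop) fun p v => ?_
    simp only [TensorProduct.assoc_tmul, LinearMap.lTensor_tmul, TensorProduct.lift.tmul,
      coactRight_apply, j₃, Conv.mapTensor_tmul, ρ.j₂_T₂, ρ.j₂_tmul, Hom.tensor_map_tmul,
      Hom.id_map, Conv.tmul_mul_tmul, one_mul]
  have h₂ : ∀ z : V ⊗[K] V, ρ.j₃ ((TensorProduct.lift ρ.coactRight).lTensor V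
        (TensorProduct.assoc K V V V ((ρ.coactRight v).rTensor V z))) =
      (Hom.assoc E E E).map (Conv.tmul (ρ.j₂ z) 1) *
        ((Hom.id E).tensor ρ.comul).map (ρ.comul.map (ρ.j v)) := by
    refine eq_of_tmul (by fun_prop) (by fun_prop) fun p q => ?_
    rw [LinearMap.rTensor_tmul, h₁, coactRight_apply, ρ.j₂_T₂, ρ.j₂_tmul, map_mul,
      Hom.tensor_map_tmul, Hom.id_map, Hom.assoc_map_tmul, ← mul_assoc,
      Conv.tmul_mul_tmul, one_mul, map_one ρ.comul.map, mul_one]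
  have h₃ : Conv.tmul (ρ.j d) (1 : (E.tensor E).Conv) =
      (Hom.assoc E E E).map (Conv.tmul (Conv.tmul (ρ.j d) 1) 1) := by
    rw [Hom.assoc_map_tmul, Conv.tmul_one_one]
  rw [j₃_assoc_rTensor, coactRight_apply, ρ.j₂_T₂, h₂, ρ.j₂_T₂, ← ρ.coassoc]
  simp only [map_mul, Hom.tensor_map_tmul, map_one, h₃, ← mul_assoc]
  simp only [← map_mul, Conv.tmul_mul_tmul, mul_one]

end Entwining.HopfRealization

end Regular

section Coaction

variable {K B : Type*} [Field K] [Ring B] [HopfAlgebra K B]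

local notation "Δ" => Coalgebra.comul (R := K)
local notation "ε" => Coalgebra.counit (R := K)

variable {φ : Module.Dual K B} {S : B ≃ₗ[K] B} (h : IsRationalDual φ)
  (hS : (S : B →ₗ[K] B) = HopfAlgebra.antipode K)

/-- `D ⊗ H` as a space of functions `B ⊗ B → B ⊗ B`. -/
def evalConvDH (φ : Module.Dual K B) :
    (DualAlg φ ⊗[K] B) ⊗[K] (DualAlg φ ⊗[K] B) →ₗ[K]
      ((drinfeldEntwining hS).tensor (heisenbergEntwining K B)).Conv :=
  Conv.mapTensor (evalConv φ (drinfeldEntwining hS)) (evalConv φ (heisenbergEntwining K B))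

theorem evalConvDH_tmul (u v : DualAlg φ ⊗[K] B) : evalConvDH hS φ (u ⊗ₜ[K] v) =
    Conv.tmul (evalConv φ (drinfeldEntwining hS) u) (evalConv φ (heisenbergEntwining K B) v) :=
  Conv.mapTensor_tmul ..

theorem evalConvDH_injective : Function.Injective (evalConvDH hS φ) :=
  Conv.mapTensor_injective evalConv_injective evalConv_injective

/-- `(d ⊗ 1)Γ(v)` is `T₂` of the Drinfel'd double: a left factor `d ⊗ 1` involves the entwining of
the first tensor factor only, and `Γ` and `Δ` are given by the same formula on functions. -/
theorem evalConvDH_drinfeldT₂ (d v : DualAlg φ ⊗[K] B) :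
    evalConvDH hS φ (drinfeldT₂ h hS (d ⊗ₜ[K] v)) =
      Conv.tmul (evalConv φ _ d) 1 * (heisenbergCoact hS).map (evalConv φ _ v) := by
  apply Conv.ext_tmul; intro x y
  have e := DFunLike.congr_fun (j₂_drinfeldT₂ h hS d v) (x ⊗ₜ[K] y)
  rw [Realization.j₂, drinfeldRealization_j, mapTensor_evalConv_apply, Conv.tmul_one_mul_apply] at e
  rw [evalConvDH, mapTensor_evalConv_apply, Conv.tmul_one_mul_apply, e]
  simp only [Hom.map_apply, evalConv_apply]
  rfl

/-- `Γ(v)(d ⊗ 1)` is `T₃` of the Drinfel'd double. -/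
theorem evalConvDH_drinfeldT₃ (d v : DualAlg φ ⊗[K] B) :
    evalConvDH hS φ (drinfeldT₃ h hS (v ⊗ₜ[K] d)) =
      (heisenbergCoact hS).map (evalConv φ _ v) * Conv.tmul (evalConv φ _ d) 1 := by
  apply Conv.ext_tmul; intro x y
  have e := DFunLike.congr_fun (j₂_drinfeldT₃ h hS v d) (x ⊗ₜ[K] y)
  rw [Realization.j₂, drinfeldRealization_j, mapTensor_evalConv_apply, Conv.mul_tmul_one_apply] at e
  rw [evalConvDH, mapTensor_evalConv_apply, Conv.mul_tmul_one_apply, e]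
  simp only [Hom.map_apply, evalConv_apply]
  rfl

theorem drinfeld_coactRight_apply (v d : DualAlg φ ⊗[K] B) :
    (drinfeldHopfRealization h hS).coactRight v d = drinfeldT₂ h hS (d ⊗ₜ[K] v) := rfl

theorem drinfeld_coactLeft_apply (v d : DualAlg φ ⊗[K] B) :
    (drinfeldHopfRealization h hS).coactLeft v d = drinfeldT₃ h hS (v ⊗ₜ[K] d) := rfl

/-- `Γ(x y) = Γ(x)Γ(y)`, multiplied from the left by `d ⊗ 1`: on functions `Γ` is an algebra
homomorphism. -/
theorem drinfeldT₂_heisenberg_mul (d x y : DualAlg φ ⊗[K] B) :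
    drinfeldT₂ h hS (d ⊗ₜ[K] (heisenbergDouble h).mul x y) =
      (TensorProduct.lift (heisenbergDouble h).mul.flip).lTensor _
        (TensorProduct.assoc K _ _ _ (((drinfeldHopfRealization h hS).coactRight y).rTensor _
          (drinfeldT₂ h hS (d ⊗ₜ[K] x)))) := by
  apply evalConvDH_injective hS
  have h₁ : ∀ (q : DualAlg φ ⊗[K] B) (w : (DualAlg φ ⊗[K] B) ⊗[K] (DualAlg φ ⊗[K] B)),
      evalConvDH hS φ ((TensorProduct.lift (heisenbergDouble h).mul.flip).lTensor _
        (TensorProduct.assoc K _ _ _ (w ⊗ₜ[K] q))) =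
      Conv.tmul 1 (evalConv φ (heisenbergEntwining K B) q) * evalConvDH hS φ w := by
    intro q
    refine eq_of_tmul (by fun_prop) (by fun_prop) fun p v => ?_
    simp only [TensorProduct.assoc_tmul, LinearMap.lTensor_tmul, TensorProduct.lift.tmul,
      evalConvDH_tmul, LinearMap.flip_apply, evalConv_heisenbergDouble_mul, Conv.tmul_mul_tmul,
      one_mul]
  have h₂ : ∀ z : (DualAlg φ ⊗[K] B) ⊗[K] (DualAlg φ ⊗[K] B),
      evalConvDH hS φ ((TensorProduct.lift (heisenbergDouble h).mul.flip).lTensor _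
        (TensorProduct.assoc K _ _ _ (((drinfeldHopfRealization h hS).coactRight y).rTensor _ z))) =
      evalConvDH hS φ z * (heisenbergCoact hS).map (evalConv φ _ y) := by
    refine eq_of_tmul (by fun_prop) (by fun_prop) fun p q => ?_
    rw [LinearMap.rTensor_tmul, h₁, drinfeld_coactRight_apply, evalConvDH_drinfeldT₂,
      evalConvDH_tmul, ← mul_assoc, Conv.tmul_mul_tmul, one_mul, mul_one]
  rw [h₂, evalConvDH_drinfeldT₂, evalConvDH_drinfeldT₂, evalConv_heisenbergDouble_mul, map_mul,
    mul_assoc]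

theorem isHeisenbergCoaction_drinfeldT₂ :
    IsHeisenbergCoaction S φ (drinfeldHopfRealization h hS).coactRight := by
  intro a a' b b' x y
  rw [← mapTensor_evalConv_apply (drinfeldEntwining hS) (drinfeldEntwining hS)]
  refine (DFunLike.congr_fun (j₂_drinfeldT₂ h hS (a' ⊗ₜ[K] b') (a ⊗ₜ[K] b)) (x ⊗ₜ[K] y)).trans ?_
  rw [Conv.tmul_one_mul_apply]
  simp (disch := fun_prop) only [sweedler₂_eq_tensorSum, sweedler₃_eq_tensorSum,
    drinfeldRealization_j, evalConv_tmul_apply, map_smul, LinearMap.smul_apply, Hom.map_apply,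
    drinfeldComul, mulOp_tmul, Bialgebra.comulAlgHom_apply,
    tensorSum_smul_arg, sum_drinfeldEntwining, smul_tensorSum, mul_smul_comm, mul_smul]
  have e : ∀ u : B, (u ⊗ₜ[K] 1) * Δ b = tensorSum (fun b₁ b₂ => (u * b₁) ⊗ₜ[K] b₂) (Δ b) := by
    intro u
    conv_lhs => rw [← tensorSum_tmul_self (Δ b), mul_tensorSum]
    simp only [Algebra.TensorProduct.tmul_mul_tmul, one_mul]
  simp only [e, smul_tensorSum]

end Coaction

/-! ### The module algebra structure -/

section Action

variable {K B : Type*} [Field K] [Ring B] [HopfAlgebra K B]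

local notation "Δ" => Coalgebra.comul (R := K)
local notation "ε" => Coalgebra.counit (R := K)

variable {φ : Module.Dual K B} {S : B ≃ₗ[K] B} (h : IsRationalDual φ)
  (hS : (S : B →ₗ[K] B) = HopfAlgebra.antipode K)

/-- The action `(a ⊗ b) · X = a · (b · X)` of the Drinfel'd double on the Heisenberg double. -/
def heisenbergAct (S : B ≃ₗ[K] B) :
    DualAlg φ ⊗[K] B →ₗ[K] DualAlg φ ⊗[K] B →ₗ[K] DualAlg φ ⊗[K] B :=
  bilin (fun d z => tensorSum (fun a b => dualAct h S (pairing φ a) (adjAct h S b z)) d)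
    (by fun_prop) (by fun_prop)

theorem heisenbergAct_tmul (a : DualAlg φ) (b : B) (z : DualAlg φ ⊗[K] B) :
    heisenbergAct h S (a ⊗ₜ[K] b) z = dualAct h S (pairing φ a) (adjAct h S b z) := by
  simp (disch := fun_prop) only [heisenbergAct, bilin_apply, tensorSum_tmul]

theorem drinfeldDouble_mul_tmul (a : DualAlg φ) (b : B) (e : DualAlg φ ⊗[K] B) :
    (drinfeldDouble h hS).mul (a ⊗ₜ[K] b) e = smulLeftA h a (smulLeftB h S b e) := by
  apply (drinfeldRealization h hS).injective
  refine ((drinfeldRealization h hS).j_mul _ _).trans ?_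
  rw [drinfeldRealization_j, evalConv_smulLeftA, evalConv_smulLeftB, evalConv_tmul, mul_assoc]

include hS in
theorem heisenbergAct_smulLeftA (a : DualAlg φ) (d z : DualAlg φ ⊗[K] B) :
    heisenbergAct h S (smulLeftA h a d) z = dualAct h S (pairing φ a) (heisenbergAct h S d z) := by
  revert d
  refine eq_of_tmul (by fun_prop) (by fun_prop) fun a' b => ?_
  rw [heisenbergAct_tmul, ← dualAct_mul h hS, ← heisenbergAct_tmul]
  rfl

include hS in
theorem heisenbergAct_smulLeftB (b : B) (d z : DualAlg φ ⊗[K] B) :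
    heisenbergAct h S (smulLeftB h S b d) z = adjAct h S b (heisenbergAct h S d z) := by
  revert d
  refine eq_of_tmul (by fun_prop) (by fun_prop) fun a c => ?_
  rw [heisenbergAct_tmul, adjAct_dualAct h hS, smulLeftB_tmul]
  have e : ∀ u v, heisenbergAct h S (smulRightB φ c (u ⊗ₜ[K] v)) z =
      dualAct h S (pairing φ u) (adjAct h S v (adjAct h S c z)) := by
    intro u v
    rw [← adjAct_mul h hS, ← heisenbergAct_tmul]
    rfl
  simp (disch := fun_prop) only [crossMul, LinearMap.map_tensorSum, _root_.tensorSum_apply, e,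
    TensorProduct.lift.tmul, bilin_apply]

theorem heisenbergAct_mul_act (d e z : DualAlg φ ⊗[K] B) :
    heisenbergAct h S ((drinfeldDouble h hS).mul d e) z =
      heisenbergAct h S d (heisenbergAct h S e z) := by
  revert d
  refine eq_of_tmul (by fun_prop) (by fun_prop) fun a b => ?_
  rw [drinfeldDouble_mul_tmul, heisenbergAct_smulLeftA h hS, heisenbergAct_smulLeftB h hS,
    heisenbergAct_tmul]

include hS in
/-- A functional that vanishes on `D · H` is zero: it vanishes on `a · X` for all `a ∈ A`, hence,
the action being rational, on `f · X` for all functionals `f`, in particular on `ε · X = X`. -/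
theorem heisenbergAct_surjective :
    Function.Surjective (TensorProduct.lift (heisenbergAct (φ := φ) h S)) := by
  rw [← LinearMap.range_eq_top]
  refine Submodule.eq_top_of_forall_dual _ fun f hf => ?_
  refine LinearMap.ext fun z => ?_
  obtain ⟨t, ht⟩ := exists_dualAct (S := S) h z
  have e : ∀ g : Module.Dual K B,
      f (dualAct h S g z) = g (tensorSum (fun w u => f w • u) t) := by
    intro g
    simp only [ht, LinearMap.map_tensorSum, map_smul, smul_eq_mul, mul_comm]
  have h₀ : tensorSum (fun w u => f w • u) t = 0 := by
    refine h.eq_zero _ fun a => ?_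
    rw [← e, ← adjAct_one h hS z, ← heisenbergAct_tmul]
    exact hf _ ⟨(a ⊗ₜ[K] 1) ⊗ₜ[K] z, rfl⟩
  rw [← dualAct_counit h hS z, e, h₀, map_zero, LinearMap.zero_apply]

theorem isHeisenbergAction_heisenbergAct : IsHeisenbergAction S φ (heisenbergAct h S) := by
  intro a a' b b' x
  rw [heisenbergAct_tmul, evalAB_dualAct, dualActHom_apply]
  simp (disch := fun_prop) only [sweedler₂_eq_tensorSum, sweedler₃_eq_tensorSum, evalAB_adjAct,
    evalAB_tmul, map_smul, tensorSum_smul_arg, mul_smul_comm, smul_mul_assoc,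
    LinearMap.map_tensorSum, tensorSum_tensorSum]
  simp only [smul_tensorSum, mul_comm (pairing φ a _), mul_smul]

/-- `d · (X Y) = (d₍₁₎ · X)(d₍₂₎ · Y)`, with `e · x` in place of `X`. -/
theorem heisenbergAct_mul (d e x y : DualAlg φ ⊗[K] B) :
    heisenbergAct h S d ((heisenbergDouble h).mul (heisenbergAct h S e x) y) =
      TensorProduct.lift ((heisenbergDouble h).mul.compl₁₂ ((heisenbergAct h S).flip x)
        ((heisenbergAct h S).flip y)) (drinfeldT₃ h hS (d ⊗ₜ[K] e)) := by
  revert d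
  refine eq_of_tmul (by fun_prop) (by fun_prop) fun a b => ?_
  have key : ∀ (b₂ : B) (e : DualAlg φ ⊗[K] B),
      TensorProduct.lift ((heisenbergDouble h).mul.compl₁₂ ((heisenbergAct h S).flip x)
        ((heisenbergAct h S).flip y)) (TensorProduct.comm K _ _ (mapFst (LinearEquiv.ofBijective _
        (h.hopfRealization hS).T₁_bijective) ((a ⊗ₜ[K] b₂) ⊗ₜ[K] e))) =
      dualAct h S (pairing φ a) ((heisenbergDouble h).mul (heisenbergAct h S e x)
        (adjAct h S b₂ y)) := by
    intro b₂
    refine eq_of_tmul (by fun_prop) (by fun_prop) fun a' b' => ?_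
    rw [heisenbergAct_tmul, ← dualAct_heisenbergDouble_mul h hS]
    simp only [mapFst_tmul, LinearEquiv.map_tensorSum, LinearMap.map_tensorSum,
      TensorProduct.comm_tmul, TensorProduct.lift.tmul, LinearMap.compl₁₂_apply,
      LinearMap.flip_apply, heisenbergAct_tmul, LinearEquiv.ofBijective_apply]
  simp only [drinfeldT₃_tmul, LinearMap.map_tensorSum, key, heisenbergAct_smulLeftB h hS,
    heisenbergAct_tmul, adjAct_heisenbergDouble_mul h hS]

end Action

/-! ### Braided commutativity and the Yetter–Drinfel'd condition -/

section YetterDrinfeld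

variable {K B : Type*} [Field K] [Ring B] [HopfAlgebra K B]

local notation "Δ" => Coalgebra.comul (R := K)
local notation "ε" => Coalgebra.counit (R := K)

variable {φ : Module.Dual K B} {S : B ≃ₗ[K] B} (h : IsRationalDual φ)
  (hS : (S : B →ₗ[K] B) = HopfAlgebra.antipode K)

theorem heisenbergDouble_mul_tmul (a : DualAlg φ) (b : B) (z : DualAlg φ ⊗[K] B) :
    (heisenbergDouble h).mul (a ⊗ₜ[K] b) z = smulLeftA h a (heisenbergSmulLeftB h b z) := by
  apply evalConv_injective (E := heisenbergEntwining K B)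
  rw [evalConv_heisenbergDouble_mul, evalConv_smulLeftA, evalConv_heisenbergSmulLeftB,
    evalConv_tmul, mul_assoc]

theorem heisenbergDouble_mul_smulRightB (u v : DualAlg φ ⊗[K] B) (b : B) :
    (heisenbergDouble h).mul u (smulRightB φ b v) =
      smulRightB φ b ((heisenbergDouble h).mul u v) := by
  apply evalConv_injective (E := heisenbergEntwining K B)
  simp only [evalConv_heisenbergDouble_mul, evalConv_smulRightB, mul_assoc]

include hS in
/-- `∑ a (b₍₁₎ · X) b₍₂₎ = (a b) X`, since `∑ b₍₁₎ X S(b₍₂₎) b₍₃₎ = b X`. -/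
theorem smulRightB_smulLeftA_adjAct (a : DualAlg φ) (b : B) (z : DualAlg φ ⊗[K] B) :
    tensorSum (fun b₁ b₂ => smulRightB φ b₂ (smulLeftA h a (adjAct h S b₁ z))) (Δ b) =
      (heisenbergDouble h).mul (a ⊗ₜ[K] b) z := by
  rw [heisenbergDouble_mul_tmul]
  apply evalConv_injective (E := heisenbergEntwining K B)
  simp (disch := fun_prop) only [LinearMap.map_tensorSum, evalConv_smulRightB, evalConv_smulLeftA,
    adjAct_eq, evalConv_heisenbergSmulLeftB, tensorSum_coassoc]
  refine .trans ((isCounital_antipodeEquiv_mul hS).sum_right (fun b₁ p =>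
    scalarConv _ (pairing φ a) * (constConv _ b₁ * evalConv φ (heisenbergEntwining K B) z *
      constConv _ p)) (by fun_prop) (by fun_prop)
    (fun _ _ _ => by simp only [mul_assoc, constConv_mul]) b) ?_
  rw [constConv_one, mul_one]

/-- Braided commutativity `Y X = (Y₍₋₁₎ · X) Y₍₀₎`. -/
theorem heisenberg_braidedCommutative (d x y : DualAlg φ ⊗[K] B) :
    (heisenbergDouble h).mul y (heisenbergAct h S d x) =
      TensorProduct.lift ((heisenbergDouble h).mul ∘ₗ (heisenbergAct h S).flip x)
        (drinfeldT₃ h hS (y ⊗ₜ[K] d)) := by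
  revert y
  refine eq_of_tmul (by fun_prop) (by fun_prop) fun a b => ?_
  have key : ∀ (b₂ : B) (e : DualAlg φ ⊗[K] B),
      TensorProduct.lift ((heisenbergDouble h).mul ∘ₗ (heisenbergAct h S).flip x)
        (TensorProduct.comm K _ _ (mapFst (LinearEquiv.ofBijective _
          (h.hopfRealization hS).T₁_bijective) ((a ⊗ₜ[K] b₂) ⊗ₜ[K] e))) =
      smulRightB φ b₂ (smulLeftA h a (heisenbergAct h S e x)) := by
    intro b₂
    refine eq_of_tmul (by fun_prop) (by fun_prop) fun a' b' => ?_
    rw [heisenbergAct_tmul, ← heisenbergDouble_mul_dualAct h hS]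
    have e : ∀ p : DualAlg φ, p ⊗ₜ[K] b₂ = smulRightB φ b₂ (p ⊗ₜ[K] 1) := by
      intro p
      simp [smulRightB]
    simp only [mapFst_tmul, LinearEquiv.map_tensorSum, LinearMap.map_tensorSum,
      TensorProduct.comm_tmul, TensorProduct.lift.tmul, LinearMap.comp_apply,
      LinearMap.flip_apply, heisenbergAct_tmul, LinearEquiv.ofBijective_apply]
    simp only [e, heisenbergDouble_mul_smulRightB]
  simp only [drinfeldT₃_tmul, LinearMap.map_tensorSum, key, heisenbergAct_smulLeftB h hS]
  exact (smulRightB_smulLeftA_adjAct h hS a b _).symm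

/-- The operator `c ⊗ w ↦ b₍₁₎ c ⊗ b₍₂₎ · w` on `D ⊗ H`. -/
def adjActTensor (S : B ≃ₗ[K] B) (b : B) :
    (DualAlg φ ⊗[K] B) ⊗[K] (DualAlg φ ⊗[K] B) →ₗ[K]
      (DualAlg φ ⊗[K] B) ⊗[K] (DualAlg φ ⊗[K] B) :=
  TensorProduct.lift (bilin (fun c w => tensorSum (fun b₁ b₂ =>
    smulLeftB h S b₁ c ⊗ₜ[K] adjAct h S b₂ w) (Δ b)) (by fun_prop) (by fun_prop))

/-- The operator `c ⊗ w ↦ a₍₂₎ c ⊗ a₍₁₎ · w` on `D ⊗ H`. -/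
def dualActTensor (a : DualAlg φ) :
    (DualAlg φ ⊗[K] B) ⊗[K] (DualAlg φ ⊗[K] B) →ₗ[K]
      (DualAlg φ ⊗[K] B) ⊗[K] (DualAlg φ ⊗[K] B) :=
  TensorProduct.lift (bilin (fun c w => tensorSum (fun a' b' => tensorSum (fun p q =>
    (q ⊗ₜ[K] b') ⊗ₜ[K] dualAct h S (pairing φ p) w)
      ((h.hopfRealization hS).T₁ (a ⊗ₜ[K] a'))) c) (by fun_prop) (by fun_prop))

theorem adjActTensor_tmul (b : B) (c w : DualAlg φ ⊗[K] B) :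
    adjActTensor h S b (c ⊗ₜ[K] w) = tensorSum (fun b₁ b₂ =>
      smulLeftB h S b₁ c ⊗ₜ[K] adjAct h S b₂ w) (Δ b) := by
  simp only [adjActTensor, TensorProduct.lift.tmul, bilin_apply]

theorem dualActTensor_tmul (a a' : DualAlg φ) (b' : B) (w : DualAlg φ ⊗[K] B) :
    dualActTensor h hS a ((a' ⊗ₜ[K] b') ⊗ₜ[K] w) = tensorSum (fun p q =>
    (q ⊗ₜ[K] b') ⊗ₜ[K] dualAct h S (pairing φ p) w)
      ((h.hopfRealization hS).T₁ (a ⊗ₜ[K] a')) := by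
  simp (disch := fun_prop) only [dualActTensor, TensorProduct.lift.tmul, bilin_apply,
    tensorSum_tmul]

/-- `d₍₁₎ c ⊗ d₍₂₎ · w` for `d = a ⊗ b`. -/
theorem lTensor_act_drinfeldT₃ (a : DualAlg φ) (b : B)
    (z : (DualAlg φ ⊗[K] B) ⊗[K] (DualAlg φ ⊗[K] B)) :
    (TensorProduct.lift (heisenbergAct h S)).lTensor _ (TensorProduct.assoc K _ _ _
      (((drinfeldT₃ h hS).toLinearMap ∘ₗ TensorProduct.mk K _ _ (a ⊗ₜ[K] b)).rTensor _ z)) =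
    dualActTensor h hS a (adjActTensor h S b z) := by
  revert z
  refine eq_of_tmul (by fun_prop) (by fun_prop) fun c w => ?_
  have key : ∀ (b₂ : B) (e : DualAlg φ ⊗[K] B),
      (TensorProduct.lift (heisenbergAct h S)).lTensor _ (TensorProduct.assoc K _ _ _
        (TensorProduct.comm K _ _ (mapFst (LinearEquiv.ofBijective _
          (h.hopfRealization hS).T₁_bijective) ((a ⊗ₜ[K] b₂) ⊗ₜ[K] e)) ⊗ₜ[K] w)) =
      dualActTensor h hS a (e ⊗ₜ[K] adjAct h S b₂ w) := by
    intro b₂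
    refine eq_of_tmul (by fun_prop) (by fun_prop) fun a' b' => ?_
    simp only [mapFst_tmul, LinearEquiv.map_tensorSum, LinearMap.map_tensorSum,
      tensorSum_tmul_const, TensorProduct.comm_tmul, TensorProduct.lift.tmul,
      TensorProduct.assoc_tmul, LinearMap.lTensor_tmul, heisenbergAct_tmul, LinearEquiv.ofBijective_apply,
      dualActTensor_tmul]
  simp only [LinearMap.rTensor_tmul, LinearMap.comp_apply, TensorProduct.mk_apply,
    LinearEquiv.coe_coe, drinfeldT₃_tmul, tensorSum_tmul_const, LinearEquiv.map_tensorSum,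
    LinearMap.map_tensorSum, key, adjActTensor_tmul]

theorem heisenbergCoact_map_constConv (b : B) :
    (heisenbergCoact hS).map (constConv _ b) =
      tensorSum (fun b₁ b₂ => Conv.tmul (constConv _ b₁) (constConv _ b₂)) (Δ b) := by
  apply Conv.ext_tmul; intro x y
  rw [Hom.map_apply]
  simp only [heisenbergCoact, mulOp_tmul, constConv_apply, Bialgebra.counit_mul, map_smul,
    Bialgebra.comulAlgHom_apply, Conv.tensorSum_apply, Conv.tmul_apply,
    TensorProduct.smul_tmul_smul, ← smul_tensorSum, tensorSum_tmul_self, mul_comm]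

/-- The operator `adjActTensor` is `Z ↦ ∑ (b₍₁₎ ⊗ b₍₂₎) Z (1 ⊗ S(b₍₃₎))`. -/
theorem evalConvDH_adjActTensor (b : B) (z : (DualAlg φ ⊗[K] B) ⊗[K] (DualAlg φ ⊗[K] B)) :
    evalConvDH hS φ (adjActTensor h S b z) = tensorSum (fun b₁ s => tensorSum (fun b₂ b₃ =>
      Conv.tmul (constConv _ b₁) (constConv _ b₂) * evalConvDH hS φ z *
        Conv.tmul 1 (constConv _ (S b₃))) (Δ s)) (Δ b) := by
  revert z
  refine eq_of_tmul (by fun_prop) (by fun_prop) fun c w => ?_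
  simp (disch := fun_prop) only [adjActTensor_tmul, adjAct_eq, LinearMap.map_tensorSum,
    evalConvDH_tmul, evalConv_smulLeftB, evalConv_smulRightB, evalConv_heisenbergSmulLeftB,
    Conv.tmul_mul_tmul, mul_one, mul_assoc]

/-- The Yetter–Drinfel'd condition for `b ∈ B`. -/
theorem drinfeldT₃_adjAct (b : B) (v d : DualAlg φ ⊗[K] B) :
    tensorSum (fun b₁ b₂ => drinfeldT₃ h hS (adjAct h S b₁ v ⊗ₜ[K] smulLeftB h S b₂ d)) (Δ b) =
      adjActTensor h S b (drinfeldT₃ h hS (v ⊗ₜ[K] d)) := by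
  apply evalConvDH_injective hS
  simp (disch := fun_prop) only [LinearMap.map_tensorSum, evalConvDH_drinfeldT₃,
    evalConvDH_adjActTensor, adjAct_eq, evalConv_smulRightB, evalConv_heisenbergSmulLeftB,
    evalConv_smulLeftB, map_mul, AlgHom.map_tensorSum, tensorSum_mul, mul_tensorSum,
    heisenbergCoact_map_constConv, comul_antipodeEquiv hS, tensorSum_tensorSum, tensorSum_tmul,
    tensorSum_coassoc, tensorSum_coassoc_one]
  refine tensorSum_congr fun b₁ s => tensorSum_congr fun b₂ s => ?_
  refine .trans ((isCounital_antipodeEquiv_mul hS).sum_right (fun b₃ p =>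
    Conv.tmul (constConv _ b₁) (constConv _ b₂) * (heisenbergCoact hS).map (evalConv φ _ v) *
      Conv.tmul (constConv _ p * evalConv φ _ d) (constConv _ (S b₃)))
    (by fun_prop) (by fun_prop) (fun _ _ _ => by
      simp only [mul_assoc, Conv.tmul_mul_tmul, constConv_mul, mul_one]) s) ?_
  simp only [constConv_one, one_mul, mul_assoc, Conv.tmul_mul_tmul, mul_one]

theorem evalABAB_drinfeldT₃ (X : DualAlg φ ⊗[K] B) (a : DualAlg φ) (b x y : B) :
    evalABAB φ (drinfeldT₃ h hS (X ⊗ₜ[K] (a ⊗ₜ[K] b))) (x ⊗ₜ[K] y) =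
      tensorSum (fun x₁ x₂ => tensorSum (fun r s => tensorSum (fun r₁ t => tensorSum (fun r₂ r₃ =>
        pairing φ a (S.symm r₃ * x₂ * r₁) • ((r₂ * b) ⊗ₜ[K] s)) (Δ t)) (Δ r))
          (Δ (evalAB φ X (y * x₁)))) (Δ x) := by
  have e := DFunLike.congr_fun (j₂_drinfeldT₃ h hS X (a ⊗ₜ[K] b)) (x ⊗ₜ[K] y)
  rw [Realization.j₂, drinfeldRealization_j, mapTensor_evalConv_apply,
    Conv.mul_tmul_one_apply] at e
  rw [e]
  simp (disch := fun_prop) only [Hom.map_apply, drinfeldComul, mulOp_tmul, evalConv_apply,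
    Bialgebra.comulAlgHom_apply, evalAB_tmul, sum_drinfeldEntwining, tensorSum_tmul_const,
    mul_smul_comm, ← TensorProduct.smul_tmul']

theorem evalABAB_dualActTensor (a : DualAlg φ) (z : (DualAlg φ ⊗[K] B) ⊗[K] (DualAlg φ ⊗[K] B))
    (x y : B) : evalABAB φ (dualActTensor h hS a z) (x ⊗ₜ[K] y) =
      tensorSum (fun x₁ x₂ => tensorSum (fun y₁ s => tensorSum (fun y₂ y₃ => tensorSum (fun r c =>
        tensorSum (fun c₁ c₂ => pairing φ a (S.symm c₁ * S.symm y₃ * y₁ * x₁) • (r ⊗ₜ[K] c₂))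
          (Δ c)) (evalABAB φ z (x₂ ⊗ₜ[K] y₂))) (Δ s)) (Δ y)) (Δ x) := by
  revert z
  refine eq_of_tmul (by fun_prop) (by fun_prop) fun d w => ?_
  revert d
  refine eq_of_tmul (by fun_prop) (by fun_prop) fun a' b' => ?_
  have key : ∀ z, evalABAB φ (tensorSum (fun p q =>
      (q ⊗ₜ[K] b') ⊗ₜ[K] dualAct h S (pairing φ p) w) z) (x ⊗ₜ[K] y) =
      tensorSum (fun y₁ s => tensorSum (fun y₂ y₃ =>
        tensorSum (fun c₁ c₂ => evalAA φ z ((S.symm c₁ * S.symm y₃ * y₁) ⊗ₜ[K] x) • (b' ⊗ₜ[K] c₂))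
          (Δ (evalAB φ w y₂))) (Δ s)) (Δ y) := by
    refine eq_of_tmul (by fun_prop) (by fun_prop) fun p q => ?_
    simp (disch := fun_prop) only [tensorSum_tmul, evalABAB_tmul, evalAB_tmul, evalAB_dualAct,
      dualActHom_apply, const_tmul_tensorSum, evalAA_tmul, TensorProduct.tmul_smul,
      ← TensorProduct.smul_tmul', mul_smul]
  rw [dualActTensor_tmul, key]
  change tensorSum (fun y₁ s => tensorSum (fun y₂ y₃ => tensorSum (fun c₁ c₂ =>
    evalAA φ (transposeAA _ h.exists_galois₁ _) _ • (b' ⊗ₜ[K] c₂)) _) _) _ = _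
  simp (disch := fun_prop) only [evalAA_transposeAA, galois₁_tmul, LinearMap.map_tensorSum,
    evalAA_tmul, tensorSum_smul, evalABAB_tmul, evalAB_tmul, tensorSum_tmul,
    ← TensorProduct.smul_tmul', tensorSum_smul_arg, smul_tensorSum]
  simp only [tensorSum_comm (w := Δ x)]
  simp only [mul_comm _ (pairing φ a' _), mul_smul]

/-- The Yetter–Drinfel'd condition for `a ∈ A`. Evaluated at `x ⊗ y`, both sides become Sweedler
sums over `x`, `y` and the values of `X`, which agree after the contractions `∑ c₍₂₎ S⁻¹(c₍₁₎) = ε(c)` of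
the value `c` of `X` and `∑ x₍₂₎ S⁻¹(x₍₁₎) = ε(x)`. -/
theorem drinfeldT₃_dualAct (a a' : DualAlg φ) (b : B) (X : DualAlg φ ⊗[K] B) :
    tensorSum (fun p q => drinfeldT₃ h hS (dualAct h S (pairing φ q) X ⊗ₜ[K] (p ⊗ₜ[K] b)))
      ((h.hopfRealization hS).T₃ (a ⊗ₜ[K] a')) =
      dualActTensor h hS a (drinfeldT₃ h hS (X ⊗ₜ[K] (a' ⊗ₜ[K] b))) := by
  apply evalConvDH_injective hS
  apply Conv.ext_tmul; intro x y
  rw [evalConvDH, mapTensor_evalConv_apply, mapTensor_evalConv_apply]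
  have key : ∀ z, evalABAB φ (tensorSum (fun p q =>
      drinfeldT₃ h hS (dualAct h S (pairing φ q) X ⊗ₜ[K] (p ⊗ₜ[K] b))) z) (x ⊗ₜ[K] y) =
      tensorSum (fun y₁ t => tensorSum (fun y₂ y₃ =>
        tensorSum (fun x₁ t => tensorSum (fun x₂ t => tensorSum (fun x₃ x₄ =>
        tensorSum (fun c₁ t => tensorSum (fun c₂ t => tensorSum (fun c₃ t => tensorSum (fun c₄ c₅ =>
          evalAA φ z ((S.symm c₄ * x₄ * c₂) ⊗ₜ[K]
            (S.symm c₁ * (S.symm x₃ * (S.symm y₃ * (y₁ * x₁))))) • ((c₃ * b) ⊗ₜ[K] c₅))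
            (Δ t)) (Δ t)) (Δ t)) (Δ (evalAB φ X (y₂ * x₂)))) (Δ t)) (Δ t)) (Δ x)) (Δ t)) (Δ y) := by
    refine eq_of_tmul (by fun_prop) (by fun_prop) fun p q => ?_
    simp (disch := fun_prop) only [tensorSum_tmul, evalABAB_drinfeldT₃, evalAB_dualAct,
      dualActHom_apply, comul_mul_eq, evalAA_tmul, LinearMap.map_tensorSum, map_smul,
      tensorSum_smul_arg, mul_smul, smul_tensorSum, tensorSum_tensorSum, tensorSum_coassoc,
      tensorSum_coassoc_one, tensorSum_coassoc_two, antipodeEquiv_symm_mul hS, mul_assoc]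
    simp only [tensorSum_comm (w := Δ y)]
    refine tensorSum_congr fun y₁ t => ?_
    simp only [tensorSum_comm (w := Δ t)]
    simp only [smul_comm (pairing φ p _)]
  rw [key, evalABAB_dualActTensor]
  change tensorSum (fun y₁ t => tensorSum (fun y₂ y₃ =>
        tensorSum (fun x₁ t => tensorSum (fun x₂ t => tensorSum (fun x₃ x₄ =>
        tensorSum (fun c₁ t => tensorSum (fun c₂ t => tensorSum (fun c₃ t => tensorSum (fun c₄ c₅ =>
          evalAA φ (transposeAA _ h.exists_galois₃ _) _ • ((c₃ * b) ⊗ₜ[K] c₅))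
            _) _) _) _) _) _) _) _) _ = _
  simp (disch := fun_prop) only [evalAA_transposeAA, galois₃_tmul, evalABAB_drinfeldT₃,
    comul_mul_eq, comul_antipodeEquiv_symm hS, LinearMap.map_tensorSum,
    evalAA_tmul, tensorSum_smul, tensorSum_tmul, tensorSum_tensorSum,
    tensorSum_smul_arg, smul_tensorSum, tensorSum_coassoc,
      mul_assoc, mul_smul]
  -- the contraction in the value of `X`
  have hc : ∀ k u w : B, tensorSum (fun c₁ t => tensorSum (fun c₂ t => tensorSum (fun c₃ t =>
      tensorSum (fun c₄ t => tensorSum (fun c₅ c₆ => tensorSum (fun u₁ u₂ =>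
        tensorSum (fun e₁ e₂ => pairing φ a (S.symm c₅ * (u₁ * (e₁ * (S.symm c₁ * k)))) •
          pairing φ a' (S.symm c₄ * (u₂ * e₂)) • (c₃ * b) ⊗ₜ[K] c₆) (Δ c₂)) (Δ u)) (Δ t))
            (Δ t)) (Δ t)) (Δ t)) (Δ w) =
      tensorSum (fun u₁ u₂ => tensorSum (fun c₁ t => tensorSum (fun c₂ t => tensorSum (fun c₃ t =>
        tensorSum (fun c₄ c₅ => pairing φ a (S.symm c₄ * (u₁ * k)) •
          pairing φ a' (S.symm c₃ * (u₂ * c₁)) • (c₂ * b) ⊗ₜ[K] c₅) (Δ t)) (Δ t)) (Δ t)) (Δ w))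
            (Δ u) := by
    intro k u w
    simp only [tensorSum_comm (w := Δ u)]
    refine tensorSum_congr fun u₁ u₂ => ?_
    refine .trans (tensorSum_congr fun c₁ t => .trans
      (tensorSum_congr fun c₂ t => by simp only [tensorSum_comm (w := Δ c₂)])
      (tensorSum_coassoc (f := fun e₁ e₂ t => tensorSum (fun c₃ t =>
        tensorSum (fun c₄ t => tensorSum (fun c₅ c₆ =>
          pairing φ a (S.symm c₅ * (u₁ * (e₁ * (S.symm c₁ * k)))) •
          pairing φ a' (S.symm c₄ * (u₂ * e₂)) • (c₃ * b) ⊗ₜ[K] c₆) (Δ t))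
            (Δ t)) (Δ t)) (by fun_prop) (by fun_prop) (by fun_prop) t)) ?_
    refine .trans ((isCounital_mul_antipodeEquiv_symm hS).sum_left (fun p t =>
      tensorSum (fun c₁ t => tensorSum (fun c₂ t => tensorSum (fun c₃ t =>
        tensorSum (fun c₄ c₅ => pairing φ a (S.symm c₄ * (u₁ * (p * k))) •
          pairing φ a' (S.symm c₃ * (u₂ * c₁)) • (c₂ * b) ⊗ₜ[K] c₅) (Δ t)) (Δ t)) (Δ t)) (Δ t))
      (by fun_prop) (by fun_prop) (fun _ _ _ => by simp only [mul_assoc]) w) ?_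
    simp only [one_mul]
  simp only [hc]
  simp only [tensorSum_comm (w := Δ y)]
  refine tensorSum_congr fun y₁ t => ?_
  simp only [tensorSum_comm (w := Δ t)]
  refine tensorSum_congr fun y₂ y₃ => tensorSum_congr fun x₁ t => tensorSum_congr fun x₂ t => ?_
  refine .trans ((isCounital_mul_antipodeEquiv_symm hS).sum_left (fun p u =>
      tensorSum (fun c₁ t => tensorSum (fun c₂ t => tensorSum (fun c₃ t =>
        tensorSum (fun c₄ c₅ => pairing φ a (S.symm c₄ * (p * (S.symm y₃ * (y₁ * x₁)))) •
          pairing φ a' (S.symm c₃ * (u * c₁)) • (c₂ * b) ⊗ₜ[K] c₅) (Δ t)) (Δ t)) (Δ t))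
            (Δ (evalAB φ X (y₂ * x₂))))
      (by fun_prop) (by fun_prop) (fun _ _ _ => by simp only [mul_assoc]) t) ?_
  simp only [one_mul, smul_comm (pairing φ a _)]

/-- The Yetter–Drinfel'd condition. For `d = a b` it follows from the conditions for `b` and for
`a`. -/
theorem heisenberg_yetterDrinfeld (d d' v : DualAlg φ ⊗[K] B) :
    TensorProduct.lift ((drinfeldHopfRealization h hS).coactLeft ∘ₗ (heisenbergAct h S).flip v)
        (drinfeldT₁ h hS (d ⊗ₜ[K] d')) =
      (TensorProduct.lift (heisenbergAct h S)).lTensor _ (TensorProduct.assoc K _ _ _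
        (((drinfeldT₃ h hS).toLinearMap ∘ₗ TensorProduct.mk K _ _ d).rTensor _
          (drinfeldT₃ h hS (v ⊗ₜ[K] d')))) := by
  revert d
  refine eq_of_tmul (by fun_prop) ⟨fun c d => ?_, fun k d => ?_⟩ fun a b => ?_
  · rw [map_add (TensorProduct.mk K _ _), LinearMap.comp_add, LinearMap.rTensor_add,
      LinearMap.add_apply, map_add, map_add]
  · rw [map_smul (TensorProduct.mk K _ _), LinearMap.comp_smul, LinearMap.rTensor_smul,
      LinearMap.smul_apply, map_smul, map_smul]
  have key : ∀ (b₁ : B) (e : DualAlg φ ⊗[K] B),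
      TensorProduct.lift ((drinfeldHopfRealization h hS).coactLeft ∘ₗ (heisenbergAct h S).flip v)
        (mapFst (LinearEquiv.ofBijective _ (h.hopfRealization hS).T₃_bijective ≪≫ₗ
          TensorProduct.comm K _ _) ((a ⊗ₜ[K] b₁) ⊗ₜ[K] e)) =
      dualActTensor h hS a (drinfeldT₃ h hS (adjAct h S b₁ v ⊗ₜ[K] e)) := by
    intro b₁
    refine eq_of_tmul (by fun_prop) (by fun_prop) fun a' b' => ?_
    rw [← drinfeldT₃_dualAct, mapFst_tmul, LinearEquiv.trans_apply, LinearEquiv.ofBijective_apply]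
    generalize (h.hopfRealization hS).T₃ (a ⊗ₜ[K] a') = z
    revert z
    refine eq_of_tmul (by fun_prop) (by fun_prop) fun p q => ?_
    simp (disch := fun_prop) only [TensorProduct.comm_tmul, tensorSum_tmul,
      TensorProduct.lift.tmul, LinearMap.comp_apply, LinearMap.flip_apply, heisenbergAct_tmul,
      drinfeld_coactLeft_apply]
  rw [lTensor_act_drinfeldT₃, ← drinfeldT₃_adjAct]
  simp only [drinfeldT₁_tmul, LinearMap.map_tensorSum, key]

end YetterDrinfeld

/-! ### The Yetter–Drinfel'd module algebra -/

section YetterDrinfeld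

variable {K B : Type*} [Field K] [Ring B] [HopfAlgebra K B] {φ : Module.Dual K B} {S : B ≃ₗ[K] B}
  (h : IsRationalDual φ) (hS : (S : B →ₗ[K] B) = HopfAlgebra.antipode K)

/-- The Heisenberg double as a Yetter–Drinfel'd module algebra over the Drinfel'd double. -/
def heisenbergYetterDrinfeld :
    YetterDrinfeldModuleAlgebra (drinfeldDouble h hS) (heisenbergDouble h) where
  act := heisenbergAct h S
  mul_act := heisenbergAct_mul_act h hS
  unital := heisenbergAct_surjective h hS
  coactLeft := (drinfeldHopfRealization h hS).coactLeft
  coactRight := (drinfeldHopfRealization h hS).coactRight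
  coact_compat := (drinfeldHopfRealization h hS).coact_compat
  coact_injective := (drinfeldHopfRealization h hS).coact_injective
  coact_coassoc := (drinfeldHopfRealization h hS).coact_coassoc
  yetter_drinfeld := heisenberg_yetterDrinfeld h hS
  act_mul := heisenbergAct_mul h hS
  coact_mul := drinfeldT₂_heisenberg_mul h hS

end YetterDrinfeld

/-- The structures `𝒜`, `𝒟`, `ℋ` and `Y` are uniquely determined by the formulas they are required
to satisfy; that these formulas do define maps of the required kind is part of the claim. -/
theorem theorem5p2 {K B : Type*} [Field K] [Ring B] [HopfAlgebra K B]
    (φ : Module.Dual K B) (hφ : IsLeftIntegral φ) (hφ0 : φ ≠ 0) :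
    ∃ S : B ≃ₗ[K] B, (S : B →ₗ[K] B) = HopfAlgebra.antipode K ∧
    ∃ 𝒜 : RegularMultiplierHopfAlgebra K (DualAlg φ), IsDualOf φ 𝒜 ∧
    ∃ 𝒟 : RegularMultiplierHopfAlgebra K (DualAlg φ ⊗[K] B), IsDrinfeldDouble S φ 𝒟 ∧
    ∃ ℋ : NondegenerateAlgebra K (DualAlg φ ⊗[K] B), IsHeisenbergDouble φ ℋ ∧
    ∃ Y : YetterDrinfeldModuleAlgebra 𝒟 ℋ,
      IsHeisenbergAction S φ Y.act ∧ IsHeisenbergCoaction S φ Y.coactRight ∧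
      Y.BraidedCommutative := by
  let S : B ≃ₗ[K] B := LinearEquiv.ofBijective (HopfAlgebra.antipode K)
    ⟨hφ.antipode_injective hφ0, hφ.antipode_surjective hφ0⟩
  have hS : (S : B →ₗ[K] B) = HopfAlgebra.antipode K := rfl
  have h := hφ.isRationalDual hS hφ0
  exact ⟨S, hS, (h.hopfRealization hS).regularMultiplierHopfAlgebra, h.isDualOf hS,
    drinfeldDouble h hS, isDrinfeldDouble_drinfeldDouble h hS,
    heisenbergDouble h, isHeisenbergDouble_heisenbergDouble h,
    heisenbergYetterDrinfeld h hS, isHeisenbergAction_heisenbergAct h,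
    isHeisenbergCoaction_drinfeldT₂ h hS, heisenberg_braidedCommutative h hS⟩
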